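/- Let $M$ be a smooth $n$-dimensional manifold and let $D$ be an $(m,n)$-distribution on $M$, i.e. a smooth rank-$m$ subbundle of $TM$. A sub-Riemannian metric $G$ on $D$ is an inner product $G_q$ on each $D(q)$, depending smoothly on $q$; its Hamiltonian is $h(p,q)=\frac12\bigl(\max\{p(v): v\in D(q),\ G_q(v,v)=1\}\bigr)^2$ on $T^*M$ (with $h(p,q)=0$ if $D(q)=0$), and its normal geodesics are the projections to $M$ of the trajectories of the Hamiltonian vector field $\vec h$ lying on the level set $H=\{h=\frac12\}$. Let $G_1,G_2$ be two sub-Riemannian metrics on $D$, with Hamiltonians $h_1,h_2$ and level sets $H_1,H_2$. They are geodesically equivalent at $q_0\in M$ if in some neighborhood of $q_0$ all their normal geodesics, considered as unparametrized curves, coincide. An orbital diffeomorphism of their extremal flows on a nonempty (relatively) open subset $\mathcal B$ of $H_1$ is a smooth map $\Phi:\mathcal B\to H_2$ which is a diffeomorphism onto its image, preserves the fibers of $\pi:T^*M\to M$, and satisfies $\Phi_*\vec h_1(\lambda)=a(\lambda)\,\vec h_2(\Phi(\lambda))$ for all $\lambda\in\mathcal B$ with some function $a:\mathcal B\to\mathbb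 R$. Let $\mathcal I_1:D(q)^*\to D(q)$ be the isomorphism with $\ell(\cdot)=G_{1,q}(\mathcal I_1\ell,\cdot)$ and let $\mathcal P(p,q)=G_{2,q}\bigl(\mathcal I_1(p|_{D(q)}),\mathcal I_1(p|_{D(q)})\bigr)$. The pair $(G_1,G_2)$ satisfies the first divisibility condition on $U\subset M$ if for each $q\in U$ the restrictions of $\mathcal P$ and of its derivative $\vec h_1(\mathcal P)$ along $\vec h_1$ to the fiber $T_q^*M$ are homogeneous polynomials of degree $2$ and $3$ respectively (possibly zero), and the first divides the second. (1) Suppose that $D=TM$, or that $D$ is a contact distribution ($n$ is odd, $m=n-1$, and near each point $D=\ker\omega$ for a smooth $1$-form $\omega$ such that $d\omega|_D$ is nondegenerate at each point), or that $D$ is a quasi-contact distribution ($n$ is even, $m=n-1$, and near each point $D=\ker\omega$ for a smooth $1$-form $\omega$ such that $d\omega|_D$ has a one-dimensional kernel at each point). If $G_1$ and $G_2$ are geodesically equivalent at $q_0\in M$, then the pair $(G_1,G_2)$ satisfies the first divisibility condition on some open neighborhood $U$ of $q_0$. (2) Let $D^1=D$ and $D^s=D^{s-1}+[D,D^{s-1}]$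 for $s\ge 2$, and suppose that $\dim D^s(q)=m+s-1$ for all $q\in M$ and all $1\le s\le n-m+1$. Suppose also that for an open set $U\subset M$ there is an orbital diffeomorphism of the extremal flows of $G_1$ and $G_2$ on a nonempty open subset $\mathcal B$ of $H_1\cap T^*U$ with $\pi(\mathcal B)=U$. Then the pair $(G_1,G_2)$ satisfies the first divisibility condition on $U$. -/

import Mathlib

open scoped Manifold ContDiff

noncomputable section

namespace SubRiem

/-- The model space of an `n`-dimensional manifold. -/
abbrev Model (n : ℕ) : Type := EuclideanSpace ℝ (Fin n)

section Manifold

variable (n : ℕ) (M : Type*) [TopologicalSpace M] [ChartedSpace (Model n) M]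
  [IsManifold (𝓡 n) ∞ M]

/-- The cotangent space `T_q^* M`. -/
abbrev CotangentSpace (q : M) : Type _ :=
  TangentSpace (𝓡 n) q →L[ℝ] Bundle.Trivial M ℝ q

/-- The cotangent bundle `T^* M`, with the topology and the smooth structure that Mathlib puts on
the bundle of continuous linear maps from the tangent bundle to the trivial line bundle. Its
preferred chart at `lam` is the canonical chart `(q, p) ↦ (φ q, p ∘ (d_q φ)⁻¹)` induced by
the preferred chart `φ` of `M` at the base point of `lam`. -/
abbrev CotangentBundle : Type _ :=
  Bundle.TotalSpace (Model n →L[ℝ] ℝ) (CotangentSpace n M)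

/-- The model with corners of the `2n`-dimensional manifold `T^* M` (it has no boundary). -/
abbrev cotangentModel : ModelWithCorners ℝ (Model n × (Model n →L[ℝ] ℝ))
    (ModelProd (Model n) (Model n →L[ℝ] ℝ)) :=
  (𝓡 n).prod 𝓘(ℝ, Model n →L[ℝ] ℝ)

variable {n M}

/-- A vector field `X` is smooth on `U`. -/
def SmoothFieldOn (X : (q : M) → TangentSpace (𝓡 n) q) (U : Set M) : Prop :=
  ContMDiffOn (𝓡 n) (𝓡 n).tangent ∞ (fun q => (⟨q, X q⟩ : TangentBundle (𝓡 n) M)) U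

/-- A differential `1`-form `η` is smooth on `U`. -/
def SmoothFormOn (η : (q : M) → CotangentSpace n M q) (U : Set M) : Prop :=
  ContMDiffOn (𝓡 n) (cotangentModel n) ∞ (fun q => (⟨q, η q⟩ : CotangentBundle n M)) U

/-- The coordinate expression of the `1`-form `η` in the preferred chart `φ` at `q`, i.e. the
pull-back of `η` by `φ⁻¹`. -/
def formInChart (η : (q : M) → CotangentSpace n M q) (q : M) (x : Model n) :
    Model n →L[ℝ] ℝ :=
  (η ((extChartAt (𝓡 n) q).symm x)).comp
    (mfderiv 𝓘(ℝ, Model n) (𝓡 n) (extChartAt (𝓡 n) q).symm x)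

/-- The exterior derivative at `q` of a `1`-form `η`, as a bilinear form on `T_q M`: in the
coordinates of the preferred chart at `q` it is
`dη (v, w) = (∂_v η) (w) - (∂_w η) (v)`. -/
def extDerivForm (η : (q : M) → CotangentSpace n M q) (q : M) :
    LinearMap.BilinForm ℝ (TangentSpace (𝓡 n) q) :=
  let A : Model n →L[ℝ] Model n →L[ℝ] ℝ :=
    fderiv ℝ (formInChart η q) (extChartAt (𝓡 n) q q)
  (A - A.flip).toLinearMap₁₂

/-- The Hamiltonian vector field of a function `h` on `T^* M`. In the canonical coordinates
`(x, p)` of the preferred chart at `lam` it is `(∂h/∂p, -∂h/∂x)`. -/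
def hamiltonianField (h : CotangentBundle n M → ℝ) (lam : CotangentBundle n M) :
    TangentSpace (cotangentModel n) lam :=
  let dh : Model n × (Model n →L[ℝ] ℝ) →L[ℝ] ℝ := mfderiv (cotangentModel n) 𝓘(ℝ, ℝ) h lam
  ((WithLp.toLp 2 (fun i : Fin n => dh (0, EuclideanSpace.proj i)) : Model n),
    -(dh.comp (ContinuousLinearMap.inl ℝ (Model n) (Model n →L[ℝ] ℝ))))

/-- The derivative `X(f)` at `lam` of a function `f` on `T^* M` along a vector `X`. -/
def derivAlong (f : CotangentBundle n M → ℝ) (lam : CotangentBundle n M)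
    (X : TangentSpace (cotangentModel n) lam) : ℝ :=
  (mfderiv (cotangentModel n) 𝓘(ℝ, ℝ) f lam : Model n × (Model n →L[ℝ] ℝ) →L[ℝ] ℝ) X

instance (q : M) : FiniteDimensional ℝ (TangentSpace (𝓡 n) q) :=
  inferInstanceAs (FiniteDimensional ℝ (Model n))

end Manifold

/-- An `(m, n)`-distribution: a smooth subbundle of rank `m` of the tangent bundle of the
`n`-dimensional manifold `M`. -/
structure VectorDistribution (m n : ℕ) (M : Type*) [TopologicalSpace M]
    [ChartedSpace (Model n) M] [IsManifold (𝓡 n) ∞ M] where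
  /-- The subspace `D(q)` of `T_q M`. -/
  fiber : (q : M) → Submodule ℝ (TangentSpace (𝓡 n) q)
  exists_local_basis : ∀ q₀ : M, ∃ U : Set M, IsOpen U ∧ q₀ ∈ U ∧
    ∃ X : Fin m → (q : M) → TangentSpace (𝓡 n) q,
      (∀ i, SmoothFieldOn (X i) U) ∧
      ∀ q ∈ U, LinearIndependent ℝ (fun i => X i q) ∧
        Submodule.span ℝ (Set.range fun i => X i q) = fiber q

variable {m n : ℕ} {M : Type*} [TopologicalSpace M] [ChartedSpace (Model n) M]
  [IsManifold (𝓡 n) ∞ M]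

namespace VectorDistribution

variable (D : VectorDistribution m n M)

/-- The power `D^s`: `D^1 = D` and `D^s = D^(s-1) + [D, D^(s-1)]` (and `D^0 = 0` by
convention). -/
def power : ℕ → (q : M) → Submodule ℝ (TangentSpace (𝓡 n) q)
  | 0 => fun _ => ⊥
  | 1 => D.fiber
  | s + 2 => fun q => power (s + 1) q ⊔ Submodule.span ℝ
      {v | ∃ (U : Set M) (X Y : (x : M) → TangentSpace (𝓡 n) x),
        IsOpen U ∧ q ∈ U ∧ SmoothFieldOn X U ∧ SmoothFieldOn Y U ∧
        (∀ x ∈ U, X x ∈ D.fiber x) ∧ (∀ x ∈ U, Y x ∈ power (s + 1) x) ∧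
        v = VectorField.mlieBracket (𝓡 n) X Y q}

/-- `D = TM`. -/
def IsTangentBundle : Prop := ∀ q, D.fiber q = ⊤

/-- The restriction `dη|_D` to `D(q)` of the exterior derivative of a `1`-form. -/
def restrictedExtDeriv (η : (q : M) → CotangentSpace n M q) (q : M) :
    LinearMap.BilinForm ℝ (D.fiber q) :=
  (extDerivForm η q).domRestrict₁₂ (D.fiber q) (D.fiber q)

/-- The `1`-form `η` annihilates `D` on `U`, in the sense that `D(q)` is the kernel of `η_q`. -/
def IsDefiningForm (η : (q : M) → CotangentSpace n M q) (U : Set M) : Prop :=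
  SmoothFormOn η U ∧ ∀ q ∈ U, ∀ v : TangentSpace (𝓡 n) q, v ∈ D.fiber q ↔ η q v = 0

/-- `D` is a contact distribution: a corank `1` distribution on an odd-dimensional manifold,
given near each point by a `1`-form `η` such that `dη|_D` is nondegenerate at each point. -/
structure IsContact : Prop where
  corank_one : m + 1 = n
  odd_dim : Odd n
  exists_form : ∀ q₀ : M, ∃ U : Set M, IsOpen U ∧ q₀ ∈ U ∧
    ∃ η : (q : M) → CotangentSpace n M q, D.IsDefiningForm η U ∧
      ∀ q ∈ U, LinearMap.ker (D.restrictedExtDeriv η q) = ⊥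

/-- `D` is a quasi-contact distribution: a corank `1` distribution on an even-dimensional
manifold, given near each point by a `1`-form `η` such that `dη|_D` has a one-dimensional kernel
at each point. -/
structure IsQuasiContact : Prop where
  corank_one : m + 1 = n
  even_dim : Even n
  exists_form : ∀ q₀ : M, ∃ U : Set M, IsOpen U ∧ q₀ ∈ U ∧
    ∃ η : (q : M) → CotangentSpace n M q, D.IsDefiningForm η U ∧
      ∀ q ∈ U, Module.finrank ℝ (LinearMap.ker (D.restrictedExtDeriv η q)) = 1

end VectorDistribution

/-- A sub-Riemannian metric on `D`: an inner product on each `D(q)`, smooth in `q`. -/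
structure Metric (D : VectorDistribution m n M) where
  /-- The inner product on `D(q)`. -/
  form : (q : M) → LinearMap.BilinForm ℝ (D.fiber q)
  symm : ∀ q v w, form q v w = form q w v
  pos : ∀ q v, v ≠ 0 → 0 < form q v v
  smooth : ∀ (U : Set M) (X Y : (q : M) → D.fiber q), IsOpen U →
    SmoothFieldOn (fun q => (X q : TangentSpace (𝓡 n) q)) U →
    SmoothFieldOn (fun q => (Y q : TangentSpace (𝓡 n) q)) U →
    ContMDiffOn (𝓡 n) 𝓘(ℝ, ℝ) ∞ (fun q => form q (X q) (Y q)) U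

variable {D : VectorDistribution m n M}

/-- The restriction `p|_{D(q)}` of a covector `p` in `T_q^* M`. -/
def restrictCovector (D : VectorDistribution m n M) (lam : CotangentBundle n M) :
    Module.Dual ℝ (D.fiber lam.proj) :=
  LinearMap.domRestrict
    (ContinuousLinearMap.toLinearMap lam.snd : TangentSpace (𝓡 n) lam.proj →ₗ[ℝ] ℝ)
    (D.fiber lam.proj)

namespace Metric

theorem nondegenerate (G : Metric D) (q : M) : (G.form q).Nondegenerate := by
  refine ⟨fun v hv => ?_, fun v hv => ?_⟩ <;>
  · by_contra h
    exact (G.pos q v h).ne' (hv v)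

/-- The canonical isomorphism `D(q)^* → D(q)` of the inner product, `l = G_q (I l, ·)`. -/
def sharp (G : Metric D) (q : M) : Module.Dual ℝ (D.fiber q) ≃ₗ[ℝ] D.fiber q :=
  (LinearMap.BilinForm.toDual (G.form q) (G.nondegenerate q)).symm

/-- The Hamiltonian `h (p, q) = (max {p(v) : v ∈ D(q), ‖v‖_q = 1})² / 2`. -/
def hamiltonian (G : Metric D) (lam : CotangentBundle n M) : ℝ :=
  (1 / 2) * (sSup {r : ℝ | ∃ v : D.fiber lam.proj, G.form lam.proj v v = 1 ∧
    r = restrictCovector D lam v}) ^ 2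

/-- The Hamiltonian vector field of the Hamiltonian of `G`. -/
def flowField (G : Metric D) (lam : CotangentBundle n M) :
    TangentSpace (cotangentModel n) lam :=
  hamiltonianField G.hamiltonian lam

/-- The `1/2`-level set of the Hamiltonian. -/
def levelSet (G : Metric D) : Set (CotangentBundle n M) :=
  {lam | G.hamiltonian lam = 1 / 2}

/-- `γ`, on the open interval `J`, is a normal sub-Riemannian geodesic: the projection of a
trajectory of the Hamiltonian field that lies on the `1/2`-level set of the Hamiltonian. -/
def IsNormalGeodesic (G : Metric D) (γ : ℝ → M) (J : Set ℝ) : Prop :=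
  IsOpen J ∧ J.OrdConnected ∧ ∃ lam : ℝ → CotangentBundle n M,
    IsMIntegralCurveOn (I := cotangentModel n) lam G.flowField J ∧
    ∀ t ∈ J, lam t ∈ G.levelSet ∧ (lam t).proj = γ t

/-- Each normal geodesic of `G₁` in `U` is, up to a reparametrization, a normal geodesic of
`G₂`. -/
def GeodesicsSubsume (G₁ G₂ : Metric D) (U : Set M) : Prop :=
  ∀ (γ : ℝ → M) (J : Set ℝ), G₁.IsNormalGeodesic γ J → Set.MapsTo γ J U →
    ∃ (γ' : ℝ → M) (J' : Set ℝ) (τ : ℝ → ℝ), G₂.IsNormalGeodesic γ' J' ∧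
      ContDiffOn ℝ ∞ τ J ∧ (∀ t ∈ J, 0 < deriv τ t) ∧ τ '' J = J' ∧
      ∀ t ∈ J, γ t = γ' (τ t)

/-- `G₁` and `G₂` are geodesically equivalent at `q₀`: in some neighborhood of `q₀` all their
normal geodesics, considered as unparametrized curves, coincide. -/
def GeodesicallyEquivalentAt (G₁ G₂ : Metric D) (q₀ : M) : Prop :=
  ∃ U : Set M, IsOpen U ∧ q₀ ∈ U ∧ GeodesicsSubsume G₁ G₂ U ∧ GeodesicsSubsume G₂ G₁ U

/-- `Φ` is an orbital diffeomorphism of the extremal flows of `G₁` and `G₂` on `B`, a nonempty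
open subset of the level set `H₁`: a fiberwise diffeomorphism of `B` onto its image in `H₂` that
maps the field `h₁` at `lam` to a multiple of the field `h₂` at `Φ lam`.
(The field `h₁` is tangent to `H₁`, so any derivative of `Φ` within `B` takes the same value
on it.) -/
structure IsOrbitalDiffeo (G₁ G₂ : Metric D) (B : Set (CotangentBundle n M))
    (Φ : CotangentBundle n M → CotangentBundle n M) : Prop where
  nonempty : B.Nonempty
  isOpen : ∃ O : Set (CotangentBundle n M), IsOpen O ∧ B = O ∩ G₁.levelSet
  fiberwise : ∀ lam ∈ B, (Φ lam).proj = lam.proj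
  mapsTo : Set.MapsTo Φ B G₂.levelSet
  smooth : ContMDiffOn (cotangentModel n) (cotangentModel n) ∞ Φ B
  smooth_inverse : ∃ Ψ : CotangentBundle n M → CotangentBundle n M,
    ContMDiffOn (cotangentModel n) (cotangentModel n) ∞ Ψ (Φ '' B) ∧ Set.LeftInvOn Ψ Φ B
  conj : ∃ a : CotangentBundle n M → ℝ, ∀ lam ∈ B,
    ∃ L : TangentSpace (cotangentModel n) lam →L[ℝ] TangentSpace (cotangentModel n) (Φ lam),
      HasMFDerivWithinAt (cotangentModel n) (cotangentModel n) Φ B lam L ∧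
      L (G₁.flowField lam) = a lam • G₂.flowField (Φ lam)

/-- The function `P (p, q) = ‖I₁ (p|_{D(q)})‖₂²` on `T^* M`. -/
def transitionQuadric (G₁ G₂ : Metric D) (lam : CotangentBundle n M) : ℝ :=
  G₂.form lam.proj (G₁.sharp lam.proj (restrictCovector D lam))
    (G₁.sharp lam.proj (restrictCovector D lam))

/-- The derivative of `P` along the Hamiltonian field of `G₁`. -/
def transitionCubic (G₁ G₂ : Metric D) (lam : CotangentBundle n M) : ℝ :=
  derivAlong (transitionQuadric G₁ G₂) lam (G₁.flowField lam)

/-- The function `f` on `T^* M` is given on the fiber `T_q^* M` by the polynomial `P` in the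
linear coordinates `p ↦ p (b i)` of a basis `b` of `T_q M`. -/
def IsFiberPolynomial (f : CotangentBundle n M → ℝ) (q : M)
    (b : Module.Basis (Fin n) ℝ (TangentSpace (𝓡 n) q)) (P : MvPolynomial (Fin n) ℝ) : Prop :=
  ∀ p : CotangentSpace n M q, f ⟨q, p⟩ = MvPolynomial.eval (fun i => (p (b i) : ℝ)) P

/-- The first divisibility condition on `U`: on each fiber over `U`, the quadratic polynomial `P`
divides the cubic polynomial `h₁ (P)`. -/
def FirstDivisibility (G₁ G₂ : Metric D) (U : Set M) : Prop :=
  ∀ q ∈ U, ∀ b : Module.Basis (Fin n) ℝ (TangentSpace (𝓡 n) q),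
    ∃ P R : MvPolynomial (Fin n) ℝ, P.IsHomogeneous 2 ∧ R.IsHomogeneous 3 ∧
      IsFiberPolynomial (transitionQuadric G₁ G₂) q b P ∧
      IsFiberPolynomial (transitionCubic G₁ G₂) q b R ∧ P ∣ R

end Metric

end SubRiem

end

/-!
Let `c i` be the components of the velocity `I₁ (p|_D)` in a local frame `X` of `D`. They are linear
on the fibers of `T^* M`, and the bracket formula for momentum functions
(`Metric.derivAlong_momentum_flowField`) describes the flow of `h₁` in terms of the `c i`, the
brackets of the frame and the derivatives of the Gram matrix.

A geodesic equivalence and an orbital diffeomorphism both give, through each covector of the level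
set that concerns them, a trajectory `lam` of the flow of `G₁` together with a curve `mu` over the
same curve of `M` that is a trajectory of the flow of `G₂` up to a change of the parameter with
derivative `a` (`LinkedTrajectories`). Comparing the two velocities one finds that `a ^ 2 = P` along
`lam`, and that the rescaled momentum `a u_Y (mu)` of a field `Y` in the frame is a *linear* function
of `lam`. Every rescaled momentum satisfies the linear equation
`w_Y' = (P' / 2P) w_Y + ∑ c i w_[X i, Y] + (a quadratic form)`
(`LinkedTrajectories.exists_hasDerivAt_rescaled`).

Suppose that `P` does not divide the cubic `h₁ (P) = P'` on the fiber over `q`. For `D` of rank at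
least `2` the quadratic form `P` has rank at least `2` and is positive semidefinite, so it is a prime
polynomial over `ℝ`. Take a chain of fields `Y 0 = X i₀, Y 1, …, Y r` in which `Y (s + 1)` is a
bracket of the frame with `Y s` up to earlier fields, and in which all brackets of the frame with
`Y r` are again combinations of the frame and the chain (`IsBracketChain`). The differential equation
expresses the rescaled momentum of `Y s` as a rational function `N / (Q P ^ s)` of `lam` with `N`
and `Q` prime to `P`: each differentiation adds one more factor `P` to the denominator, because the
numerator of the worst term is a multiple of `P' N`. At the end of the chain the equation forces
`P` to divide `Q P' N`, a contradiction (`IsBracketChain.fiberDvd_transitionCubic`). Here a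
homogeneous polynomial that vanishes on an open piece of the level set over `q` vanishes, by
homogeneity. If `D` has rank at most `1`, the metrics are conformal and `P' = f P` trivially.

Chains exist when the dimension of the powers of `D` grows by one at each step
(`exists_isBracketChain`), and this includes the case `D = TM` and the contact and quasi-contact
distributions of rank at least `2`: there `dη|_D ≠ 0`, so `[D, D] = TM` by Cartan's formula
(`VectorDistribution.power_two_eq_top`).
-/

noncomputable section

namespace SubRiem

open Bundle Filter Topology VectorField

/-! ### Momentum functions and Hamiltonian fields in charts -/

section

variable {n : ℕ} {M : Type*} [TopologicalSpace M] [ChartedSpace (Model n) M]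
  [IsManifold (𝓡 n) ∞ M]

/-- The momentum function `(q, p) ↦ p (Y q)` of a vector field `Y`. -/
def momentum (Y : (q : M) → TangentSpace (𝓡 n) q) (lam : CotangentBundle n M) : ℝ :=
  lam.snd (Y lam.proj)

/-- The differential `d_q f` of a function on `M`, as a linear form on `T_q M`. -/
def differential (f : M → ℝ) (q : M) : TangentSpace (𝓡 n) q →L[ℝ] ℝ :=
  mfderiv (𝓡 n) 𝓘(ℝ, ℝ) f q

/-- The projection to `T_q M` of a tangent vector of `T^* M`. -/
def projVector {lam : CotangentBundle n M} (w : TangentSpace (cotangentModel n) lam) :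
    TangentSpace (𝓡 n) lam.proj :=
  (w : Model n × (Model n →L[ℝ] ℝ)).1

/-- The component of a tangent vector of `T^* M` along the fiber, in the preferred chart. -/
def fiberVector {lam : CotangentBundle n M} (w : TangentSpace (cotangentModel n) lam) :
    CotangentSpace n M lam.proj :=
  (w : Model n × (Model n →L[ℝ] ℝ)).2

/-- The components of the vector field `Y` in the preferred chart at `q`. -/
def fieldInChart (Y : (q : M) → TangentSpace (𝓡 n) q) (q : M) (x : Model n) : Model n :=
  (trivializationAt (Model n) (TangentSpace (𝓡 n)) q).continuousLinearMapAt ℝ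
    ((extChartAt (𝓡 n) q).symm x) (Y ((extChartAt (𝓡 n) q).symm x))

theorem _root_.HasMFDerivAt.derivAlong_eq {f : CotangentBundle n M → ℝ}
    {lam : CotangentBundle n M} {L : Model n × (Model n →L[ℝ] ℝ) →L[ℝ] ℝ}
    (h : HasMFDerivAt (cotangentModel n) 𝓘(ℝ, ℝ) f lam L)
    (w : TangentSpace (cotangentModel n) lam) : derivAlong f lam w = L w := by
  rw [derivAlong, h.mfderiv]
  rfl

theorem contMDiffAt_momentum {Y : (q : M) → TangentSpace (𝓡 n) q} {lam : CotangentBundle n M}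
    (hY : ContMDiffAt (𝓡 n) (𝓡 n).tangent ∞ (fun q => (⟨q, Y q⟩ : TangentBundle (𝓡 n) M))
      lam.proj) : ContMDiffAt (cotangentModel n) 𝓘(ℝ, ℝ) ∞ (momentum Y) lam := by
  have h1 : ContMDiffAt (cotangentModel n) (𝓡 n) ∞
      (fun l : CotangentBundle n M => l.proj) lam := contMDiffAt_proj _
  have h2 := hY.comp lam h1
  have h3 := ContMDiffAt.clm_bundle_apply (𝕜 := ℝ) (F₁ := Model n) (F₂ := ℝ)
    (E₁ := TangentSpace (𝓡 n)) (E₂ := Trivial M ℝ) (IB := 𝓡 n) (IM := cotangentModel n)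
    (b := fun l : CotangentBundle n M => l.proj) (n := ∞)
    (ϕ := fun l : CotangentBundle n M => l.snd) (v := fun l => Y l.proj) (x := lam)
    contMDiffAt_id h2
  exact (contMDiffAt_totalSpace.mp h3).2

theorem continuousLinearMapAt_trivializationAt_self (q : M) :
    (trivializationAt (Model n) (TangentSpace (𝓡 n)) q).continuousLinearMapAt ℝ q =
      ContinuousLinearMap.id ℝ (Model n) := by
  rw [TangentBundle.continuousLinearMapAt_trivializationAt_eq_core (mem_chart_source _ q)]
  ext v
  exact congrArg (fun w : Model n => w _)
    ((tangentBundleCore (𝓡 n) M).coordChange_self _ _ (mem_achart_source _ q) v)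

theorem symmL_trivializationAt_self (q : M) :
    (trivializationAt (Model n) (TangentSpace (𝓡 n)) q).symmL ℝ q =
      ContinuousLinearMap.id ℝ (Model n) := by
  rw [TangentBundle.symmL_trivializationAt_eq_core (mem_chart_source _ q)]
  ext v
  exact congrArg (fun w : Model n => w _)
    ((tangentBundleCore (𝓡 n) M).coordChange_self _ _ (mem_achart_source _ q) v)

theorem fieldInChart_self (Y : (q : M) → TangentSpace (𝓡 n) q) (q : M) :
    fieldInChart Y q (extChartAt (𝓡 n) q q) = Y q := by
  rw [fieldInChart, extChartAt_to_inv, continuousLinearMapAt_trivializationAt_self]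
  rfl

theorem differentiableAt_fieldInChart {Y : (q : M) → TangentSpace (𝓡 n) q} {q : M}
    (hY : MDifferentiableAt (𝓡 n) (𝓡 n).tangent (fun q => (⟨q, Y q⟩ : TangentBundle (𝓡 n) M)) q) :
    DifferentiableAt ℝ (fieldInChart Y q) (extChartAt (𝓡 n) q q) := by
  rw [mdifferentiableAt_section] at hY
  have h := hY.differentiableWithinAt_writtenInExtChartAt
  rw [ModelWithCorners.Boundaryless.range_eq_univ, differentiableWithinAt_univ] at h
  refine h.congr_of_eventuallyEq ?_
  filter_upwards [extChartAt_target_mem_nhds (I := 𝓡 n) q] with x hx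
  have hb : (extChartAt (𝓡 n) q).symm x ∈
      (trivializationAt (Model n) (TangentSpace (𝓡 n)) q).baseSet := by
    rw [TangentBundle.trivializationAt_baseSet, ← extChartAt_source (𝓡 n)]
    exact (extChartAt (𝓡 n) q).map_target hx
  rw [fieldInChart, Trivialization.continuousLinearMapAt_apply,
    Trivialization.coe_linearMapAt_of_mem _ hb]
  rfl

/-- The inverse of the preferred chart of `T^* M` at `lam`, also for `x` outside the target of the chart
of `M`: both sides use the same junk values there. -/
theorem cotangent_extChartAt_symm {lam : CotangentBundle n M} {x : Model n}
    (l : Model n →L[ℝ] ℝ) :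
    (extChartAt (cotangentModel n) lam).symm (x, l) =
      ⟨(extChartAt (𝓡 n) lam.proj).symm x,
        l.comp ((trivializationAt (Model n) (TangentSpace (𝓡 n)) lam.proj).continuousLinearMapAt ℝ
          ((extChartAt (𝓡 n) lam.proj).symm x))⟩ := by
  rw [FiberBundle.extChartAt, PartialEquiv.coe_trans_symm, Function.comp_apply,
    PartialEquiv.prod_symm, PartialEquiv.prod_coe]
  change (⟨(extChartAt (𝓡 n) lam.proj).symm x,
    ((trivializationAt ℝ (Trivial M ℝ) lam.proj).symmL ℝ ((extChartAt (𝓡 n) lam.proj).symm x)).comp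
    (l.comp ((trivializationAt (Model n) (TangentSpace (𝓡 n)) lam.proj).continuousLinearMapAt ℝ
          ((extChartAt (𝓡 n) lam.proj).symm x)))⟩ : CotangentBundle n M) = _
  congr 1
  ext v
  simp
  rfl

theorem cotangent_extChartAt_self (lam : CotangentBundle n M) :
    extChartAt (cotangentModel n) lam lam = (extChartAt (𝓡 n) lam.proj lam.proj, lam.snd) := by
  rw [FiberBundle.extChartAt, PartialEquiv.coe_trans, Function.comp_apply]
  refine Prod.ext rfl ?_
  change ContinuousLinearMap.inCoordinates (Model n) (TangentSpace (𝓡 n)) ℝ (Trivial M ℝ)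
    lam.proj lam.proj lam.proj lam.proj lam.snd = lam.snd
  rw [ContinuousLinearMap.inCoordinates, symmL_trivializationAt_self]
  ext v
  simp
  rfl

theorem mlieBracket_eq_fieldInChart (V W : (q : M) → TangentSpace (𝓡 n) q) (q : M) :
    mlieBracket (𝓡 n) V W q =
      lieBracket ℝ (fieldInChart V q) (fieldInChart W q) (extChartAt (𝓡 n) q q) := by
  have key : ∀ Y : (q : M) → TangentSpace (𝓡 n) q,
      mpullbackWithin 𝓘(ℝ, Model n) (𝓡 n) (extChartAt (𝓡 n) q).symm Y (Set.range (𝓡 n))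
        =ᶠ[𝓝 (extChartAt (𝓡 n) q q)] fieldInChart Y q := by
    intro Y
    filter_upwards [extChartAt_target_mem_nhds (I := 𝓡 n) q] with x hx
    have hx' := (extChartAt (𝓡 n) q).map_target hx
    rw [mpullbackWithin_apply, fieldInChart,
      TangentBundle.continuousLinearMapAt_trivializationAt (by rwa [extChartAt_source] at hx')]
    congr 1
    have h1 := mfderiv_extChartAt_comp_mfderivWithin_extChartAt_symm (I := 𝓡 n) hx
    have h2 := mfderivWithin_extChartAt_symm_comp_mfderiv_extChartAt (I := 𝓡 n) hx
    exact ContinuousLinearMap.inverse_eq h2 h1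
  have hid : ∀ v : Model n,
      (mfderiv (𝓡 n) 𝓘(ℝ, Model n) (extChartAt (𝓡 n) q) q).inverse v = v := by
    intro v
    rw [mfderiv_extChartAt_self]
    exact congrArg (fun L : Model n →L[ℝ] Model n => L v) ContinuousLinearMap.inverse_id
  rw [ModelWithCorners.Boundaryless.range_eq_univ] at key
  rw [mlieBracket, mlieBracketWithin_apply]
  refine (hid _).trans ?_
  rw [ModelWithCorners.Boundaryless.range_eq_univ, Set.preimage_univ, Set.univ_inter]
  refine Eq.trans ?_ ((key V).lieBracket_vectorField_eq (key W))
  exact congrFun (lieBracketWithin_univ (𝕜 := ℝ) (E := Model n)) _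

/-- In the preferred chart the momentum function of `Y` is `(x, l) ↦ l (Y x)`. -/
theorem derivAlong_momentum {Y : (q : M) → TangentSpace (𝓡 n) q} {lam : CotangentBundle n M}
    (hY : ContMDiffAt (𝓡 n) (𝓡 n).tangent ∞ (fun q => (⟨q, Y q⟩ : TangentBundle (𝓡 n) M))
      lam.proj) (w : TangentSpace (cotangentModel n) lam) :
    derivAlong (momentum Y) lam w =
    fiberVector w (Y lam.proj) + lam.snd (fderiv ℝ (fieldInChart Y lam.proj)
      (extChartAt (𝓡 n) lam.proj lam.proj) (projVector w)) := by
  have hd := differentiableAt_fieldInChart (hY.mdifferentiableAt (by simp))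
  obtain ⟨L, hL, hLw⟩ : ∃ L : Model n × (Model n →L[ℝ] ℝ) →L[ℝ] ℝ,
      HasFDerivAt (fun z : Model n × (Model n →L[ℝ] ℝ) => z.2 (fieldInChart Y lam.proj z.1)) L
        (extChartAt (cotangentModel n) lam lam) ∧
      ∀ w, L w = w.2 (Y lam.proj) + lam.snd (fderiv ℝ (fieldInChart Y lam.proj)
        (extChartAt (𝓡 n) lam.proj lam.proj) w.1) := by
    have a : HasFDerivAt (fun z : Model n × (Model n →L[ℝ] ℝ) => fieldInChart Y lam.proj z.1)
        ((fderiv ℝ (fieldInChart Y lam.proj) (extChartAt (𝓡 n) lam.proj lam.proj)).comp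
          (ContinuousLinearMap.fst ℝ _ _))
        (extChartAt (cotangentModel n) lam lam) := by
      rw [cotangent_extChartAt_self]
      exact HasFDerivAt.comp (f := fun z : Model n × (Model n →L[ℝ] ℝ) => z.1)
        (g := fieldInChart Y lam.proj)
        (extChartAt (𝓡 n) lam.proj lam.proj, (lam.snd : Model n →L[ℝ] ℝ))
        hd.hasFDerivAt hasFDerivAt_fst
    refine ⟨_, (hasFDerivAt_snd (𝕜 := ℝ) (E := Model n) (F := Model n →L[ℝ] ℝ)).clm_apply a,
      fun w => ?_⟩
    rw [cotangent_extChartAt_self]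
    change lam.snd (fderiv ℝ (fieldInChart Y lam.proj) (extChartAt (𝓡 n) lam.proj lam.proj) w.1) +
      w.2 (fieldInChart Y lam.proj (extChartAt (𝓡 n) lam.proj lam.proj)) = _
    rw [fieldInChart_self]
    exact add_comm _ _
  have hm : HasMFDerivAt (cotangentModel n) 𝓘(ℝ, ℝ) (momentum Y) lam L := by
    refine ⟨(contMDiffAt_momentum hY).continuousAt, HasFDerivAt.hasFDerivWithinAt
      (hL.congr_of_eventuallyEq (Eventually.of_forall fun z => ?_))⟩
    change momentum Y ((extChartAt (cotangentModel n) lam).symm (z.1, z.2)) = _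
    rw [cotangent_extChartAt_symm]
    rfl
  exact (hm.derivAlong_eq w).trans (hLw w)

/-- In the preferred chart the projection `(q, p) ↦ q` is `(x, p) ↦ x`. -/
theorem hasMFDerivAt_proj (lam : CotangentBundle n M) :
    HasMFDerivAt (cotangentModel n) (𝓡 n)
      (fun l : CotangentBundle n M => l.proj) lam
      (ContinuousLinearMap.fst ℝ (Model n) (Model n →L[ℝ] ℝ)) := by
  refine ⟨(FiberBundle.continuous_proj _ _).continuousAt, HasFDerivAt.hasFDerivWithinAt
    (hasFDerivAt_fst.congr_of_eventuallyEq ?_)⟩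
  have : ∀ᶠ z : Model n × (Model n →L[ℝ] ℝ) in 𝓝 (extChartAt (cotangentModel n) lam lam),
      z.1 ∈ (extChartAt (𝓡 n) lam.proj).target := by
    refine continuous_fst.continuousAt.eventually ?_
    rw [cotangent_extChartAt_self]
    exact extChartAt_target_mem_nhds (I := 𝓡 n) lam.proj
  filter_upwards [this] with z hz
  change extChartAt (𝓡 n) lam.proj ((extChartAt (cotangentModel n) lam).symm (z.1, z.2)).proj = _
  rw [cotangent_extChartAt_symm]
  exact (extChartAt (𝓡 n) lam.proj).right_inv hz

theorem derivAlong_comp_proj {f : M → ℝ} {lam : CotangentBundle n M}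
    (hf : MDifferentiableAt (𝓡 n) 𝓘(ℝ, ℝ) f lam.proj) (w : TangentSpace (cotangentModel n) lam) :
    derivAlong (fun l : CotangentBundle n M => f l.proj) lam w =
      differential f lam.proj (projVector w) := by
  have h := hf.hasMFDerivAt.comp lam (hasMFDerivAt_proj lam)
  change derivAlong (f ∘ fun l : CotangentBundle n M => l.proj) lam w = _
  exact h.derivAlong_eq w

section Hamiltonian

variable {h : CotangentBundle n M → ℝ} {lam : CotangentBundle n M}
  {V : (q : M) → TangentSpace (𝓡 n) q} {f : M → ℝ}

/-- If `dh` agrees at `lam` with the differential of `u_V + f`, then the Hamiltonian field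
of `h` at `lam` projects to `V`. -/
theorem projVector_hamiltonianField
    (hV : ContMDiffAt (𝓡 n) (𝓡 n).tangent ∞ (fun q => (⟨q, V q⟩ : TangentBundle (𝓡 n) M))
      lam.proj)
    (hh : ∀ w : TangentSpace (cotangentModel n) lam, derivAlong h lam w =
      derivAlong (momentum V) lam w + differential f lam.proj (projVector w)) :
    projVector (hamiltonianField h lam) = V lam.proj := by
  change (WithLp.toLp 2 (fun i : Fin n => (mfderiv (cotangentModel n) 𝓘(ℝ, ℝ) h lam :
    Model n × (Model n →L[ℝ] ℝ) →L[ℝ] ℝ) (0, EuclideanSpace.proj i)) : Model n) = _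
  ext i
  change (mfderiv (cotangentModel n) 𝓘(ℝ, ℝ) h lam :
    Model n × (Model n →L[ℝ] ℝ) →L[ℝ] ℝ) (0, EuclideanSpace.proj i) = _
  let w : TangentSpace (cotangentModel n) lam :=
    ((0, EuclideanSpace.proj i) : Model n × (Model n →L[ℝ] ℝ))
  refine (hh w).trans ?_
  rw [derivAlong_momentum hV]
  change (EuclideanSpace.proj i : Model n →L[ℝ] ℝ) (V lam.proj) + lam.snd (fderiv ℝ
    (fieldInChart V lam.proj) (extChartAt (𝓡 n) lam.proj lam.proj) (0 : Model n)) +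
    differential f lam.proj 0 = _
  rw [map_zero, map_zero, add_zero]
  erw [map_zero]
  exact add_zero _

/-- The Poisson bracket formula: if `dh` agrees at `lam` with the differential of `u_V + f`,
then the derivative of `u_Y` along the Hamiltonian field of `h` is `u_[V, Y] - Y f`. -/
theorem derivAlong_momentum_hamiltonianField {Y : (q : M) → TangentSpace (𝓡 n) q}
    (hV : ContMDiffAt (𝓡 n) (𝓡 n).tangent ∞ (fun q => (⟨q, V q⟩ : TangentBundle (𝓡 n) M))
      lam.proj)
    (hY : ContMDiffAt (𝓡 n) (𝓡 n).tangent ∞ (fun q => (⟨q, Y q⟩ : TangentBundle (𝓡 n) M))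
      lam.proj)
    (hh : ∀ w : TangentSpace (cotangentModel n) lam, derivAlong h lam w =
      derivAlong (momentum V) lam w + differential f lam.proj (projVector w)) :
    derivAlong (momentum Y) lam (hamiltonianField h lam) =
      momentum (mlieBracket (𝓡 n) V Y) lam - differential f lam.proj (Y lam.proj) := by
  have h1 := projVector_hamiltonianField hV hh
  let w : TangentSpace (cotangentModel n) lam :=
    ((Y lam.proj, 0) : Model n × (Model n →L[ℝ] ℝ))
  have h2 : fiberVector (hamiltonianField h lam) (Y lam.proj) = -(derivAlong h lam w) := rfl
  rw [derivAlong_momentum hY, h1, h2, hh, derivAlong_momentum hV, momentum,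
    mlieBracket_eq_fieldInChart, lieBracket]
  rw [fieldInChart_self, fieldInChart_self]
  change -((0 : Model n →L[ℝ] ℝ) (V lam.proj) + lam.snd (fderiv ℝ
    (fieldInChart V lam.proj) (extChartAt (𝓡 n) lam.proj lam.proj) (Y lam.proj)) +
    differential f lam.proj (Y lam.proj)) + _ = _
  erw [zero_apply, map_sub]
  ring

/-- A function is constant along its own Hamiltonian field. -/
theorem derivAlong_hamiltonianField_self (h : CotangentBundle n M → ℝ)
    (lam : CotangentBundle n M) : derivAlong h lam (hamiltonianField h lam) = 0 := by
  let dh : Model n × (Model n →L[ℝ] ℝ) →L[ℝ] ℝ := mfderiv (cotangentModel n) 𝓘(ℝ, ℝ) h lam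
  let ξ : Model n := WithLp.toLp 2 (fun i : Fin n => dh (0, EuclideanSpace.proj i))
  let η : Model n →L[ℝ] ℝ := -(dh.comp (ContinuousLinearMap.inl ℝ (Model n) (Model n →L[ℝ] ℝ)))
  change dh (ξ, η) = 0
  have h1 : dh (ξ, η) = dh (ξ, 0) + dh (0, η) := by rw [← map_add]; simp
  have h2 : dh (ξ, 0) = - η ξ := by simp [η]
  have h3 : η = ∑ i, η (EuclideanSpace.single i 1) •
      (EuclideanSpace.proj i : Model n →L[ℝ] ℝ) := by
    ext v
    have : v = ∑ i, v i • EuclideanSpace.single i (1 : ℝ) := by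
      ext j
      simp [Finset.sum_apply, Pi.single_apply]
    conv_lhs => rw [this, map_sum]
    simp [mul_comm]
  have h4 : dh (0, η) = η ξ := by
    have e : ((0 : Model n), η) = ∑ i, η (EuclideanSpace.single i 1) •
        ((0 : Model n), (EuclideanSpace.proj i : Model n →L[ℝ] ℝ)) := by
      refine Prod.ext (by simp [Prod.fst_sum]) ?_
      rw [Prod.snd_sum]
      exact h3
    rw [e, map_sum]
    conv_rhs => rw [h3]
    simp only [map_smul, smul_eq_mul, sum_apply, smul_apply]
    rfl
  rw [h1, h2, h4]
  ring

end Hamiltonian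

end

/-! ### Functions that are polynomial on the fibers -/

section

variable {n : ℕ} {M : Type*} [TopologicalSpace M] [ChartedSpace (Model n) M]
  [IsManifold (𝓡 n) ∞ M] {U : Set M}

theorem SmoothFieldOn.contMDiffAt {X : (q : M) → TangentSpace (𝓡 n) q} (hX : SmoothFieldOn X U)
    (hU : IsOpen U) {q : M} (hq : q ∈ U) :
    ContMDiffAt (𝓡 n) (𝓡 n).tangent ∞ (fun q => (⟨q, X q⟩ : TangentBundle (𝓡 n) M)) q :=
  ContMDiffOn.contMDiffAt hX (hU.mem_nhds hq)

theorem SmoothFieldOn.mlieBracket {X Y : (q : M) → TangentSpace (𝓡 n) q}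
    (hX : SmoothFieldOn X U) (hY : SmoothFieldOn Y U) (hU : IsOpen U) :
    SmoothFieldOn (mlieBracket (𝓡 n) X Y) U := by
  intro q hq
  have : IsManifold (𝓡 n) (((⊤ : ℕ∞) : WithTop ℕ∞) + 1) M := by
    change IsManifold (𝓡 n) ∞ M; infer_instance
  have : IsManifold (𝓡 n) (minSmoothness ℝ 2) M := by
    rw [minSmoothness_of_isRCLikeNormedField]; infer_instance
  exact (ContMDiffAt.mlieBracket_vectorField (m := ⊤) (n := ⊤) (hX.contMDiffAt hU hq)
    (hY.contMDiffAt hU hq) (by simp [minSmoothness_of_isRCLikeNormedField])).contMDiffWithinAt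

theorem SmoothFieldOn.smul {X : (q : M) → TangentSpace (𝓡 n) q} {f : M → ℝ}
    (hX : SmoothFieldOn X U) (hf : ContMDiffOn (𝓡 n) 𝓘(ℝ, ℝ) ∞ f U) :
    SmoothFieldOn (fun q => f q • X q) U := ContMDiffOn.smul_section hf hX

theorem SmoothFieldOn.sum {ι : Type*} {s : Finset ι} {X : ι → (q : M) → TangentSpace (𝓡 n) q}
    (hX : ∀ i, SmoothFieldOn (X i) U) : SmoothFieldOn (fun q => ∑ i ∈ s, X i q) U :=
  ContMDiffOn.sum_section fun i _ => hX i

theorem SmoothFieldOn.mono {X : (q : M) → TangentSpace (𝓡 n) q} {V : Set M}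
    (hX : SmoothFieldOn X U) (h : V ⊆ U) : SmoothFieldOn X V := ContMDiffOn.mono hX h

theorem contMDiffOn_differential_apply {X : (q : M) → TangentSpace (𝓡 n) q} {f : M → ℝ}
    (hU : IsOpen U) (hX : SmoothFieldOn X U) (hf : ContMDiffOn (𝓡 n) 𝓘(ℝ, ℝ) ∞ f U) :
    ContMDiffOn (𝓡 n) 𝓘(ℝ, ℝ) ∞ (fun q => differential f q (X q)) U := by
  have h1 : ContMDiffOn (𝓡 n).tangent 𝓘(ℝ, ℝ).tangent ∞ (tangentMapWithin (𝓡 n) 𝓘(ℝ, ℝ) f U)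
      (π (Model n) (TangentSpace (𝓡 n)) ⁻¹' U) :=
    hf.contMDiffOn_tangentMapWithin (by simp) hU.uniqueMDiffOn
  have h2 := h1.comp hX (fun q hq => hq)
  have h3 := contMDiff_snd_tangentBundle_modelSpace ℝ 𝓘(ℝ, ℝ) (n := ∞) |>.comp_contMDiffOn h2
  refine h3.congr fun q hq => ?_
  change _ = mfderivWithin (𝓡 n) 𝓘(ℝ, ℝ) f U q (X q)
  rw [mfderivWithin_of_isOpen hU hq]
  rfl

/-- The functions on `T^* M` that over the open set `U` are homogeneous polynomials of degree `d`
on the fibers, with smooth coefficients. They are generated by the smooth functions on `U` and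
the momentum functions of the smooth vector fields on `U`; values over the complement of `U` do
not matter. -/
inductive FiberPolynomialOn (U : Set M) : ℕ → (CotangentBundle n M → ℝ) → Prop
  | base {f : M → ℝ} (hf : ContMDiffOn (𝓡 n) 𝓘(ℝ, ℝ) ∞ f U) :
      FiberPolynomialOn U 0 fun lam => f lam.proj
  | momentum {Y : (q : M) → TangentSpace (𝓡 n) q} (hY : SmoothFieldOn Y U) :
      FiberPolynomialOn U 1 (momentum Y)
  | add {d : ℕ} {F G : CotangentBundle n M → ℝ} (hF : FiberPolynomialOn U d F)
      (hG : FiberPolynomialOn U d G) : FiberPolynomialOn U d fun lam => F lam + G lam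
  | mul {d e k : ℕ} {F G : CotangentBundle n M → ℝ} (hF : FiberPolynomialOn U d F)
      (hG : FiberPolynomialOn U e G) (hk : d + e = k) :
      FiberPolynomialOn U k fun lam => F lam * G lam
  | congr {d : ℕ} {F G : CotangentBundle n M → ℝ} (hF : FiberPolynomialOn U d F)
      (h : ∀ lam : CotangentBundle n M, lam.proj ∈ U → G lam = F lam) : FiberPolynomialOn U d G
  | zero (d : ℕ) : FiberPolynomialOn U d fun _ => 0

namespace FiberPolynomialOn

variable {d e k : ℕ} {F G : CotangentBundle n M → ℝ}

theorem const_mul (hF : FiberPolynomialOn U d F) (c : ℝ) :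
    FiberPolynomialOn U d fun lam => c * F lam :=
  .mul (.base (f := fun _ => c) contMDiffOn_const) hF (zero_add d)

theorem base_mul {f : M → ℝ} (hf : ContMDiffOn (𝓡 n) 𝓘(ℝ, ℝ) ∞ f U)
    (hF : FiberPolynomialOn U d F) : FiberPolynomialOn U d fun lam => f lam.proj * F lam :=
  .mul (.base hf) hF (zero_add d)

theorem neg (hF : FiberPolynomialOn U d F) : FiberPolynomialOn U d fun lam => -F lam :=
  (hF.const_mul (-1)).congr fun _ _ => by ring

theorem sub (hF : FiberPolynomialOn U d F) (hG : FiberPolynomialOn U d G) :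
    FiberPolynomialOn U d fun lam => F lam - G lam :=
  (hF.add hG.neg).congr fun _ _ => by ring

theorem sum {ι : Type*} {s : Finset ι} {F : ι → CotangentBundle n M → ℝ}
    (hF : ∀ i ∈ s, FiberPolynomialOn U d (F i)) :
    FiberPolynomialOn U d fun lam => ∑ i ∈ s, F i lam := by
  classical
  induction s using Finset.induction_on with
  | empty => simpa using FiberPolynomialOn.zero d
  | insert a s ha ih =>
    refine ((hF a (Finset.mem_insert_self a s)).add
      (ih fun i hi => hF i (Finset.mem_insert_of_mem hi))).congr fun lam _ => ?_
    rw [Finset.sum_insert ha]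

theorem pow (hF : FiberPolynomialOn U d F) (k : ℕ) :
    FiberPolynomialOn U (d * k) fun lam => F lam ^ k := by
  induction k with
  | zero =>
    refine (FiberPolynomialOn.base (f := fun _ => 1) contMDiffOn_const).congr fun _ _ => ?_
    simp
  | succ k ih => exact (ih.mul hF (by ring)).congr fun _ _ => pow_succ _ _

theorem contMDiffAt (hU : IsOpen U) (hF : FiberPolynomialOn U d F) {lam : CotangentBundle n M}
    (hl : lam.proj ∈ U) : ContMDiffAt (cotangentModel n) 𝓘(ℝ, ℝ) ∞ F lam := by
  induction hF with
  | base hf =>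
    exact (hf.contMDiffAt (hU.mem_nhds hl)).comp lam (contMDiffAt_proj _)
  | momentum hY => exact contMDiffAt_momentum (hY.contMDiffAt hU hl)
  | add _ _ h1 h2 => exact h1.add h2
  | mul _ _ _ h1 h2 => exact h1.mul h2
  | congr _ h h1 =>
    refine h1.congr_of_eventuallyEq ?_
    filter_upwards [(hU.preimage (FiberBundle.continuous_proj (Model n →L[ℝ] ℝ)
      (CotangentSpace n M))).mem_nhds hl] with l hl using h l hl
  | zero d => exact contMDiffAt_const

theorem mdifferentiableAt (hU : IsOpen U) (hF : FiberPolynomialOn U d F)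
    {lam : CotangentBundle n M} (hl : lam.proj ∈ U) :
    MDifferentiableAt (cotangentModel n) 𝓘(ℝ, ℝ) F lam :=
  (hF.contMDiffAt hU hl).mdifferentiableAt (by simp)

end FiberPolynomialOn

section derivAlong

variable {F G : CotangentBundle n M → ℝ} {lam : CotangentBundle n M}

theorem derivAlong_add (hF : MDifferentiableAt (cotangentModel n) 𝓘(ℝ, ℝ) F lam)
    (hG : MDifferentiableAt (cotangentModel n) 𝓘(ℝ, ℝ) G lam)
    (w : TangentSpace (cotangentModel n) lam) :
    derivAlong (fun l => F l + G l) lam w = derivAlong F lam w + derivAlong G lam w :=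
  (hF.hasMFDerivAt.add hG.hasMFDerivAt).derivAlong_eq w

theorem mdifferentiableAt_mul (hF : MDifferentiableAt (cotangentModel n) 𝓘(ℝ, ℝ) F lam)
    (hG : MDifferentiableAt (cotangentModel n) 𝓘(ℝ, ℝ) G lam) :
    MDifferentiableAt (cotangentModel n) 𝓘(ℝ, ℝ) (fun l => F l * G l) lam := hF.mul hG

theorem derivAlong_mul (hF : MDifferentiableAt (cotangentModel n) 𝓘(ℝ, ℝ) F lam)
    (hG : MDifferentiableAt (cotangentModel n) 𝓘(ℝ, ℝ) G lam)
    (w : TangentSpace (cotangentModel n) lam) :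
    derivAlong (fun l => F l * G l) lam w =
      F lam * derivAlong G lam w + derivAlong F lam w * G lam :=
  ((hF.hasMFDerivAt.mul hG.hasMFDerivAt).derivAlong_eq w).trans
    (congrArg (F lam * derivAlong G lam w + ·) (mul_comm (G lam) (derivAlong F lam w)))

theorem derivAlong_const (c : ℝ) (w : TangentSpace (cotangentModel n) lam) :
    derivAlong (fun _ => c) lam w = 0 :=
  (hasMFDerivAt_const c lam).derivAlong_eq w

theorem derivAlong_congr (h : F =ᶠ[𝓝 lam] G) (w : TangentSpace (cotangentModel n) lam) :
    derivAlong F lam w = derivAlong G lam w := by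
  rw [derivAlong, derivAlong, h.mfderiv_eq]
  rfl

theorem derivAlong_congr_over (hU : IsOpen U) (hl : lam.proj ∈ U)
    (h : ∀ l : CotangentBundle n M, l.proj ∈ U → F l = G l)
    (w : TangentSpace (cotangentModel n) lam) : derivAlong F lam w = derivAlong G lam w := by
  refine derivAlong_congr ?_ w
  filter_upwards [(hU.preimage (FiberBundle.continuous_proj (Model n →L[ℝ] ℝ)
    (CotangentSpace n M))).mem_nhds hl] with l hl using h l hl

/-- The chain rule along a curve in `T^* M`. -/
theorem hasDerivAt_comp_curve {γ : ℝ → CotangentBundle n M} {t : ℝ}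
    {v : TangentSpace (cotangentModel n) (γ t)}
    (hF : MDifferentiableAt (cotangentModel n) 𝓘(ℝ, ℝ) F (γ t))
    (hγ : HasMFDerivAt 𝓘(ℝ, ℝ) (cotangentModel n) γ t ((1 : ℝ →L[ℝ] ℝ).smulRight v)) :
    HasDerivAt (fun s => F (γ s)) (derivAlong F (γ t) v) t := by
  let A : Model n × (Model n →L[ℝ] ℝ) →L[ℝ] ℝ := mfderiv (cotangentModel n) 𝓘(ℝ, ℝ) F (γ t)
  let B : ℝ →L[ℝ] Model n × (Model n →L[ℝ] ℝ) := (1 : ℝ →L[ℝ] ℝ).smulRight v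
  have h : HasFDerivAt (F ∘ γ) (A.comp B) t := (hF.hasMFDerivAt.comp t hγ).hasFDerivAt
  have h1 : A.comp B 1 = derivAlong F (γ t) v := by
    change A ((1 : ℝ) • (v : Model n × (Model n →L[ℝ] ℝ))) = _
    rw [one_smul]
    rfl
  have h2 := h.hasDerivAt
  rw [h1] at h2
  exact h2

end derivAlong

end

/-! ### Frames and Gram matrices -/

section

section Matrix

variable {n : ℕ} {M : Type*} [TopologicalSpace M] [ChartedSpace (Model n) M] {U : Set M}
  {ι : Type*} [Fintype ι] [DecidableEq ι] {A : M → Matrix ι ι ℝ}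

theorem contMDiffOn_det (hA : ∀ i j, ContMDiffOn (𝓡 n) 𝓘(ℝ, ℝ) ∞ (fun q => A q i j) U) :
    ContMDiffOn (𝓡 n) 𝓘(ℝ, ℝ) ∞ (fun q => (A q).det) U := by
  simp only [Matrix.det_apply']
  exact contMDiffOn_finsetSum fun σ _ => contMDiffOn_const.mul
    (contMDiffOn_finsetProd fun i _ => hA (σ i) i)

theorem contMDiffOn_matrix_inv (hA : ∀ i j, ContMDiffOn (𝓡 n) 𝓘(ℝ, ℝ) ∞ (fun q => A q i j) U)
    (hdet : ∀ q ∈ U, (A q).det ≠ 0) (i j : ι) :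
    ContMDiffOn (𝓡 n) 𝓘(ℝ, ℝ) ∞ (fun q => (A q)⁻¹ i j) U := by
  have h : ∀ q, (A q)⁻¹ i j = (A q).det⁻¹ * ((A q).updateRow j (Pi.single i 1)).det := by
    intro q
    rw [Matrix.inv_def, Matrix.smul_apply, Matrix.adjugate_apply, Ring.inverse_eq_inv', smul_eq_mul]
  simp only [h]
  refine ((contMDiffOn_det hA).inv₀ hdet).mul (contMDiffOn_det fun k l => ?_)
  by_cases hk : k = j
  · subst hk
    simp only [Matrix.updateRow_self]
    exact contMDiffOn_const
  · simp only [Matrix.updateRow_ne hk]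
    exact hA k l

end Matrix

variable {m n : ℕ} {M : Type*} [TopologicalSpace M] [ChartedSpace (Model n) M]
  [IsManifold (𝓡 n) ∞ M] {U : Set M} {D : VectorDistribution m n M}

/-- A smooth local frame `X` of the distribution `D` over the open set `U`. -/
structure IsFrameOn (D : VectorDistribution m n M) (X : Fin m → (q : M) → TangentSpace (𝓡 n) q)
    (U : Set M) : Prop where
  isOpen : IsOpen U
  smooth : ∀ i, SmoothFieldOn (X i) U
  linearIndependent : ∀ q ∈ U, LinearIndependent ℝ fun i => X i q
  span_eq : ∀ q ∈ U, Submodule.span ℝ (Set.range fun i => X i q) = D.fiber q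

theorem IsFrameOn.mem {X : Fin m → (q : M) → TangentSpace (𝓡 n) q} (hX : IsFrameOn D X U)
    {q : M} (hq : q ∈ U) (i : Fin m) : X i q ∈ D.fiber q := by
  rw [← hX.span_eq q hq]
  exact Submodule.subset_span ⟨i, rfl⟩

theorem IsFrameOn.mono {X : Fin m → (q : M) → TangentSpace (𝓡 n) q} (hX : IsFrameOn D X U)
    {V : Set M} (hV : IsOpen V) (h : V ⊆ U) : IsFrameOn D X V where
  isOpen := hV
  smooth i := (hX.smooth i).mono h
  linearIndependent q hq := hX.linearIndependent q (h hq)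
  span_eq q hq := hX.span_eq q (h hq)

open Classical in
/-- The vector field `X` as a section of `D`, made zero at the points where it is not in `D`. -/
def toFiber (D : VectorDistribution m n M) (X : (q : M) → TangentSpace (𝓡 n) q) (q : M) :
    D.fiber q :=
  if h : X q ∈ D.fiber q then ⟨X q, h⟩ else 0

theorem coe_toFiber {X : (q : M) → TangentSpace (𝓡 n) q} {q : M} (h : X q ∈ D.fiber q) :
    (toFiber D X q : TangentSpace (𝓡 n) q) = X q := by
  rw [toFiber, dif_pos h]

namespace Metric

variable (G : Metric D) (X : Fin m → (q : M) → TangentSpace (𝓡 n) q)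

theorem form_sharp (q : M) (l : Module.Dual ℝ (D.fiber q)) (w : D.fiber q) :
    G.form q (G.sharp q l) w = l w :=
  LinearMap.BilinForm.apply_toDual_symm_apply (hB := G.nondegenerate q) l w

theorem form_self_nonneg (q : M) (v : D.fiber q) : 0 ≤ G.form q v v := by
  by_cases h : v = 0
  · simp [h]
  · exact (G.pos q v h).le

theorem hamiltonian_eq_sharp (lam : CotangentBundle n M) :
    G.hamiltonian lam =
      (1 / 2) * restrictCovector D lam (G.sharp lam.proj (restrictCovector D lam)) := by
  set l := restrictCovector D lam
  set v := G.sharp lam.proj l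
  have hv : ∀ w, l w = G.form lam.proj v w := fun w => (G.form_sharp _ _ _).symm
  rw [hamiltonian]
  congr 1
  by_cases h0 : v = 0
  · have hl : ∀ w, l w = 0 := fun w => by rw [hv, h0]; simp
    have hS : sSup {r : ℝ | ∃ w : D.fiber lam.proj, G.form lam.proj w w = 1 ∧ r = l w} = 0 := by
      refine le_antisymm (Real.sSup_nonpos ?_) (Real.sSup_nonneg ?_) <;>
      · rintro r ⟨w, _, rfl⟩
        rw [hl]
    rw [hS, hl]
    norm_num
  · have hpos := G.pos _ v h0
    set N := Real.sqrt (G.form lam.proj v v)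
    have hN : N ^ 2 = G.form lam.proj v v := Real.sq_sqrt hpos.le
    have hN0 : 0 < N := Real.sqrt_pos.2 hpos
    have hS : sSup {r : ℝ | ∃ w : D.fiber lam.proj, G.form lam.proj w w = 1 ∧ r = l w} = N := by
      refine IsGreatest.csSup_eq ⟨⟨N⁻¹ • v, ?_, ?_⟩, ?_⟩
      · simp only [map_smul, LinearMap.smul_apply, smul_eq_mul, ← hN]
        field_simp
      · rw [map_smul, hv, smul_eq_mul, ← hN]
        field_simp
      · rintro r ⟨w, hw, rfl⟩
        rw [hv]
        have h1 := G.form_self_nonneg lam.proj (v - G.form lam.proj v w • w)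
        simp only [map_sub, map_smul, LinearMap.sub_apply, LinearMap.smul_apply, smul_eq_mul,
          hw, G.symm lam.proj w v] at h1
        exact abs_le_of_sq_le_sq' (by nlinarith) hN0.le |>.2
    rw [hS, hv, hN]

/-- The Gram matrix of the fields `X i` (as sections of `D`). -/
def gram (q : M) : Matrix (Fin m) (Fin m) ℝ :=
  fun i j => G.form q (toFiber D (X i) q) (toFiber D (X j) q)

theorem gram_symm (q : M) (i j : Fin m) : G.gram X q i j = G.gram X q j i := G.symm _ _ _

/-- The components `c i` of the velocity `I (p|_D) = ∑ c i • X i` in the frame `X`. -/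
def coeff (i : Fin m) (lam : CotangentBundle n M) : ℝ :=
  ∑ j, (G.gram X lam.proj)⁻¹ i j * momentum (X j) lam

variable {G X}

theorem sum_gram_mul (q : M) (a b : Fin m → ℝ) :
    ∑ i, ∑ j, a i * b j * G.gram X q i j =
      G.form q (∑ i, a i • toFiber D (X i) q) (∑ j, b j • toFiber D (X j) q) := by
  simp only [map_sum, map_smul, LinearMap.sum_apply, LinearMap.smul_apply, smul_eq_mul, gram,
    Finset.mul_sum]
  rw [Finset.sum_comm]
  refine Finset.sum_congr rfl fun i _ => Finset.sum_congr rfl fun j _ => by ring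

theorem linearIndependent_toFiber (hX : IsFrameOn D X U) {q : M} (hq : q ∈ U) :
    LinearIndependent ℝ fun i => toFiber D (X i) q := by
  refine LinearIndependent.of_comp (D.fiber q).subtype ?_
  convert hX.linearIndependent q hq using 2 with i
  exact coe_toFiber (hX.mem hq i)

theorem span_toFiber (hX : IsFrameOn D X U) {q : M} (hq : q ∈ U) :
    Submodule.span ℝ (Set.range fun i => toFiber D (X i) q) = ⊤ := by
  apply Submodule.map_injective_of_injective (D.fiber q).injective_subtype
  rw [Submodule.map_span, ← Set.range_comp, Submodule.map_top, Submodule.range_subtype]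
  refine Eq.trans ?_ (hX.span_eq q hq)
  congr 2
  ext1 i
  exact coe_toFiber (hX.mem hq i)

theorem det_gram_ne_zero (hX : IsFrameOn D X U) {q : M} (hq : q ∈ U) :
    (G.gram X q).det ≠ 0 := by
  intro h
  obtain ⟨a, ha0, ha⟩ := Matrix.exists_mulVec_eq_zero_iff.2 h
  have h1 : ∑ i, ∑ j, a i * a j * G.gram X q i j = 0 := by
    have : ∀ i, ∑ j, a i * a j * G.gram X q i j = a i * (G.gram X q).mulVec a i := by
      intro i
      rw [Matrix.mulVec, dotProduct, Finset.mul_sum]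
      exact Finset.sum_congr rfl fun j _ => by ring
    simp [this, ha]
  rw [sum_gram_mul] at h1
  have h2 : ∑ i, a i • toFiber D (X i) q = 0 := by
    by_contra h3
    exact (G.pos q _ h3).ne' h1
  exact ha0 (funext (Fintype.linearIndependent_iff.1 (linearIndependent_toFiber hX hq) a h2))

theorem contMDiffOn_gram (hX : IsFrameOn D X U) (i j : Fin m) :
    ContMDiffOn (𝓡 n) 𝓘(ℝ, ℝ) ∞ (fun q => G.gram X q i j) U := by
  have h : ∀ i, SmoothFieldOn (fun q => (toFiber D (X i) q : TangentSpace (𝓡 n) q)) U :=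
    fun i => ContMDiffOn.congr (hX.smooth i) fun q hq => by
      simp only [coe_toFiber (hX.mem hq i)]
  exact G.smooth U _ _ hX.isOpen (h i) (h j)

theorem sum_gram_mul_coeff (hX : IsFrameOn D X U) {lam : CotangentBundle n M}
    (hl : lam.proj ∈ U) (i : Fin m) :
    ∑ j, G.gram X lam.proj i j * G.coeff X j lam = momentum (X i) lam := by
  have h1 : G.gram X lam.proj * (G.gram X lam.proj)⁻¹ = 1 :=
    Matrix.mul_nonsing_inv _ (det_gram_ne_zero hX hl).isUnit
  have h2 : (G.gram X lam.proj).mulVec ((G.gram X lam.proj)⁻¹.mulVec fun j => momentum (X j) lam) i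
      = momentum (X i) lam := by
    rw [Matrix.mulVec_mulVec, h1, Matrix.one_mulVec]
  exact h2

theorem sharp_eq_sum_coeff (hX : IsFrameOn D X U) {lam : CotangentBundle n M}
    (hl : lam.proj ∈ U) :
    G.sharp lam.proj (restrictCovector D lam) =
      ∑ i, G.coeff X i lam • toFiber D (X i) lam.proj := by
  rw [sharp, LinearEquiv.symm_apply_eq]
  refine LinearMap.ext_on_range (span_toFiber hX hl) fun i => ?_
  have h := sum_gram_mul_coeff (G := G) hX hl i
  rw [LinearMap.BilinForm.toDual_def, map_sum, LinearMap.sum_apply]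
  change lam.snd (toFiber D (X i) lam.proj) = _
  rw [coe_toFiber (hX.mem hl i)]
  refine h.symm.trans (Finset.sum_congr rfl fun j _ => ?_)
  rw [map_smul, LinearMap.smul_apply, smul_eq_mul, mul_comm, gram_symm]
  rfl

theorem fiberPolynomialOn_coeff (hX : IsFrameOn D X U) (i : Fin m) :
    FiberPolynomialOn U 1 (G.coeff X i) :=
  .sum fun j _ => .base_mul (f := fun q => (G.gram X q)⁻¹ i j)
    (contMDiffOn_matrix_inv (fun i j => contMDiffOn_gram hX i j)
      (fun _ hq => det_gram_ne_zero hX hq) i j) (.momentum (hX.smooth j))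

theorem hamiltonian_eq_sum (hX : IsFrameOn D X U) {lam : CotangentBundle n M}
    (hl : lam.proj ∈ U) :
    G.hamiltonian lam = (1 / 2) * ∑ i, G.coeff X i lam * momentum (X i) lam := by
  rw [hamiltonian_eq_sharp, sharp_eq_sum_coeff hX hl, map_sum]
  congr 1
  refine Finset.sum_congr rfl fun i _ => ?_
  rw [map_smul, smul_eq_mul]
  change _ * lam.snd (toFiber D (X i) lam.proj) = _
  rw [coe_toFiber (hX.mem hl i)]
  rfl

theorem fiberPolynomialOn_hamiltonian (hX : IsFrameOn D X U) :
    FiberPolynomialOn U 2 G.hamiltonian :=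
  (FiberPolynomialOn.const_mul (.sum fun i _ => (fiberPolynomialOn_coeff hX i).mul
    (.momentum (hX.smooth i)) rfl) (1 / 2)).congr fun _ hl => hamiltonian_eq_sum hX hl

end Metric

end

/-! ### The Hamiltonian flow in a frame -/

section

variable {m n : ℕ} {M : Type*} [TopologicalSpace M] [ChartedSpace (Model n) M]
  [IsManifold (𝓡 n) ∞ M] {U : Set M} {D : VectorDistribution m n M}

theorem derivAlong_sum {ι : Type*} (s : Finset ι) {F : ι → CotangentBundle n M → ℝ}
    {lam : CotangentBundle n M}
    (hF : ∀ i ∈ s, MDifferentiableAt (cotangentModel n) 𝓘(ℝ, ℝ) (F i) lam)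
    (w : TangentSpace (cotangentModel n) lam) :
    derivAlong (fun l => ∑ i ∈ s, F i l) lam w = ∑ i ∈ s, derivAlong (F i) lam w := by
  classical
  have key : MDifferentiableAt (cotangentModel n) 𝓘(ℝ, ℝ) (fun l => ∑ i ∈ s, F i l) lam ∧
      derivAlong (fun l => ∑ i ∈ s, F i l) lam w = ∑ i ∈ s, derivAlong (F i) lam w := by
    induction s using Finset.induction_on with
    | empty => exact ⟨by simpa using mdifferentiableAt_const, by simp [derivAlong_const]⟩
    | insert i s hi ih =>
      obtain ⟨h1, h2⟩ := ih fun j hj => hF j (Finset.mem_insert_of_mem hj)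
      have h3 := hF i (Finset.mem_insert_self i s)
      simp only [Finset.sum_insert hi]
      exact ⟨h3.add h1, by rw [derivAlong_add h3 h1, h2]⟩
  exact key.2

theorem mlieBracket_sum_smul_left {ι : Type*} (s : Finset ι) (a : ι → ℝ)
    {X : ι → (q : M) → TangentSpace (𝓡 n) q} {Y : (q : M) → TangentSpace (𝓡 n) q} {q : M}
    (hX : ∀ i, MDifferentiableAt (𝓡 n) (𝓡 n).tangent
      (fun q => (⟨q, X i q⟩ : TangentBundle (𝓡 n) M)) q) :
    mlieBracket (𝓡 n) (fun q => ∑ i ∈ s, a i • X i q) Y q =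
      ∑ i ∈ s, a i • mlieBracket (𝓡 n) (X i) Y q := by
  classical
  induction s using Finset.induction_on with
  | empty =>
    simp only [Finset.sum_empty]
    exact congrFun (mlieBracket_zero_left (W := Y)) q
  | insert i s hi ih =>
    simp only [Finset.sum_insert hi]
    have h1 : MDifferentiableAt (𝓡 n) (𝓡 n).tangent
        (fun q => (⟨q, a i • X i q⟩ : TangentBundle (𝓡 n) M)) q :=
      mdifferentiableAt_const.smul_section (hX i)
    have h2 : MDifferentiableAt (𝓡 n) (𝓡 n).tangent
        (fun q => (⟨q, ∑ j ∈ s, a j • X j q⟩ : TangentBundle (𝓡 n) M)) q :=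
      .sum_section fun j _ => mdifferentiableAt_const.smul_section (hX j)
    have h3 := mlieBracket_add_left (W := Y) h1 h2
    have h4 := mlieBracket_const_smul_left (W := Y) (c := a i) (hX i)
    rw [← ih]
    refine Eq.trans ?_ (h3.trans ?_)
    · rfl
    · exact congrArg₂ (· + ·) h4 rfl

namespace Metric

variable {G : Metric D} {X : Fin m → (q : M) → TangentSpace (𝓡 n) q}

theorem differential_sum_gram (hX : IsFrameOn D X U) {q : M} (hq : q ∈ U) (k : ℝ)
    (a : Fin m → ℝ) (v : TangentSpace (𝓡 n) q) :
    differential (fun q => k * ∑ i, ∑ j, a i * a j * G.gram X q i j) q v =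
      k * ∑ i, ∑ j, a i * a j * differential (fun q => G.gram X q i j) q v := by
  have hU := hX.isOpen
  let lam : CotangentBundle n M := ⟨q, 0⟩
  have hl : lam.proj ∈ U := hq
  let w : TangentSpace (cotangentModel n) lam := ((v, 0) : Model n × (Model n →L[ℝ] ℝ))
  have hs : ∀ i j, ContMDiffAt (𝓡 n) 𝓘(ℝ, ℝ) ∞ (fun q => G.gram X q i j) q :=
    fun i j => (contMDiffOn_gram hX i j).contMDiffAt (hU.mem_nhds hq)
  have hgp : ∀ i j, FiberPolynomialOn U 0 fun l : CotangentBundle n M => G.gram X l.proj i j :=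
    fun i j => .base (contMDiffOn_gram (G := G) hX i j)
  have hg := fun i j => (hgp i j).mdifferentiableAt hU hl
  have hgs : FiberPolynomialOn U 0 fun l : CotangentBundle n M => ∑ i, ∑ j,
      a i * a j * G.gram X l.proj i j :=
    .sum fun i _ => .sum fun j _ => (hgp i j).const_mul _
  have hgs' : ∀ i, FiberPolynomialOn U 0 fun l : CotangentBundle n M => ∑ j,
      a i * a j * G.gram X l.proj i j :=
    fun i => .sum fun j _ => (hgp i j).const_mul _
  have hk : ∀ c : ℝ, MDifferentiableAt (cotangentModel n) 𝓘(ℝ, ℝ)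
      (fun _ : CotangentBundle n M => c) lam := fun c => mdifferentiableAt_const
  have hm : MDifferentiableAt (𝓡 n) 𝓘(ℝ, ℝ) (fun q => k * ∑ i, ∑ j,
      a i * a j * G.gram X q i j) lam.proj :=
    ContMDiffAt.mdifferentiableAt (n := ∞) (contMDiffAt_const.mul
      (contMDiffAt_finsetSum fun i _ => contMDiffAt_finsetSum fun j _ =>
        contMDiffAt_const.mul (hs i j))) (by simp)
  have h1 := derivAlong_comp_proj hm w
  have h2 := fun i j => derivAlong_comp_proj ((hs i j).mdifferentiableAt (by simp)) w
  rw [derivAlong_mul (hk _) (hgs.mdifferentiableAt hU hl),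
    derivAlong_const, derivAlong_sum _ fun i _ => (hgs' i).mdifferentiableAt hU hl] at h1
  simp only [derivAlong_sum _ fun j _ => mdifferentiableAt_mul (hk _) (hg _ j),
    derivAlong_mul (hk _) (hg _ _), derivAlong_const, zero_mul, add_zero, h2] at h1
  exact h1.symm

/-- The differential of the Hamiltonian, as the one of `u_V - G(V, V) / 2` for the field
`V = ∑ c i • X i` with the constant coefficients `c i` of the velocity at `lam`. -/
theorem derivAlong_hamiltonian (hX : IsFrameOn D X U) {lam : CotangentBundle n M}
    (hl : lam.proj ∈ U) (w : TangentSpace (cotangentModel n) lam) :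
    derivAlong G.hamiltonian lam w =
      derivAlong (momentum fun q => ∑ i, G.coeff X i lam • X i q) lam w +
      differential (fun q => -(1 / 2) * ∑ i, ∑ j, G.coeff X i lam * G.coeff X j lam *
        G.gram X q i j) lam.proj (projVector w) := by
  have hU := hX.isOpen
  have hc : ∀ i, MDifferentiableAt (cotangentModel n) 𝓘(ℝ, ℝ) (G.coeff X i) lam :=
    fun i => (fiberPolynomialOn_coeff hX i).mdifferentiableAt hU hl
  have hu : ∀ i, MDifferentiableAt (cotangentModel n) 𝓘(ℝ, ℝ) (momentum (X i)) lam :=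
    fun i => (FiberPolynomialOn.momentum (hX.smooth i)).mdifferentiableAt hU hl
  have hgp : ∀ i j, FiberPolynomialOn U 0 fun l : CotangentBundle n M => G.gram X l.proj i j :=
    fun i j => .base (contMDiffOn_gram (G := G) hX i j)
  have hg := fun i j => (hgp i j).mdifferentiableAt hU hl
  have hcu : FiberPolynomialOn U 2 fun l => ∑ i, G.coeff X i l * momentum (X i) l :=
    .sum fun i _ => (fiberPolynomialOn_coeff hX i).mul (.momentum (hX.smooth i)) rfl
  have hk : ∀ c : ℝ, MDifferentiableAt (cotangentModel n) 𝓘(ℝ, ℝ)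
      (fun _ : CotangentBundle n M => c) lam := fun c => mdifferentiableAt_const
  have e1 : derivAlong G.hamiltonian lam w = (1 / 2) * ∑ i, (G.coeff X i lam *
      derivAlong (momentum (X i)) lam w + derivAlong (G.coeff X i) lam w * momentum (X i) lam) := by
    rw [derivAlong_congr_over hU hl (fun l hl => hamiltonian_eq_sum (G := G) hX hl),
      derivAlong_mul (hk _) (hcu.mdifferentiableAt hU hl), derivAlong_const,
      derivAlong_sum _ fun i _ => mdifferentiableAt_mul (hc i) (hu i)]
    simp only [derivAlong_mul (hc _) (hu _)]
    ring
  have e2 : ∀ i, derivAlong (momentum (X i)) lam w = ∑ j, (G.gram X lam.proj i j *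
      derivAlong (G.coeff X j) lam w +
        derivAlong (fun l : CotangentBundle n M => G.gram X l.proj i j) lam w *
          G.coeff X j lam) := by
    intro i
    rw [derivAlong_congr_over hU hl (fun l hl => (sum_gram_mul_coeff (G := G) hX hl i).symm),
      derivAlong_sum _ fun j _ => mdifferentiableAt_mul (hg i j) (hc j)]
    simp only [derivAlong_mul (hg _ _) (hc _)]
  have e3 : derivAlong (momentum fun q => ∑ i, G.coeff X i lam • X i q) lam w =
      ∑ i, G.coeff X i lam * derivAlong (momentum (X i)) lam w := by
    have : (momentum fun q => ∑ i, G.coeff X i lam • X i q) =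
        fun l : CotangentBundle n M => ∑ i, G.coeff X i lam * momentum (X i) l := by
      ext l
      simp only [momentum, map_sum, map_smul, smul_eq_mul]
    rw [this, derivAlong_sum _ fun i _ => mdifferentiableAt_mul (hk _) (hu i)]
    simp only [derivAlong_mul (hk _) (hu _), derivAlong_const, zero_mul, add_zero]
  have e4 := differential_sum_gram (G := G) hX hl (-(1 / 2)) (fun i => G.coeff X i lam)
    (projVector w)
  have e4' : ∀ i j, differential (fun q => G.gram X q i j) lam.proj (projVector w) =
      derivAlong (fun l : CotangentBundle n M => G.gram X l.proj i j) lam w := fun i j =>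
    (derivAlong_comp_proj (((contMDiffOn_gram hX i j).contMDiffAt (hU.mem_nhds hl)).mdifferentiableAt
      (by simp)) w).symm
  simp only [e4'] at e4
  have e5 : ∑ i, derivAlong (G.coeff X i) lam w * momentum (X i) lam =
      ∑ i, ∑ j, G.coeff X i lam * (G.gram X lam.proj i j * derivAlong (G.coeff X j) lam w) := by
    rw [Finset.sum_comm]
    refine Finset.sum_congr rfl fun i _ => ?_
    rw [← sum_gram_mul_coeff (G := G) hX hl i, Finset.mul_sum]
    refine Finset.sum_congr rfl fun j _ => ?_
    rw [gram_symm]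
    ring
  have e6 : ∑ i, G.coeff X i lam * derivAlong (momentum (X i)) lam w =
      ∑ i, ∑ j, G.coeff X i lam * (G.gram X lam.proj i j * derivAlong (G.coeff X j) lam w) +
      ∑ i, ∑ j, G.coeff X i lam * G.coeff X j lam *
        derivAlong (fun l : CotangentBundle n M => G.gram X l.proj i j) lam w := by
    rw [← Finset.sum_add_distrib]
    refine Finset.sum_congr rfl fun i _ => ?_
    rw [e2 i, Finset.mul_sum, ← Finset.sum_add_distrib]
    exact Finset.sum_congr rfl fun j _ => by ring
  rw [e1, Finset.sum_add_distrib, e3, e4, e5]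
  linear_combination (-1 / 2) * e6

theorem projVector_flowField (hX : IsFrameOn D X U) {lam : CotangentBundle n M}
    (hl : lam.proj ∈ U) :
    projVector (G.flowField lam) = ∑ i, G.coeff X i lam • X i lam.proj := by
  have hV : SmoothFieldOn (fun q => ∑ i, G.coeff X i lam • X i q) U :=
    .sum fun i => (hX.smooth i).smul contMDiffOn_const
  exact projVector_hamiltonianField (hV.contMDiffAt hX.isOpen hl)
    (derivAlong_hamiltonian hX hl)

theorem derivAlong_comp_proj_flowField (hX : IsFrameOn D X U) {lam : CotangentBundle n M}
    (hl : lam.proj ∈ U) {f : M → ℝ} (hf : MDifferentiableAt (𝓡 n) 𝓘(ℝ, ℝ) f lam.proj) :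
    derivAlong (fun l : CotangentBundle n M => f l.proj) lam (G.flowField lam) =
      ∑ i, G.coeff X i lam * differential f lam.proj (X i lam.proj) := by
  rw [derivAlong_comp_proj hf, projVector_flowField hX hl, map_sum]
  simp only [map_smul, smul_eq_mul]

/-- Hamilton's equation for the momentum of a field `Y`:
`u_Y' = ∑ c i u_[X i, Y] + ½ ∑ c i c j Y (g i j)`. -/
theorem derivAlong_momentum_flowField (hX : IsFrameOn D X U) {lam : CotangentBundle n M}
    (hl : lam.proj ∈ U) {Y : (q : M) → TangentSpace (𝓡 n) q} (hY : SmoothFieldOn Y U) :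
    derivAlong (momentum Y) lam (G.flowField lam) =
      ∑ i, G.coeff X i lam * momentum (mlieBracket (𝓡 n) (X i) Y) lam +
      (1 / 2) * ∑ i, ∑ j, G.coeff X i lam * G.coeff X j lam *
        differential (fun q => G.gram X q i j) lam.proj (Y lam.proj) := by
  have hU := hX.isOpen
  have hV : SmoothFieldOn (fun q => ∑ i, G.coeff X i lam • X i q) U :=
    .sum fun i => (hX.smooth i).smul contMDiffOn_const
  have h := derivAlong_momentum_hamiltonianField (hV.contMDiffAt hU hl) (hY.contMDiffAt hU hl)
    (derivAlong_hamiltonian (G := G) hX hl)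
  rw [differential_sum_gram hX hl] at h
  refine h.trans ?_
  rw [momentum, mlieBracket_sum_smul_left _ _ fun i =>
    ((hX.smooth i).contMDiffAt hU hl).mdifferentiableAt (by simp)]
  simp only [map_sum, map_smul, smul_eq_mul, momentum]
  ring

theorem derivAlong_hamiltonian_flowField (lam : CotangentBundle n M) :
    derivAlong G.hamiltonian lam (G.flowField lam) = 0 :=
  derivAlong_hamiltonianField_self _ _

end Metric

namespace FiberPolynomialOn

variable {G : Metric D} {X : Fin m → (q : M) → TangentSpace (𝓡 n) q} {d : ℕ}
  {F : CotangentBundle n M → ℝ}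

/-- The derivative along the Hamiltonian flow raises the degree on the fibers by one. -/
theorem derivAlong_flowField (hX : IsFrameOn D X U) (hF : FiberPolynomialOn U d F) :
    FiberPolynomialOn U (d + 1) fun lam => derivAlong F lam (G.flowField lam) := by
  have hU := hX.isOpen
  have hc := fun i => Metric.fiberPolynomialOn_coeff (G := G) hX i
  induction hF with
  | base hf =>
    refine FiberPolynomialOn.congr (.sum (s := Finset.univ) fun i _ =>
      (hc i).mul (.base (contMDiffOn_differential_apply hU (hX.smooth i) hf)) rfl)
      fun lam hl => ?_
    exact Metric.derivAlong_comp_proj_flowField hX hl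
      ((hf.contMDiffAt (hU.mem_nhds hl)).mdifferentiableAt (by simp))
  | momentum hY =>
    refine FiberPolynomialOn.congr (.add (.sum (s := Finset.univ) fun i _ =>
      (hc i).mul (.momentum ((hX.smooth i).mlieBracket hY hU)) rfl)
      (.const_mul (.sum (s := Finset.univ) fun i _ => .sum (s := Finset.univ) fun j _ =>
        ((hc i).mul (hc j) rfl).mul (.base (contMDiffOn_differential_apply hU hY
          (Metric.contMDiffOn_gram (G := G) hX i j))) rfl) (1 / 2)))
      fun lam hl => Metric.derivAlong_momentum_flowField hX hl hY
  | add h1 h2 ih1 ih2 =>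
    exact (ih1.add ih2).congr fun lam hl =>
      derivAlong_add (h1.mdifferentiableAt hU hl) (h2.mdifferentiableAt hU hl) _
  | mul h1 h2 hk ih1 ih2 =>
    exact ((h1.mul ih2 (by omega)).add (ih1.mul h2 (by omega))).congr fun lam hl =>
      derivAlong_mul (h1.mdifferentiableAt hU hl) (h2.mdifferentiableAt hU hl) _
  | congr h1 h ih =>
    exact ih.congr fun lam hl => derivAlong_congr_over hU hl h _
  | zero d => exact (FiberPolynomialOn.zero (d + 1)).congr fun lam _ => derivAlong_const _ _

end FiberPolynomialOn

end

/-! ### Polynomials on a fiber -/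

section

section Polynomial

variable {n d : ℕ}

theorem _root_.MvPolynomial.IsHomogeneous.eval_smul {P : MvPolynomial (Fin n) ℝ}
    (hP : P.IsHomogeneous d) (t : ℝ) (x : Fin n → ℝ) :
    MvPolynomial.eval (t • x) P = t ^ d * MvPolynomial.eval x P := by
  rw [MvPolynomial.eval_eq', MvPolynomial.eval_eq', Finset.mul_sum]
  refine Finset.sum_congr rfl fun s hs => ?_
  have h1 : ∑ i, s i = d := by
    rw [← Finsupp.degree_eq_sum]
    by_contra h
    exact (MvPolynomial.mem_support_iff.1 hs) (hP.coeff_eq_zero h)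
  simp only [Pi.smul_apply, smul_eq_mul, mul_pow, Finset.prod_mul_distrib,
    Finset.prod_pow_eq_pow_sum, h1]
  ring

theorem _root_.MvPolynomial.eq_zero_of_eventually_eval_eq_zero {P : MvPolynomial (Fin n) ℝ}
    {x₀ : Fin n → ℝ} (h : ∀ᶠ x in 𝓝 x₀, MvPolynomial.eval x P = 0) : P = 0 := by
  obtain ⟨ε, hε, hb⟩ := Metric.eventually_nhds_iff_ball.1 h
  refine MvPolynomial.funext_set (fun i => Metric.ball (x₀ i) ε) ?_ fun x hx => ?_
  · intro i
    rw [Real.ball_eq_Ioo]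
    exact Set.Ioo_infinite (by linarith)
  · rw [map_zero]
    refine hb x ?_
    rw [ball_pi _ hε]
    exact hx

theorem _root_.MvPolynomial.IsHomogeneous.eval_eq_sum {P : MvPolynomial (Fin n) ℝ}
    (hP : P.IsHomogeneous 1) :
    ∃ c : Fin n → ℝ, ∀ x, MvPolynomial.eval x P = ∑ i, c i * x i := by
  have h : P ∈ MvPolynomial.homogeneousSubmodule (Fin n) ℝ 1 := hP
  rw [MvPolynomial.homogeneousSubmodule_one_eq_span_X] at h
  obtain ⟨c, rfl⟩ := (Submodule.mem_span_range_iff_exists_fun ℝ).1 h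
  exact ⟨c, fun x => by simp [MvPolynomial.smul_eval]⟩

/-- A quadratic form over `ℝ` that has a nonzero value on the zero set of every linear form is
irreducible. -/
theorem _root_.MvPolynomial.IsHomogeneous.prime_of_forall_exists {P : MvPolynomial (Fin n) ℝ}
    (hP : P.IsHomogeneous 2)
    (h : ∀ c : Fin n → ℝ, ∃ x, ∑ i, c i * x i = 0 ∧ MvPolynomial.eval x P ≠ 0) : Prime P := by
  have hP0 : P ≠ 0 := by
    rintro rfl
    obtain ⟨x, _, hx⟩ := h 0
    exact hx (map_zero _)
  have unit_of : ∀ A : MvPolynomial (Fin n) ℝ, A ≠ 0 → A.totalDegree = 0 → IsUnit A := by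
    intro A hA hd
    rw [MvPolynomial.totalDegree_eq_zero_iff_eq_C] at hd
    rw [hd]
    refine (isUnit_iff_ne_zero.2 fun h0 => hA ?_).map MvPolynomial.C
    rw [hd, h0, map_zero]
  rw [← irreducible_iff_prime]
  refine ⟨fun hu => ?_, fun A B hAB => ?_⟩
  · have := (MvPolynomial.isUnit_iff_totalDegree_of_isReduced.1 hu).2
    rw [hP.totalDegree hP0] at this
    omega
  · have hA : A ≠ 0 := by rintro rfl; exact hP0 (by rw [hAB, zero_mul])
    have hB : B ≠ 0 := by rintro rfl; exact hP0 (by rw [hAB, mul_zero])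
    have hdeg : A.totalDegree + B.totalDegree = 2 := by
      rw [← MvPolynomial.totalDegree_mul_of_isDomain hA hB, ← hAB, hP.totalDegree hP0]
    by_contra hcon
    rw [not_or] at hcon
    have hA1 : A.totalDegree = 1 := by
      have h1 : A.totalDegree ≠ 0 := fun h0 => hcon.1 (unit_of A hA h0)
      have h2 : B.totalDegree ≠ 0 := fun h0 => hcon.2 (unit_of B hB h0)
      omega
    have hB1 : B.totalDegree = 1 := by omega
    have affine : ∀ A : MvPolynomial (Fin n) ℝ, A.totalDegree = 1 →
        ∃ (a : ℝ) (c : Fin n → ℝ), ∀ x, MvPolynomial.eval x A = a + ∑ i, c i * x i := by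
      intro A hA
      obtain ⟨c, hc⟩ := (MvPolynomial.homogeneousComponent_isHomogeneous 1 A).eval_eq_sum
      refine ⟨MvPolynomial.coeff 0 A, c, fun x => ?_⟩
      have h1 := MvPolynomial.sum_homogeneousComponent A
      rw [hA, Finset.sum_range_succ, Finset.sum_range_one,
        MvPolynomial.homogeneousComponent_zero] at h1
      conv_lhs => rw [← h1]
      rw [map_add, hc, MvPolynomial.eval_C]
    obtain ⟨a, c, hc⟩ := affine A hA1
    obtain ⟨b, e, he⟩ := affine B hB1
    obtain ⟨x, hx, hPx⟩ := h c
    -- compare the values at `x`, `-x` and `0` to see that the linear parts multiply to `P`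
    have h1 : MvPolynomial.eval x P = (a + ∑ i, c i * x i) * (b + ∑ i, e i * x i) := by
      rw [hAB, map_mul, hc, he]
    have h2 : MvPolynomial.eval ((-1 : ℝ) • x) P =
        (a - ∑ i, c i * x i) * (b - ∑ i, e i * x i) := by
      rw [hAB, map_mul, hc, he]
      simp [sub_eq_add_neg]
    have h3 : MvPolynomial.eval ((0 : ℝ) • x) P = a * b := by
      rw [hAB, map_mul, hc, he]
      simp
    rw [hP.eval_smul] at h2 h3
    apply hPx
    rw [hx] at h1 h2
    linear_combination (1 / 2) * h1 + (1 / 2) * h2 - h3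

end Polynomial

variable {m n : ℕ} {M : Type*} [TopologicalSpace M] [ChartedSpace (Model n) M]
  [IsManifold (𝓡 n) ∞ M] {U : Set M} {D : VectorDistribution m n M} {q : M}
  {b : Module.Basis (Fin n) ℝ (TangentSpace (𝓡 n) q)} {d : ℕ} {F : CotangentBundle n M → ℝ}

/-- The covector in `T_q^* M` with the components `x` in the dual basis of `b`. -/
def covectorOfCoords (b : Module.Basis (Fin n) ℝ (TangentSpace (𝓡 n) q)) :
    (Fin n → ℝ) →ₗ[ℝ] CotangentSpace n M q :=
  (LinearMap.toContinuousLinearMap (𝕜 := ℝ) (E := Model n) (F' := ℝ)).toLinearMap.comp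
    (b.constr ℝ).toLinearMap

omit [IsManifold (𝓡 n) ∞ M] in
theorem covectorOfCoords_apply (x : Fin n → ℝ) (i : Fin n) :
    covectorOfCoords b x (b i) = x i := b.constr_basis ℝ x i

omit [IsManifold (𝓡 n) ∞ M] in
theorem covectorOfCoords_coords (p : CotangentSpace n M q) :
    covectorOfCoords b (fun i => p (b i)) = p := by
  apply ContinuousLinearMap.coe_injective
  exact b.ext fun i => covectorOfCoords_apply _ i

omit [IsManifold (𝓡 n) ∞ M] in
theorem Metric.IsFiberPolynomial.eval_eq {P : MvPolynomial (Fin n) ℝ}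
    (h : Metric.IsFiberPolynomial F q b P) (x : Fin n → ℝ) :
    MvPolynomial.eval x P = F ⟨q, covectorOfCoords b x⟩ := by
  rw [h]
  simp only [covectorOfCoords_apply]

theorem FiberPolynomialOn.exists_polynomial (hF : FiberPolynomialOn U d F) (hq : q ∈ U)
    (b : Module.Basis (Fin n) ℝ (TangentSpace (𝓡 n) q)) :
    ∃ P : MvPolynomial (Fin n) ℝ, P.IsHomogeneous d ∧ Metric.IsFiberPolynomial F q b P := by
  induction hF with
  | @base f hf => exact ⟨.C (f q), MvPolynomial.isHomogeneous_C _ _, fun p => by simp⟩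
  | @momentum Y hY =>
    obtain ⟨c, hc⟩ : ∃ c : Fin n → ℝ, ∀ i, c i = b.repr (Y q) i := ⟨_, fun i => rfl⟩
    refine ⟨∑ i, MvPolynomial.C (c i) * MvPolynomial.X i, MvPolynomial.IsHomogeneous.sum _ _ _
      fun i _ => MvPolynomial.isHomogeneous_C_mul_X _ _, fun p => ?_⟩
    have h1 : ∀ L : TangentSpace (𝓡 n) q →ₗ[ℝ] ℝ, L (Y q) = ∑ i, b.repr (Y q) i * L (b i) := by
      intro L
      conv_lhs => rw [← b.sum_repr (Y q), map_sum]
      simp only [map_smul, smul_eq_mul]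
    rw [map_sum]
    simp only [map_mul, MvPolynomial.eval_C, MvPolynomial.eval_X, hc]
    exact h1 (ContinuousLinearMap.toLinearMap p)
  | add _ _ h1 h2 =>
    obtain ⟨P, hP, hP'⟩ := h1
    obtain ⟨Q, hQ, hQ'⟩ := h2
    exact ⟨P + Q, hP.add hQ, fun p => by rw [map_add, ← hP', ← hQ']⟩
  | mul _ _ hk h1 h2 =>
    obtain ⟨P, hP, hP'⟩ := h1
    obtain ⟨Q, hQ, hQ'⟩ := h2
    exact ⟨P * Q, hk ▸ hP.mul hQ, fun p => by rw [map_mul, ← hP', ← hQ']⟩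
  | congr _ h h1 =>
    obtain ⟨P, hP, hP'⟩ := h1
    exact ⟨P, hP, fun p => by rw [h _ hq, hP']⟩
  | zero d => exact ⟨0, MvPolynomial.isHomogeneous_zero _ _ _, fun p => by simp⟩

theorem continuous_covectorOfCoords :
    Continuous fun x : Fin n → ℝ => (⟨q, covectorOfCoords b x⟩ : CotangentBundle n M) := by
  refine (FiberBundle.continuous_totalSpaceMk (Model n →L[ℝ] ℝ) (CotangentSpace n M) q).comp ?_
  let L : (Fin n → ℝ) →ₗ[ℝ] (Model n →L[ℝ] ℝ) := covectorOfCoords b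
  have : Continuous L := L.continuous_of_finiteDimensional
  exact this

/-- A homogeneous polynomial on `T_q^* M` that vanishes on a nonempty relatively open subset of
the level set of the Hamiltonian is zero. -/
theorem Metric.IsFiberPolynomial.eq_zero_of_levelSet {G : Metric D}
    {X : Fin m → (q : M) → TangentSpace (𝓡 n) q} (hX : IsFrameOn D X U) (hq : q ∈ U)
    {P : MvPolynomial (Fin n) ℝ} (hP : P.IsHomogeneous d)
    (hFP : Metric.IsFiberPolynomial F q b P) {O : Set (CotangentBundle n M)} (hO : IsOpen O)
    {p₀ : CotangentSpace n M q} (h0 : (⟨q, p₀⟩ : CotangentBundle n M) ∈ O ∩ G.levelSet)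
    (hF : ∀ p : CotangentSpace n M q, (⟨q, p⟩ : CotangentBundle n M) ∈ O ∩ G.levelSet →
      F ⟨q, p⟩ = 0) : P = 0 := by
  obtain ⟨H, hH, hGH⟩ := (Metric.fiberPolynomialOn_hamiltonian (G := G) hX).exists_polynomial hq b
  let x₀ : Fin n → ℝ := fun i => p₀ (b i)
  have hx₀ : covectorOfCoords b x₀ = p₀ := covectorOfCoords_coords p₀
  have hHx₀ : MvPolynomial.eval x₀ H = 1 / 2 := by
    rw [hGH.eval_eq, hx₀]
    exact h0.2
  -- `x` is near `x₀` on the ray of the point `r x • x` of the level set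
  let r : (Fin n → ℝ) → ℝ := fun x => (Real.sqrt (2 * MvPolynomial.eval x H))⁻¹
  have hHc : Continuous fun x => MvPolynomial.eval x H := MvPolynomial.continuous_eval H
  have hsq : Continuous fun x => Real.sqrt (2 * MvPolynomial.eval x H) :=
    Real.continuous_sqrt.comp (continuous_const.mul hHc)
  have hr : ContinuousAt (fun x => r x • x) x₀ := by
    have h1 : Real.sqrt (2 * MvPolynomial.eval x₀ H) ≠ 0 := by
      rw [hHx₀]
      norm_num
    have h2 : ContinuousAt r x₀ := hsq.continuousAt.inv₀ h1
    exact h2.smul continuousAt_id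
  have hrx₀ : r x₀ = 1 := by simp [r, hHx₀]
  refine MvPolynomial.eq_zero_of_eventually_eval_eq_zero (x₀ := x₀) ?_
  have e1 : ∀ᶠ x in 𝓝 x₀, (⟨q, covectorOfCoords b (r x • x)⟩ : CotangentBundle n M) ∈ O := by
    have h1 : ContinuousAt (fun x => (⟨q, covectorOfCoords b (r x • x)⟩ : CotangentBundle n M))
        x₀ :=
      ContinuousAt.comp (g := fun x : Fin n → ℝ =>
        (⟨q, covectorOfCoords b x⟩ : CotangentBundle n M))
        (continuous_covectorOfCoords (b := b)).continuousAt hr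
    refine h1.eventually (hO.mem_nhds ?_)
    change (⟨q, covectorOfCoords b (r x₀ • x₀)⟩ : CotangentBundle n M) ∈ O
    rw [hrx₀, one_smul, hx₀]
    exact h0.1
  have e2 : ∀ᶠ x in 𝓝 x₀, 0 < MvPolynomial.eval x H :=
    hHc.continuousAt.eventually (lt_mem_nhds (one_half_pos.trans_eq hHx₀.symm))
  filter_upwards [e1, e2] with x hx hpos
  have hs : Real.sqrt (2 * MvPolynomial.eval x H) ≠ 0 := by positivity
  have hr0 : r x ≠ 0 := inv_ne_zero hs
  have hlev : (⟨q, covectorOfCoords b (r x • x)⟩ : CotangentBundle n M) ∈ G.levelSet := by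
    change G.hamiltonian _ = 1 / 2
    rw [← hGH.eval_eq, hH.eval_smul, inv_pow, Real.sq_sqrt (by positivity)]
    field_simp
  have h1 := hF _ ⟨hx, hlev⟩
  rw [← hFP.eval_eq, hP.eval_smul] at h1
  exact (mul_eq_zero.1 h1).resolve_left (pow_ne_zero _ hr0)

theorem Metric.transitionQuadric_eq_zero_iff {G₁ G₂ : Metric D} {lam : CotangentBundle n M} :
    Metric.transitionQuadric G₁ G₂ lam = 0 ↔ restrictCovector D lam = 0 := by
  rw [transitionQuadric]
  constructor
  · intro h
    by_contra h0
    exact (G₂.pos _ _ fun h1 => h0 ((G₁.sharp _).map_eq_zero_iff.1 h1)).ne' h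
  · intro h
    rw [h, map_zero, map_zero]

/-- If `D` has rank at least two, the quadratic polynomial `P` is irreducible on each fiber: the
zero set of a linear form is not contained in the annihilator of `D`. -/
theorem Metric.prime_transitionQuadric {G₁ G₂ : Metric D} {P : MvPolynomial (Fin n) ℝ}
    (hP : P.IsHomogeneous 2)
    (hFP : Metric.IsFiberPolynomial (Metric.transitionQuadric G₁ G₂) q b P)
    (hD : 2 ≤ Module.finrank ℝ (D.fiber q)) : Prime P := by
  refine hP.prime_of_forall_exists fun c => ?_
  let a : TangentSpace (𝓡 n) q := ∑ i, c i • b i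
  have h1 : ¬ D.fiber q ≤ Submodule.span ℝ {a} := by
    intro hle
    have := (Submodule.finrank_mono hle).trans (finrank_span_le_card {a})
    simp at this
    omega
  obtain ⟨v, hv, hva⟩ := Set.not_subset.1 h1
  obtain ⟨f, hfv, hf⟩ := Submodule.exists_le_ker_of_notMem hva
  refine ⟨fun i => f (b i), ?_, fun h0 => ?_⟩
  · have : f a = 0 := hf (Submodule.mem_span_singleton_self a)
    simpa [a] using this
  · rw [hFP.eval_eq, Metric.transitionQuadric_eq_zero_iff] at h0
    have h2 : covectorOfCoords b (fun i => f (b i)) v = 0 := LinearMap.congr_fun h0 ⟨v, hv⟩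
    have h3 : b.constr ℝ (fun i => f (b i)) = f := b.ext fun i => by simp
    exact hfv ((LinearMap.congr_fun h3 v).symm.trans h2)

end

/-! ### Linked trajectories -/

section

variable {m n : ℕ} {M : Type*} [TopologicalSpace M] [ChartedSpace (Model n) M]
  [IsManifold (𝓡 n) ∞ M] {U : Set M} {D : VectorDistribution m n M} {G₁ G₂ : Metric D}
  {X : Fin m → (q : M) → TangentSpace (𝓡 n) q}

namespace Metric

theorem transitionQuadric_eq_sum (hX : IsFrameOn D X U) {lam : CotangentBundle n M}
    (hl : lam.proj ∈ U) :
    transitionQuadric G₁ G₂ lam =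
      ∑ i, ∑ j, G₁.coeff X i lam * G₁.coeff X j lam * G₂.gram X lam.proj i j := by
  rw [transitionQuadric, sharp_eq_sum_coeff hX hl, sum_gram_mul]

theorem fiberPolynomialOn_transitionQuadric (hX : IsFrameOn D X U) :
    FiberPolynomialOn U 2 (transitionQuadric G₁ G₂) :=
  FiberPolynomialOn.congr (.sum (s := Finset.univ) fun i _ => .sum (s := Finset.univ) fun j _ =>
    ((fiberPolynomialOn_coeff hX i).mul (fiberPolynomialOn_coeff hX j) rfl).mul
      (.base (contMDiffOn_gram (G := G₂) hX i j)) rfl) fun _ hl => transitionQuadric_eq_sum hX hl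

theorem fiberPolynomialOn_transitionCubic (hX : IsFrameOn D X U) :
    FiberPolynomialOn U 3 (transitionCubic G₁ G₂) :=
  (fiberPolynomialOn_transitionQuadric hX).derivAlong_flowField hX

theorem hamiltonian_eq_sum_gram {G : Metric D} (hX : IsFrameOn D X U) {lam : CotangentBundle n M}
    (hl : lam.proj ∈ U) :
    G.hamiltonian lam =
      (1 / 2) * ∑ i, ∑ j, G.coeff X i lam * G.coeff X j lam * G.gram X lam.proj i j := by
  rw [hamiltonian_eq_sum hX hl]
  congr 1
  refine Finset.sum_congr rfl fun i _ => ?_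
  rw [← sum_gram_mul_coeff (G := G) hX hl i, Finset.mul_sum]
  exact Finset.sum_congr rfl fun j _ => by ring

theorem transitionQuadric_ne_zero {lam : CotangentBundle n M} (hl : lam ∈ G₁.levelSet) :
    transitionQuadric G₁ G₂ lam ≠ 0 := by
  rw [Ne, transitionQuadric_eq_zero_iff]
  intro h
  have h1 : G₁.hamiltonian lam = 1 / 2 := hl
  rw [hamiltonian_eq_sharp, h] at h1
  norm_num at h1

variable (G₁ G₂)

/-- The covector `G₂ (v, X i)` of the velocity `v = I₁ (p|_D)`, evaluated on the field `X i`. -/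
def velocityCovector (X : Fin m → (q : M) → TangentSpace (𝓡 n) q) (i : Fin m)
    (lam : CotangentBundle n M) : ℝ :=
  ∑ j, G₂.gram X lam.proj i j * G₁.coeff X j lam

variable {G₁ G₂}

theorem fiberPolynomialOn_velocityCovector (hX : IsFrameOn D X U) (i : Fin m) :
    FiberPolynomialOn U 1 (velocityCovector G₁ G₂ X i) :=
  .sum fun j _ => .base_mul (contMDiffOn_gram (G := G₂) hX i j) (fiberPolynomialOn_coeff hX j)

/-- Every vector of `D(q)` is the velocity of a covector. -/
theorem exists_covector_coeff (G : Metric D) (hX : IsFrameOn D X U) {q : M} (hq : q ∈ U)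
    (a : Fin m → ℝ) :
    ∃ p : CotangentSpace n M q, ∀ i, G.coeff X i ⟨q, p⟩ = a i := by
  let l : Module.Dual ℝ (D.fiber q) := G.form q (∑ i, a i • toFiber D (X i) q)
  obtain ⟨f, hf⟩ := LinearMap.exists_extend l
  let p : CotangentSpace n M q :=
    LinearMap.toContinuousLinearMap (𝕜 := ℝ) (E := Model n) (F' := ℝ) f
  have hp : restrictCovector D (⟨q, p⟩ : CotangentBundle n M) = l := hf
  have h1 := sharp_eq_sum_coeff (G := G) hX (lam := (⟨q, p⟩ : CotangentBundle n M)) hq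
  have h2 : G.sharp q l = ∑ i, a i • toFiber D (X i) q := by
    rw [sharp, LinearEquiv.symm_apply_eq]
    rfl
  rw [hp, h2] at h1
  refine ⟨p, fun i => ?_⟩
  have h3 : ∑ i, (G.coeff X i (⟨q, p⟩ : CotangentBundle n M) - a i) • toFiber D (X i) q = 0 := by
    simp only [sub_smul, Finset.sum_sub_distrib, h1, sub_self]
  exact sub_eq_zero.1
    (Fintype.linearIndependent_iff.1 (linearIndependent_toFiber hX hq) _ h3 i)

end Metric

/-- A trajectory `lam` of the Hamiltonian flow of `G₁` on its level set, with a curve `mu` in the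
level set of `G₂` over the same curve of `M` that is a reparametrized (by the factor `a`)
trajectory of the Hamiltonian flow of `G₂`; `J` is the open set of times, and the curves lie
over `U`. -/
structure LinkedTrajectories (G₁ G₂ : Metric D) (U : Set M) (lam mu : ℝ → CotangentBundle n M)
    (a : ℝ → ℝ) (J : Set ℝ) : Prop where
  isOpen : IsOpen J
  proj_mem : ∀ t ∈ J, (lam t).proj ∈ U
  proj_eq : ∀ t ∈ J, (mu t).proj = (lam t).proj
  lam_mem : ∀ t ∈ J, lam t ∈ G₁.levelSet
  mu_mem : ∀ t ∈ J, mu t ∈ G₂.levelSet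
  hasMFDerivAt_lam : ∀ t ∈ J, HasMFDerivAt 𝓘(ℝ, ℝ) (cotangentModel n) lam t
    ((1 : ℝ →L[ℝ] ℝ).smulRight (G₁.flowField (lam t)))
  hasMFDerivAt_mu : ∀ t ∈ J, HasMFDerivAt 𝓘(ℝ, ℝ) (cotangentModel n) mu t
    ((1 : ℝ →L[ℝ] ℝ).smulRight (a t • G₂.flowField (mu t)))

theorem derivAlong_smul (F : CotangentBundle n M → ℝ) (lam : CotangentBundle n M) (c : ℝ)
    (w : TangentSpace (cotangentModel n) lam) :
    derivAlong F lam (c • w) = c * derivAlong F lam w :=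
  map_smul (mfderiv (cotangentModel n) 𝓘(ℝ, ℝ) F lam) c w

namespace LinkedTrajectories

open SubRiem.Metric

variable {lam mu : ℝ → CotangentBundle n M} {a : ℝ → ℝ} {J : Set ℝ} {t : ℝ}

theorem mu_proj_mem (h : LinkedTrajectories G₁ G₂ U lam mu a J) (ht : t ∈ J) :
    (mu t).proj ∈ U := by
  rw [h.proj_eq t ht]
  exact h.proj_mem t ht

/-- The two curves have the same projection to `M`, so their velocities are equal. -/
theorem coeff_eq (hX : IsFrameOn D X U) (h : LinkedTrajectories G₁ G₂ U lam mu a J)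
    (ht : t ∈ J) (i : Fin m) : G₁.coeff X i (lam t) = a t * G₂.coeff X i (mu t) := by
  have hl := h.proj_mem t ht
  have hm := h.mu_proj_mem ht
  have h1 := (hasMFDerivAt_proj (lam t)).comp t (h.hasMFDerivAt_lam t ht)
  have h2 := (hasMFDerivAt_proj (mu t)).comp t (h.hasMFDerivAt_mu t ht)
  have h3 : (fun l : CotangentBundle n M => l.proj) ∘ lam =ᶠ[𝓝 t]
      (fun l : CotangentBundle n M => l.proj) ∘ mu := by
    filter_upwards [h.isOpen.mem_nhds ht] with s hs using (h.proj_eq s hs).symm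
  have h4 := hasMFDerivAt_unique h1 (h2.congr_of_eventuallyEq h3)
  have h5 : projVector ((1 : ℝ) • G₁.flowField (lam t)) =
      (projVector ((1 : ℝ) • (a t • G₂.flowField (mu t))) : Model n) :=
    congrArg (fun L : ℝ →L[ℝ] Model n => L 1) h4
  have h6 : projVector (G₁.flowField (lam t)) =
      (a t • projVector (G₂.flowField (mu t)) : Model n) := by
    rw [one_smul, one_smul] at h5
    exact h5
  rw [projVector_flowField hX hl, projVector_flowField hX hm] at h6
  have h7 : ∀ i, (X i (mu t).proj : Model n) = X i (lam t).proj := fun i => by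
    rw [h.proj_eq t ht]
  have h8 : ∑ i, (G₁.coeff X i (lam t) - a t * G₂.coeff X i (mu t)) •
      (X i (lam t).proj : Model n) = 0 := by
    simp only [sub_smul, Finset.sum_sub_distrib, mul_smul, ← Finset.smul_sum]
    rw [sub_eq_zero]
    refine h6.trans (congrArg (a t • ·) ?_)
    exact Finset.sum_congr rfl fun i _ => congrArg (G₂.coeff X i (mu t) • ·) (h7 i)
  exact sub_eq_zero.1 (Fintype.linearIndependent_iff.1 (hX.linearIndependent _ hl) _ h8 i)

/-- The velocity of `mu` has unit length for `G₂` before the change of parameter. -/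
theorem sq_eq_transitionQuadric (hX : IsFrameOn D X U)
    (h : LinkedTrajectories G₁ G₂ U lam mu a J) (ht : t ∈ J) :
    a t ^ 2 = transitionQuadric G₁ G₂ (lam t) := by
  have h1 : G₂.hamiltonian (mu t) = 1 / 2 := h.mu_mem t ht
  rw [hamiltonian_eq_sum_gram hX (h.mu_proj_mem ht), h.proj_eq t ht] at h1
  rw [transitionQuadric_eq_sum hX (h.proj_mem t ht)]
  simp only [h.coeff_eq hX ht]
  have h2 : ∀ i j, a t * G₂.coeff X i (mu t) * (a t * G₂.coeff X j (mu t)) *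
      G₂.gram X (lam t).proj i j = a t ^ 2 * (G₂.coeff X i (mu t) * G₂.coeff X j (mu t) *
        G₂.gram X (lam t).proj i j) := fun i j => by ring
  simp only [h2, ← Finset.mul_sum]
  linear_combination (-2) * a t ^ 2 * h1

theorem factor_ne_zero (hX : IsFrameOn D X U)
    (h : LinkedTrajectories G₁ G₂ U lam mu a J) (ht : t ∈ J) : a t ≠ 0 := by
  intro h0
  refine transitionQuadric_ne_zero (G₂ := G₂) (h.lam_mem t ht) ?_
  rw [← h.sq_eq_transitionQuadric hX ht, h0]
  norm_num

/-- The rescaled momenta of the fields of the frame are linear functions of the first trajectory. -/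
theorem factor_mul_momentum_frame (hX : IsFrameOn D X U)
    (h : LinkedTrajectories G₁ G₂ U lam mu a J) (ht : t ∈ J) (i : Fin m) :
    a t * momentum (X i) (mu t) = velocityCovector G₁ G₂ X i (lam t) := by
  rw [← sum_gram_mul_coeff (G := G₂) hX (h.mu_proj_mem ht) i, velocityCovector, Finset.mul_sum,
    h.proj_eq t ht]
  refine Finset.sum_congr rfl fun j _ => ?_
  rw [h.coeff_eq hX ht]
  ring

/-- An expression of the factor that shows that it is differentiable. -/
theorem factor_eq (hX : IsFrameOn D X U)
    (h : LinkedTrajectories G₁ G₂ U lam mu a J) (ht : t ∈ J) :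
    a t = ∑ i, G₁.coeff X i (lam t) * momentum (X i) (mu t) := by
  refine mul_left_cancel₀ (h.factor_ne_zero hX ht) ?_
  rw [← sq, h.sq_eq_transitionQuadric hX ht, transitionQuadric_eq_sum hX (h.proj_mem t ht),
    Finset.mul_sum]
  refine Finset.sum_congr rfl fun i _ => ?_
  rw [mul_left_comm, h.factor_mul_momentum_frame hX ht, velocityCovector, Finset.mul_sum]
  exact Finset.sum_congr rfl fun j _ => by ring

theorem hasDerivAt_comp_lam (h : LinkedTrajectories G₁ G₂ U lam mu a J) (ht : t ∈ J)
    (hU : IsOpen U) {d : ℕ} {F : CotangentBundle n M → ℝ} (hF : FiberPolynomialOn U d F) :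
    HasDerivAt (fun s => F (lam s)) (derivAlong F (lam t) (G₁.flowField (lam t))) t :=
  hasDerivAt_comp_curve (hF.mdifferentiableAt hU (h.proj_mem t ht)) (h.hasMFDerivAt_lam t ht)

theorem hasDerivAt_comp_mu (h : LinkedTrajectories G₁ G₂ U lam mu a J) (ht : t ∈ J)
    (hU : IsOpen U) {d : ℕ} {F : CotangentBundle n M → ℝ} (hF : FiberPolynomialOn U d F) :
    HasDerivAt (fun s => F (mu s)) (a t * derivAlong F (mu t) (G₂.flowField (mu t))) t := by
  rw [← derivAlong_smul]
  exact hasDerivAt_comp_curve (hF.mdifferentiableAt hU (h.mu_proj_mem ht)) (h.hasMFDerivAt_mu t ht)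

theorem exists_hasDerivAt_factor (hX : IsFrameOn D X U)
    (h : LinkedTrajectories G₁ G₂ U lam mu a J) (ht : t ∈ J) :
    ∃ a', HasDerivAt a a' t ∧ 2 * a t * a' = transitionCubic G₁ G₂ (lam t) := by
  have h1 : a =ᶠ[𝓝 t] fun s => ∑ i, G₁.coeff X i (lam s) * momentum (X i) (mu s) := by
    filter_upwards [h.isOpen.mem_nhds ht] with s hs using h.factor_eq hX hs
  have h2 : DifferentiableAt ℝ (fun s => ∑ i, G₁.coeff X i (lam s) * momentum (X i) (mu s)) t :=
    DifferentiableAt.fun_sum fun i _ =>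
      (h.hasDerivAt_comp_lam ht hX.isOpen (fiberPolynomialOn_coeff hX i)).differentiableAt.mul
      (h.hasDerivAt_comp_mu ht hX.isOpen (.momentum (hX.smooth i))).differentiableAt
  have h3 := (h2.congr_of_eventuallyEq h1).hasDerivAt
  refine ⟨_, h3, ?_⟩
  have h4 : (fun s => a s ^ 2) =ᶠ[𝓝 t] fun s => transitionQuadric G₁ G₂ (lam s) := by
    filter_upwards [h.isOpen.mem_nhds ht] with s hs using h.sq_eq_transitionQuadric hX hs
  have h5 := (h.hasDerivAt_comp_lam ht hX.isOpen
    (fiberPolynomialOn_transitionQuadric (G₁ := G₁) (G₂ := G₂) hX)).congr_of_eventuallyEq h4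
  have h6 := (h3.pow 2).unique h5
  have h7 : 2 * a t * deriv a t = derivAlong (transitionQuadric G₁ G₂) (lam t)
      (G₁.flowField (lam t)) := by simpa using h6
  exact h7

/-- The fundamental equation of an orbital equivalence: the rescaled momentum `w_Y = a u_Y` of
the second trajectory satisfies
`w_Y' = (P' / 2P) w_Y + ∑ c i w_[X i, Y] + ½ ∑ c i c j Y (g₂ i j)`. -/
theorem exists_hasDerivAt_rescaled (hX : IsFrameOn D X U)
    (h : LinkedTrajectories G₁ G₂ U lam mu a J) (ht : t ∈ J)
    {Y : (q : M) → TangentSpace (𝓡 n) q} (hY : SmoothFieldOn Y U) :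
    ∃ w', HasDerivAt (fun s => a s * momentum Y (mu s)) w' t ∧
      2 * transitionQuadric G₁ G₂ (lam t) * w' =
        transitionCubic G₁ G₂ (lam t) * (a t * momentum Y (mu t)) +
        2 * transitionQuadric G₁ G₂ (lam t) *
          (∑ i, G₁.coeff X i (lam t) * (a t * momentum (mlieBracket (𝓡 n) (X i) Y) (mu t)) +
          (1 / 2) * ∑ i, ∑ j, G₁.coeff X i (lam t) * G₁.coeff X j (lam t) *
            differential (fun q => G₂.gram X q i j) (lam t).proj (Y (lam t).proj)) := by
  obtain ⟨a', ha, haa⟩ := h.exists_hasDerivAt_factor hX ht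
  have h1 := h.hasDerivAt_comp_mu ht hX.isOpen (.momentum hY)
  refine ⟨_, ha.mul h1, ?_⟩
  rw [derivAlong_momentum_flowField hX (h.mu_proj_mem ht) hY]
  have h2 : ∀ i j, differential (fun q => G₂.gram X q i j) (mu t).proj (Y (mu t).proj) =
      differential (fun q => G₂.gram X q i j) (lam t).proj (Y (lam t).proj) := fun i j => by
    rw [h.proj_eq t ht]
  have h3 : ∑ i, G₁.coeff X i (lam t) * (a t * momentum (mlieBracket (𝓡 n) (X i) Y) (mu t)) =
      a t ^ 2 * ∑ i, G₂.coeff X i (mu t) * momentum (mlieBracket (𝓡 n) (X i) Y) (mu t) := by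
    rw [Finset.mul_sum]
    refine Finset.sum_congr rfl fun i _ => ?_
    rw [h.coeff_eq hX ht]
    ring
  have h4 : ∑ i, ∑ j, G₁.coeff X i (lam t) * G₁.coeff X j (lam t) *
      differential (fun q => G₂.gram X q i j) (lam t).proj (Y (lam t).proj) =
      a t ^ 2 * ∑ i, ∑ j, G₂.coeff X i (mu t) * G₂.coeff X j (mu t) *
        differential (fun q => G₂.gram X q i j) (lam t).proj (Y (lam t).proj) := by
    simp only [Finset.mul_sum]
    refine Finset.sum_congr rfl fun i _ => Finset.sum_congr rfl fun j _ => ?_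
    rw [h.coeff_eq hX ht, h.coeff_eq hX ht]
    ring
  simp only [h2]
  rw [h3, h4, ← haa, ← h.sq_eq_transitionQuadric hX ht]
  ring

end LinkedTrajectories

end

/-! ### Brackets and divisibility -/

section

variable {m n : ℕ} {M : Type*} [TopologicalSpace M] [ChartedSpace (Model n) M]
  [IsManifold (𝓡 n) ∞ M] {U : Set M} {D : VectorDistribution m n M} {G₁ G₂ : Metric D}
  {X : Fin m → (q : M) → TangentSpace (𝓡 n) q}

section FiberDvd

variable {q : M} {b : Module.Basis (Fin n) ℝ (TangentSpace (𝓡 n) q)} {d e : ℕ}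
  {F G : CotangentBundle n M → ℝ} {P R : MvPolynomial (Fin n) ℝ}

namespace Metric

omit [IsManifold (𝓡 n) ∞ M] in
theorem IsFiberPolynomial.unique (h : IsFiberPolynomial F q b P) (h' : IsFiberPolynomial F q b R) :
    P = R :=
  MvPolynomial.funext fun x => by rw [h.eval_eq, h'.eval_eq]

omit [IsManifold (𝓡 n) ∞ M] in
theorem IsFiberPolynomial.add (h : IsFiberPolynomial F q b P) (h' : IsFiberPolynomial G q b R) :
    IsFiberPolynomial (fun l => F l + G l) q b (P + R) :=
  fun p => by rw [map_add, ← h p, ← h' p]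

omit [IsManifold (𝓡 n) ∞ M] in
theorem IsFiberPolynomial.mul (h : IsFiberPolynomial F q b P) (h' : IsFiberPolynomial G q b R) :
    IsFiberPolynomial (fun l => F l * G l) q b (P * R) :=
  fun p => by rw [map_mul, ← h p, ← h' p]

end Metric

/-- The function `F` on `T^* M` is given on the fiber over `q` by a polynomial divisible by
`P`. -/
def FiberDvd (b : Module.Basis (Fin n) ℝ (TangentSpace (𝓡 n) q)) (P : MvPolynomial (Fin n) ℝ)
    (F : CotangentBundle n M → ℝ) : Prop :=
  ∃ R, Metric.IsFiberPolynomial F q b R ∧ P ∣ R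

theorem not_fiberDvd_mul (hP : Prime P) (hq : q ∈ U) (hF : FiberPolynomialOn U d F)
    (hG : FiberPolynomialOn U e G) (h : ¬ FiberDvd b P F) (h' : ¬ FiberDvd b P G) :
    ¬ FiberDvd b P fun l => F l * G l := by
  rintro ⟨R, hR, hPR⟩
  obtain ⟨A, -, hA⟩ := hF.exists_polynomial hq b
  obtain ⟨B, -, hB⟩ := hG.exists_polynomial hq b
  rw [hR.unique (hA.mul hB)] at hPR
  exact (hP.dvd_or_dvd hPR).elim (fun h1 => h ⟨A, hA, h1⟩) fun h1 => h' ⟨B, hB, h1⟩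

theorem FiberDvd.of_add_mul (hq : q ∈ U) (hF : FiberPolynomialOn U d F)
    {K : CotangentBundle n M → ℝ} (hK : FiberPolynomialOn U e K)
    (hGP : Metric.IsFiberPolynomial G q b P)
    (h : FiberDvd b P fun l => F l + G l * K l) : FiberDvd b P F := by
  obtain ⟨R, hR, hPR⟩ := h
  obtain ⟨A, -, hA⟩ := hF.exists_polynomial hq b
  obtain ⟨B, -, hB⟩ := hK.exists_polynomial hq b
  rw [hR.unique (hA.add (hGP.mul hB))] at hPR
  exact ⟨A, hA, (dvd_add_left ⟨B, rfl⟩).1 hPR⟩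

omit [IsManifold (𝓡 n) ∞ M] in
theorem not_fiberDvd_const (hP : Prime P) {c : ℝ} (hc : c ≠ 0) :
    ¬ FiberDvd b P fun _ => c := by
  rintro ⟨R, hR, hPR⟩
  have hC : Metric.IsFiberPolynomial (fun _ : CotangentBundle n M => c) q b (.C c) :=
    fun p => by simp
  rw [hR.unique hC] at hPR
  exact hP.not_isUnit (isUnit_of_dvd_unit hPR ((isUnit_iff_ne_zero.2 hc).map MvPolynomial.C))

/-- A form of degree `1` that does not vanish is not divisible by a form of degree `2`. -/
theorem not_fiberDvd_of_ne_zero (hP : P.IsHomogeneous 2) (hq : q ∈ U)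
    (hF : FiberPolynomialOn U 1 F) {p : CotangentSpace n M q} (h : F ⟨q, p⟩ ≠ 0) :
    ¬ FiberDvd b P F := by
  rintro ⟨R, hR, K, hK⟩
  obtain ⟨A, hA1, hA⟩ := hF.exists_polynomial hq b
  rw [← hA.unique hR] at hK
  have hA0 : A ≠ 0 := by
    rintro rfl
    exact h ((hA p).trans (map_zero _))
  have hP0 : P ≠ 0 := by rintro rfl; exact hA0 (hK.trans (zero_mul K))
  have hK0 : K ≠ 0 := by rintro rfl; exact hA0 (hK.trans (mul_zero P))
  have h1 := MvPolynomial.totalDegree_mul_of_isDomain hP0 hK0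
  rw [← hK, hA1.totalDegree hA0, hP.totalDegree hP0] at h1
  omega

end FiberDvd

/-- A chain `Y 0 = X i₀, Y 1, …, Y r` of vector fields such that the bracket of a field of the frame
`X` of `D` with `Y s` is a combination of the frame and of `Y 1, …, Y (s + 1)`; the coefficient of
`Y (s + 1)` is nonzero at `q` for some field of the frame if `s < r`, and there is no such term
if `s = r`. -/
structure IsBracketChain (X : Fin m → (q : M) → TangentSpace (𝓡 n) q) (i₀ : Fin m)
    (Y : ℕ → (q : M) → TangentSpace (𝓡 n) q) (r : ℕ) (A : Fin m → ℕ → Fin m → M → ℝ)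
    (B : Fin m → ℕ → ℕ → M → ℝ) (U : Set M) (q : M) : Prop where
  zero : Y 0 = X i₀
  smooth : ∀ s ≤ r, SmoothFieldOn (Y s) U
  smooth_left : ∀ s ≤ r, ∀ j i, ContMDiffOn (𝓡 n) 𝓘(ℝ, ℝ) ∞ (A j s i) U
  smooth_right : ∀ s ≤ r, ∀ j, ∀ t ≤ s, ContMDiffOn (𝓡 n) 𝓘(ℝ, ℝ) ∞ (B j s t) U
  bracket : ∀ s ≤ r, ∀ j, ∀ x ∈ U, mlieBracket (𝓡 n) (X j) (Y s) x =
    ∑ i, A j s i x • X i x + ∑ t ∈ Finset.range (s + 1), B j s t x • Y (t + 1) x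
  top : ∀ j, ∀ x ∈ U, B j r r x = 0
  diag : ∀ s < r, ∃ j, B j s s q ≠ 0

/-- Along linked trajectories, the rescaled momenta of `Y 0, …, Y s` are rational functions
`N k / (Q P ^ s)` of the first trajectory, with `P` the transition quadric. -/
structure RationalMomenta (G₁ G₂ : Metric D) (U : Set M) (Y : ℕ → (q : M) → TangentSpace (𝓡 n) q)
    (s e : ℕ) (Q : CotangentBundle n M → ℝ) (N : ℕ → CotangentBundle n M → ℝ) : Prop where
  denominator : FiberPolynomialOn U e Q
  numerator : ∀ k ≤ s, FiberPolynomialOn U (e + 2 * s + 1) (N k)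
  eq : ∀ ⦃lam mu : ℝ → CotangentBundle n M⦄ ⦃a : ℝ → ℝ⦄ ⦃J : Set ℝ⦄,
    LinkedTrajectories G₁ G₂ U lam mu a J → ∀ t ∈ J, ∀ k ≤ s,
      Q (lam t) * Metric.transitionQuadric G₁ G₂ (lam t) ^ s * (a t * momentum (Y k) (mu t)) =
        N k (lam t)

namespace RationalMomenta

open SubRiem.Metric

variable {i₀ : Fin m} {Y : ℕ → (q : M) → TangentSpace (𝓡 n) q} {r s e : ℕ}
  {A : Fin m → ℕ → Fin m → M → ℝ} {B : Fin m → ℕ → ℕ → M → ℝ} {q : M}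
  {Q : CotangentBundle n M → ℝ} {N : ℕ → CotangentBundle n M → ℝ}

omit [IsManifold (𝓡 n) ∞ M] in
theorem _root_.SubRiem.momentum_sum {ι : Type*} (s : Finset ι) (a : ι → ℝ)
    (Z : ι → (q : M) → TangentSpace (𝓡 n) q) (lam : CotangentBundle n M) :
    lam.snd (∑ i ∈ s, a i • Z i lam.proj) = ∑ i ∈ s, a i * momentum (Z i) lam := by
  rw [map_sum]
  exact Finset.sum_congr rfl fun i _ => by rw [map_smul]; rfl

/-- The equation obtained by differentiating the rational expression of the momentum of `Y s`
along the flow and clearing denominators. -/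
theorem exists_remainder (hX : IsFrameOn D X U) (hY : IsBracketChain X i₀ Y r A B U q)
    (h : RationalMomenta G₁ G₂ U Y s e Q N) (hs : s ≤ r) :
    ∃ K, FiberPolynomialOn U (2 * e + 2 * s + 2) K ∧
      ∀ ⦃lam mu : ℝ → CotangentBundle n M⦄ ⦃a : ℝ → ℝ⦄ ⦃J : Set ℝ⦄,
        LinkedTrajectories G₁ G₂ U lam mu a J → ∀ t ∈ J,
          2 * Q (lam t) ^ 2 * transitionQuadric G₁ G₂ (lam t) ^ (s + 1) *
            ((∑ j, G₁.coeff X j (lam t) * B j s s (lam t).proj) *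
              (a t * momentum (Y (s + 1)) (mu t))) =
          -(2 * s + 1) * (Q (lam t) * transitionCubic G₁ G₂ (lam t) * N s (lam t)) +
            transitionQuadric G₁ G₂ (lam t) * K (lam t) := by
  have hU := hX.isOpen
  have hc := fun i => fiberPolynomialOn_coeff (G := G₁) hX i
  have hP := fiberPolynomialOn_transitionQuadric (G₁ := G₁) (G₂ := G₂) hX
  have hN := h.numerator s le_rfl
  have hYs := hY.smooth s hs
  -- the terms of the bracket and of the metric that are already polynomial
  let S : CotangentBundle n M → ℝ := fun l =>
    ∑ j, G₁.coeff X j l * ∑ i, A j s i l.proj * velocityCovector G₁ G₂ X i l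
  let T : CotangentBundle n M → ℝ := fun l => ∑ i, ∑ j, G₁.coeff X i l * G₁.coeff X j l *
    differential (fun q => G₂.gram X q i j) l.proj (Y s l.proj)
  let V : CotangentBundle n M → ℝ := fun l =>
    ∑ j, G₁.coeff X j l * ∑ t ∈ Finset.range s, B j s t l.proj * N (t + 1) l
  let DQ : CotangentBundle n M → ℝ := fun l => derivAlong Q l (G₁.flowField l)
  let DN : CotangentBundle n M → ℝ := fun l => derivAlong (N s) l (G₁.flowField l)
  have hS : FiberPolynomialOn U 2 S := .sum fun j _ => .mul (hc j) (.sum fun i _ =>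
    .base_mul (hY.smooth_left s hs j i) (fiberPolynomialOn_velocityCovector hX i)) rfl
  have hT : FiberPolynomialOn U 2 T := .sum fun i _ => .sum fun j _ =>
    .mul (.mul (hc i) (hc j) rfl) (.base (f := fun q => differential (fun q => G₂.gram X q i j) q
      (Y s q)) (contMDiffOn_differential_apply hU hYs (contMDiffOn_gram hX i j))) rfl
  have hV : FiberPolynomialOn U (e + 2 * s + 2) V := .sum fun j _ => .mul (hc j)
    (.sum fun t ht => .base_mul (hY.smooth_right s hs j t (Finset.mem_range.1 ht).le)
      (h.numerator (t + 1) (Finset.mem_range.1 ht))) (by ring)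
  have hDQ : FiberPolynomialOn U (e + 1) DQ := h.denominator.derivAlong_flowField hX
  have hDN : FiberPolynomialOn U (e + 2 * s + 1 + 1) DN := hN.derivAlong_flowField hX
  refine ⟨fun l => 2 * (Q l * DN l) - 2 * (DQ l * N s l) -
    (Q l * (Q l * transitionQuadric G₁ G₂ l ^ s)) * (2 * S l + T l) - 2 * (Q l * V l), ?_, ?_⟩
  · refine ((FiberPolynomialOn.sub ?_ ?_).sub ?_).sub ?_
    · exact (h.denominator.mul hDN (by ring)).const_mul 2
    · exact (hDQ.mul hN (by ring)).const_mul 2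
    · exact (h.denominator.mul (h.denominator.mul (hP.pow s) rfl) rfl).mul
        ((hS.const_mul 2).add hT) (by ring)
    · exact (h.denominator.mul hV (by ring)).const_mul 2
  intro lam mu a J hL t ht
  have hm := hL.mu_proj_mem ht
  obtain ⟨w', hw, hw'⟩ := hL.exists_hasDerivAt_rescaled hX ht hYs
  have d1 := ((hL.hasDerivAt_comp_lam ht hU h.denominator).mul
    ((hL.hasDerivAt_comp_lam ht hU hP).pow s)).mul hw
  have d2 := hL.hasDerivAt_comp_lam ht hU hN
  have d3 := d1.unique (d2.congr_of_eventuallyEq (by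
    filter_upwards [hL.isOpen.mem_nhds ht] with τ hτ using h.eq hL τ hτ s le_rfl))
  have h1 := h.eq hL t ht s le_rfl
  -- the brackets in terms of the chain
  have h2 : ∀ j, a t * momentum (mlieBracket (𝓡 n) (X j) (Y s)) (mu t) =
      ∑ i, A j s i (lam t).proj * velocityCovector G₁ G₂ X i (lam t) +
      ∑ k ∈ Finset.range (s + 1), B j s k (lam t).proj * (a t * momentum (Y (k + 1)) (mu t)) := by
    intro j
    have h3 : momentum (mlieBracket (𝓡 n) (X j) (Y s)) (mu t) =
        ∑ i, A j s i (mu t).proj * momentum (X i) (mu t) +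
        ∑ k ∈ Finset.range (s + 1), B j s k (mu t).proj * momentum (Y (k + 1)) (mu t) := by
      rw [momentum, hY.bracket s hs j _ hm, map_add, momentum_sum,
        momentum_sum _ _ fun k => Y (k + 1)]
    rw [h3, mul_add, Finset.mul_sum, Finset.mul_sum, hL.proj_eq t ht]
    congr 1
    · refine Finset.sum_congr rfl fun i _ => ?_
      rw [← hL.factor_mul_momentum_frame hX ht]
      ring
    · exact Finset.sum_congr rfl fun k _ => by ring
  have h4 : Q (lam t) * transitionQuadric G₁ G₂ (lam t) ^ s *
      ∑ j, G₁.coeff X j (lam t) * (a t * momentum (mlieBracket (𝓡 n) (X j) (Y s)) (mu t)) =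
      Q (lam t) * transitionQuadric G₁ G₂ (lam t) ^ s * S (lam t) + V (lam t) +
      Q (lam t) * transitionQuadric G₁ G₂ (lam t) ^ s *
        ((∑ j, G₁.coeff X j (lam t) * B j s s (lam t).proj) *
          (a t * momentum (Y (s + 1)) (mu t))) := by
    have hV' : V (lam t) = Q (lam t) * transitionQuadric G₁ G₂ (lam t) ^ s *
        ∑ j, G₁.coeff X j (lam t) * ∑ k ∈ Finset.range s, B j s k (lam t).proj *
          (a t * momentum (Y (k + 1)) (mu t)) := by
      simp only [V, Finset.mul_sum]
      refine Finset.sum_congr rfl fun j _ => Finset.sum_congr rfl fun k hk => ?_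
      rw [← h.eq hL t ht (k + 1) (Finset.mem_range.1 hk)]
      ring
    rw [hV', ← mul_add, ← mul_add, Finset.sum_mul, ← Finset.sum_add_distrib,
      ← Finset.sum_add_distrib]
    congr 1
    refine Finset.sum_congr rfl fun j _ => ?_
    rw [h2, Finset.sum_range_succ]
    ring
  have h5 : (s : ℝ) * transitionQuadric G₁ G₂ (lam t) ^ (s - 1) *
      transitionQuadric G₁ G₂ (lam t) = s * transitionQuadric G₁ G₂ (lam t) ^ s := by
    cases s with
    | zero => simp
    | succ s => rw [Nat.add_sub_cancel, pow_succ]; ring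
  change (DQ (lam t) * transitionQuadric G₁ G₂ (lam t) ^ s + Q (lam t) *
    (s * transitionQuadric G₁ G₂ (lam t) ^ (s - 1) * transitionCubic G₁ G₂ (lam t))) *
    (a t * momentum (Y s) (mu t)) + Q (lam t) * transitionQuadric G₁ G₂ (lam t) ^ s * w' =
    DN (lam t) at d3
  change 2 * transitionQuadric G₁ G₂ (lam t) * w' = transitionCubic G₁ G₂ (lam t) *
    (a t * momentum (Y s) (mu t)) + 2 * transitionQuadric G₁ G₂ (lam t) *
    (∑ i, G₁.coeff X i (lam t) * (a t * momentum (mlieBracket (𝓡 n) (X i) (Y s)) (mu t)) +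
      (1 / 2) * T (lam t)) at hw'
  dsimp only
  rw [← h1]
  generalize transitionQuadric G₁ G₂ (lam t) = p at *
  generalize transitionCubic G₁ G₂ (lam t) = ρ at *
  generalize Q (lam t) = x at *
  generalize a t * momentum (Y s) (mu t) = w at *
  generalize DN (lam t) = dn at *
  generalize DQ (lam t) = dq at *
  generalize S (lam t) = σ at *
  generalize T (lam t) = θ at *
  generalize V (lam t) = v at *
  generalize (∑ j, G₁.coeff X j (lam t) * B j s s (lam t).proj) *
          (a t * momentum (Y (s + 1)) (mu t)) = z at *
  generalize ∑ j, G₁.coeff X j (lam t) *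
    (a t * momentum (mlieBracket (𝓡 n) (X j) (Y s)) (mu t)) = β at *
  rw [pow_succ]
  linear_combination (2 * p * x) * d3 - x ^ 2 * p ^ s * hw' - (2 * p * x) * h4 -
    2 * x ^ 2 * ρ * w * h5

/-- The passage from `Y s` to `Y (s + 1)`, unless `P` divides the cubic on the fiber over `q`. -/
theorem exists_succ (hX : IsFrameOn D X U) (hq : q ∈ U) (hY : IsBracketChain X i₀ Y r A B U q)
    {b : Module.Basis (Fin n) ℝ (TangentSpace (𝓡 n) q)} {P : MvPolynomial (Fin n) ℝ}
    (hP : P.IsHomogeneous 2) (hFP : IsFiberPolynomial (transitionQuadric G₁ G₂) q b P)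
    (hPr : Prime P) (hR : ¬ FiberDvd b P (transitionCubic G₁ G₂))
    (h : RationalMomenta G₁ G₂ U Y s e Q N) (hQ : ¬ FiberDvd b P Q) (hN : ¬ FiberDvd b P (N s))
    (hs : s < r) :
    ∃ e' Q' N', RationalMomenta G₁ G₂ U Y (s + 1) e' Q' N' ∧ ¬ FiberDvd b P Q' ∧
      ¬ FiberDvd b P (N' (s + 1)) := by
  obtain ⟨K, hK, hKe⟩ := h.exists_remainder hX hY hs.le
  have hP2 := fiberPolynomialOn_transitionQuadric (G₁ := G₁) (G₂ := G₂) hX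
  have hR3 := fiberPolynomialOn_transitionCubic (G₁ := G₁) (G₂ := G₂) hX
  have hNs := h.numerator s le_rfl
  let C : CotangentBundle n M → ℝ := fun l => ∑ j, G₁.coeff X j l * B j s s l.proj
  have hC : FiberPolynomialOn U 1 C := .sum fun j _ =>
    .mul (fiberPolynomialOn_coeff hX j) (.base (hY.smooth_right s hs.le j s le_rfl)) rfl
  have hC0 : ¬ FiberDvd b P C := by
    obtain ⟨j, hj⟩ := hY.diag s hs
    obtain ⟨p, hp⟩ := exists_covector_coeff G₁ hX hq (Pi.single j 1)
    refine not_fiberDvd_of_ne_zero hP hq hC (p := p) ?_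
    have h1 : C ⟨q, p⟩ = B j s s q := by
      simp only [C, hp, Pi.single_apply, ite_mul, one_mul, zero_mul, Finset.sum_ite_eq',
        Finset.mem_univ, if_true]
    rwa [h1]
  have hQ2 : FiberPolynomialOn U (e + e) fun l => Q l * Q l := h.denominator.mul h.denominator rfl
  have hQC : FiberPolynomialOn U (e + e + 1) fun l => Q l * Q l * C l := hQ2.mul hC rfl
  have hlead : FiberPolynomialOn U (e + 3 + (e + 2 * s + 1))
      fun l => Q l * transitionCubic G₁ G₂ l * N s l := (h.denominator.mul hR3 rfl).mul hNs rfl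
  have hlead0 : ¬ FiberDvd b P fun l => -(2 * (s : ℝ) + 1) *
      (Q l * transitionCubic G₁ G₂ l * N s l) := by
    refine not_fiberDvd_mul hPr hq (.base (f := fun _ => -(2 * (s : ℝ) + 1)) contMDiffOn_const)
      hlead (not_fiberDvd_const hPr (neg_ne_zero.2 (by positivity))) ?_
    exact not_fiberDvd_mul hPr hq (h.denominator.mul hR3 rfl) hNs
      (not_fiberDvd_mul hPr hq h.denominator hR3 hQ hR) hN
  refine ⟨2 * e + 1, fun l => 2 * (Q l * Q l * C l), fun k l => if k ≤ s then
    2 * (Q l * C l * (transitionQuadric G₁ G₂ l * N k l)) else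
    -(2 * (s : ℝ) + 1) * (Q l * transitionCubic G₁ G₂ l * N s l) +
      transitionQuadric G₁ G₂ l * K l, ⟨?_, ?_, ?_⟩, ?_, ?_⟩
  · have h1 := hQC.const_mul 2
    rwa [← two_mul] at h1
  · intro k hk
    by_cases hks : k ≤ s
    · simp only [if_pos hks]
      exact ((h.denominator.mul hC rfl).mul (hP2.mul (h.numerator k hks) rfl) (by ring)).const_mul 2
    · simp only [if_neg hks]
      refine .add ?_ (hP2.mul hK (by ring))
      have h1 := hlead.const_mul (-(2 * (s : ℝ) + 1))
      convert h1 using 1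
      ring
  · intro lam mu a J hL t ht k hk
    by_cases hks : k ≤ s
    · simp only [if_pos hks]
      rw [← h.eq hL t ht k hks]
      ring
    · simp only [if_neg hks]
      obtain rfl : k = s + 1 := by omega
      rw [← hKe hL t ht]
      ring
  · exact not_fiberDvd_mul hPr hq (.base (f := fun _ => 2) contMDiffOn_const) hQC
      (not_fiberDvd_const hPr two_ne_zero) (not_fiberDvd_mul hPr hq hQ2 hC
        (not_fiberDvd_mul hPr hq h.denominator h.denominator hQ hQ) hC0)
  · simp only [if_neg (Nat.not_succ_le_self s)]
    exact fun h1 => hlead0 (.of_add_mul hq (hlead.const_mul _) hK hFP h1)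

/-- If trajectories of the flow of `G₁` through a nonempty open subset of the unit covectors at `q`
are linked to trajectories of the flow of `G₂`, and `D` has rank at least `2` and a chain of
brackets that closes up, then `P` divides the cubic on the fiber over `q`: otherwise the momenta
along the chain would have the denominators `P, P ^ 2, …` in lowest terms, with no end. -/
theorem _root_.SubRiem.IsBracketChain.fiberDvd_transitionCubic (hX : IsFrameOn D X U) (hq : q ∈ U)
    (hY : IsBracketChain X i₀ Y r A B U q) (hm : 2 ≤ m)
    {b : Module.Basis (Fin n) ℝ (TangentSpace (𝓡 n) q)} {P : MvPolynomial (Fin n) ℝ}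
    (hP : P.IsHomogeneous 2) (hFP : IsFiberPolynomial (transitionQuadric G₁ G₂) q b P)
    {O : Set (CotangentBundle n M)} (hO : IsOpen O)
    {p₀ : CotangentSpace n M q} (h0 : (⟨q, p₀⟩ : CotangentBundle n M) ∈ O ∩ G₁.levelSet)
    (hL : ∀ p : CotangentSpace n M q, (⟨q, p⟩ : CotangentBundle n M) ∈ O ∩ G₁.levelSet →
      ∃ lam mu a J, LinkedTrajectories G₁ G₂ U lam mu a J ∧ (0 : ℝ) ∈ J ∧ lam 0 = ⟨q, p⟩) :
    FiberDvd b P (transitionCubic G₁ G₂) := by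
  by_contra hR
  have hPr : Prime P := by
    refine prime_transitionQuadric hP hFP ?_
    rw [← hX.span_eq q hq, finrank_span_eq_card (hX.linearIndependent q hq), Fintype.card_fin]
    exact hm
  have key : ∀ s ≤ r, ∃ e Q N, RationalMomenta G₁ G₂ U Y s e Q N ∧ ¬ FiberDvd b P Q ∧
      ¬ FiberDvd b P (N s) := by
    intro s
    induction s with
    | zero =>
      intro _
      refine ⟨0, fun _ => 1, fun _ => velocityCovector G₁ G₂ X i₀,
        ⟨.base (f := fun _ => 1) contMDiffOn_const,
          fun _ _ => fiberPolynomialOn_velocityCovector hX i₀, ?_⟩,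
        not_fiberDvd_const hPr one_ne_zero, ?_⟩
      · intro lam mu a J hL t ht k hk
        obtain rfl : k = 0 := by omega
        rw [hY.zero, hL.factor_mul_momentum_frame hX ht, pow_zero, one_mul, one_mul]
      · obtain ⟨p, hp⟩ := exists_covector_coeff G₁ hX hq (Pi.single i₀ 1)
        refine not_fiberDvd_of_ne_zero hP hq (fiberPolynomialOn_velocityCovector hX i₀)
          (p := p) ?_
        have h1 : velocityCovector G₁ G₂ X i₀ ⟨q, p⟩ = G₂.gram X q i₀ i₀ := by
          simp only [velocityCovector, hp, Pi.single_apply, mul_ite, mul_one, mul_zero,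
            Finset.sum_ite_eq', Finset.mem_univ, if_true]
        refine h1.trans_ne ?_
        exact (G₂.pos q _ ((linearIndependent_toFiber hX hq).ne_zero i₀)).ne'
    | succ s ih =>
      intro hs
      obtain ⟨e, Q, N, h, hQ, hN⟩ := ih (by omega)
      exact h.exists_succ hX hq hY hP hFP hPr hR hQ hN hs
  obtain ⟨e, Q, N, h, hQ, hN⟩ := key r le_rfl
  obtain ⟨K, hK, hKe⟩ := h.exists_remainder hX hY le_rfl
  have hR3 := fiberPolynomialOn_transitionCubic (G₁ := G₁) (G₂ := G₂) hX
  have hP2 := fiberPolynomialOn_transitionQuadric (G₁ := G₁) (G₂ := G₂) hX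
  have hNs := h.numerator r le_rfl
  let F : CotangentBundle n M → ℝ := fun l => -(2 * (r : ℝ) + 1) *
      (Q l * transitionCubic G₁ G₂ l * N r l)
  have hlead : FiberPolynomialOn U (2 * e + 2 * r + 4) F := by
    have h1 := ((h.denominator.mul hR3 rfl).mul hNs rfl).const_mul (-(2 * (r : ℝ) + 1))
    convert h1 using 1
    ring
  have hlead0 : ¬ FiberDvd b P F := by
    refine not_fiberDvd_mul hPr hq (.base (f := fun _ => -(2 * (r : ℝ) + 1)) contMDiffOn_const)
      ((h.denominator.mul hR3 rfl).mul hNs rfl)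
      (not_fiberDvd_const hPr (neg_ne_zero.2 (by positivity))) ?_
    exact not_fiberDvd_mul hPr hq (h.denominator.mul hR3 rfl) hNs
      (not_fiberDvd_mul hPr hq h.denominator hR3 hQ hR) hN
  have hsum := hlead.add (hP2.mul hK (k := 2 * e + 2 * r + 4) (by ring))
  obtain ⟨S, hS, hFS⟩ := hsum.exists_polynomial hq b
  refine hlead0 (.of_add_mul hq hlead hK hFP ⟨S, hFS, ?_⟩)
  rw [hFS.eq_zero_of_levelSet hX hq hS hO h0]
  · exact dvd_zero P
  · intro p hp
    obtain ⟨lam, mu, a, J, hLT, h0J, hlam⟩ := hL p hp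
    have h1 := hKe hLT 0 h0J
    have h2 : ∑ j, G₁.coeff X j (lam 0) * B j r r (lam 0).proj = 0 :=
      Finset.sum_eq_zero fun j _ => by rw [hY.top j _ (hLT.proj_mem 0 h0J), mul_zero]
    rw [h2, zero_mul, mul_zero] at h1
    rw [← hlam]
    exact h1.symm

end RationalMomenta

namespace Metric

variable {q : M} {b : Module.Basis (Fin n) ℝ (TangentSpace (𝓡 n) q)}

theorem exists_dvd_of_fiberDvd (hX : IsFrameOn D X U) (hq : q ∈ U)
    (h : ∀ P : MvPolynomial (Fin n) ℝ, P.IsHomogeneous 2 →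
      IsFiberPolynomial (transitionQuadric G₁ G₂) q b P →
      FiberDvd b P (transitionCubic G₁ G₂)) :
    ∃ P R : MvPolynomial (Fin n) ℝ, P.IsHomogeneous 2 ∧ R.IsHomogeneous 3 ∧
      IsFiberPolynomial (transitionQuadric G₁ G₂) q b P ∧
      IsFiberPolynomial (transitionCubic G₁ G₂) q b R ∧ P ∣ R := by
  obtain ⟨P, hP, hFP⟩ :=
    (fiberPolynomialOn_transitionQuadric (G₁ := G₁) (G₂ := G₂) hX).exists_polynomial hq b
  obtain ⟨R, hR, hFR⟩ :=
    (fiberPolynomialOn_transitionCubic (G₁ := G₁) (G₂ := G₂) hX).exists_polynomial hq b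
  obtain ⟨R', hFR', hd⟩ := h P hP hFP
  exact ⟨P, R, hP, hR, hFP, hFR, hFR.unique hFR' ▸ hd⟩

/-- If the metrics are conformal to each other, with a smooth factor `f`, the transition quadric is
`2 f h₁`, and `h₁` is constant along its own flow. -/
theorem fiberDvd_of_conformal (hX : IsFrameOn D X U) (hq : q ∈ U) {P : MvPolynomial (Fin n) ℝ}
    (hFP : IsFiberPolynomial (transitionQuadric G₁ G₂) q b P) {f : M → ℝ}
    (hf : ContMDiffOn (𝓡 n) 𝓘(ℝ, ℝ) ∞ f U) (hf0 : f q ≠ 0)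
    (h : ∀ lam : CotangentBundle n M, lam.proj ∈ U →
      transitionQuadric G₁ G₂ lam = f lam.proj * G₁.hamiltonian lam) :
    FiberDvd b P (transitionCubic G₁ G₂) := by
  have hFf : FiberPolynomialOn U 0 fun lam : CotangentBundle n M => f lam.proj := .base hf
  have hDf := hFf.derivAlong_flowField (G := G₁) hX
  obtain ⟨A, -, hA⟩ := hDf.exists_polynomial hq b
  refine ⟨P * (.C (f q)⁻¹ * A), fun p => ?_, dvd_mul_right _ _⟩
  have hp : (⟨q, p⟩ : CotangentBundle n M).proj ∈ U := hq
  rw [transitionCubic, derivAlong_congr_over hX.isOpen hp h,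
    derivAlong_mul (hFf.mdifferentiableAt hX.isOpen hp)
      ((fiberPolynomialOn_hamiltonian hX).mdifferentiableAt hX.isOpen hp),
    derivAlong_hamiltonian_flowField, map_mul, map_mul, ← hFP p, ← hA p, h _ hp,
    MvPolynomial.eval_C]
  field_simp
  ring

theorem fiberDvd_of_rank_le_one (hX : IsFrameOn D X U) (hq : q ∈ U) (hm : m ≤ 1)
    {P : MvPolynomial (Fin n) ℝ} (hFP : IsFiberPolynomial (transitionQuadric G₁ G₂) q b P) :
    FiberDvd b P (transitionCubic G₁ G₂) := by
  obtain rfl | rfl : m = 0 ∨ m = 1 := by omega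
  · refine fiberDvd_of_conformal hX hq hFP (f := fun _ => 1) contMDiffOn_const one_ne_zero
      fun lam hl => ?_
    rw [transitionQuadric_eq_sum hX hl, hamiltonian_eq_sum_gram hX hl]
    simp
  · have hpos : ∀ (G : Metric D), ∀ x ∈ U, G.gram X x 0 0 ≠ 0 := fun G x hx =>
      (G.pos x _ ((linearIndependent_toFiber hX hx).ne_zero 0)).ne'
    refine fiberDvd_of_conformal hX hq hFP
      (f := fun x => 2 * (G₂.gram X x 0 0 * (G₁.gram X x 0 0)⁻¹))
      (contMDiffOn_const.mul ((contMDiffOn_gram hX 0 0).mul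
        ((contMDiffOn_gram hX 0 0).inv₀ (hpos G₁))))
      (mul_ne_zero two_ne_zero (mul_ne_zero (hpos G₂ q hq) (inv_ne_zero (hpos G₁ q hq))))
      fun lam hl => ?_
    rw [transitionQuadric_eq_sum hX hl, hamiltonian_eq_sum_gram hX hl]
    simp only [Fin.sum_univ_one]
    have := hpos G₁ _ hl
    field_simp

end Metric

end

/-! ### Smoothness of the Hamiltonian field -/

section

variable {m n : ℕ} {M : Type*} [TopologicalSpace M] [ChartedSpace (Model n) M]
  [IsManifold (𝓡 n) ∞ M] {U : Set M} {D : VectorDistribution m n M} {G G₁ G₂ : Metric D}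
  {X : Fin m → (q : M) → TangentSpace (𝓡 n) q}

/-- The vector field with constant components `v` in the preferred chart at `q₀` (zero outside
the domain of the chart). -/
def coordinateField (q₀ : M) (v : Model n) (q : M) : TangentSpace (𝓡 n) q :=
  (trivializationAt (Model n) (TangentSpace (𝓡 n)) q₀).symmL ℝ q v

theorem smoothFieldOn_coordinateField (q₀ : M) (v : Model n) :
    SmoothFieldOn (coordinateField q₀ v)
      (trivializationAt (Model n) (TangentSpace (𝓡 n)) q₀).baseSet := by
  refine ((trivializationAt (Model n) (TangentSpace (𝓡 n)) q₀).contMDiffOn_section_baseSet_iff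
    (IB := 𝓡 n) (s := coordinateField q₀ v) (n := ∞)).2 ?_
  refine (contMDiffOn_const (c := v)).congr fun q hq => ?_
  rw [coordinateField, Trivialization.symmL_apply _ hq]
  exact congrArg Prod.snd (Trivialization.apply_mk_symm _ hq v)

theorem cotangent_extChartAt_apply (lam l : CotangentBundle n M) :
    extChartAt (cotangentModel n) lam l = (extChartAt (𝓡 n) lam.proj l.proj,
      (l.snd : Model n →L[ℝ] ℝ).comp
        ((trivializationAt (Model n) (TangentSpace (𝓡 n)) lam.proj).symmL ℝ l.proj)) := by
  rw [FiberBundle.extChartAt, PartialEquiv.coe_trans, Function.comp_apply]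
  refine Prod.ext rfl ?_
  change ContinuousLinearMap.inCoordinates (Model n) (TangentSpace (𝓡 n)) ℝ (Trivial M ℝ)
    lam.proj l.proj lam.proj l.proj l.snd = _
  rw [ContinuousLinearMap.inCoordinates]
  ext v
  simp

theorem cotangent_eq_sum (z : Model n × (Model n →L[ℝ] ℝ)) :
    z = ∑ i, z.1 i • ((EuclideanSpace.single i 1 : Model n), (0 : Model n →L[ℝ] ℝ)) +
      ∑ i, z.2 (EuclideanSpace.single i 1) • ((0 : Model n),
        (EuclideanSpace.proj i : Model n →L[ℝ] ℝ)) := by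
  refine Prod.ext ?_ ?_
  · ext j
    simp [Prod.fst_sum, Pi.single_apply]
  · refine ContinuousLinearMap.ext fun v => ?_
    have hv : v = ∑ i, v i • (EuclideanSpace.single i 1 : Model n) := by
      ext j
      simp [Pi.single_apply]
    conv_lhs => rw [hv]
    simp [Prod.snd_sum, mul_comm]

/-- In the canonical chart at `lam`, the components of the Hamiltonian field are its derivatives of
the coordinate functions, and these are polynomial on the fibers, of degree `0` or `1`. -/
theorem Metric.contMDiffAt_flowField (hX : IsFrameOn D X U) {lam : CotangentBundle n M}
    (hl : lam.proj ∈ U) :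
    ContMDiffAt (cotangentModel n) (cotangentModel n).tangent 1
      (fun l => (⟨l, G.flowField l⟩ : TangentBundle (cotangentModel n) (CotangentBundle n M)))
      lam := by
  let e := trivializationAt (Model n) (TangentSpace (𝓡 n)) lam.proj
  have hq : lam.proj ∈ e.baseSet := FiberBundle.mem_baseSet_trivializationAt' lam.proj
  have hX' := hX.mono (hX.isOpen.inter e.open_baseSet) Set.inter_subset_left
  have hl' : lam.proj ∈ U ∩ e.baseSet := ⟨hl, hq⟩
  rw [Bundle.contMDiffAt_section]
  have key : ∀ (ℓ : Model n × (Model n →L[ℝ] ℝ) →L[ℝ] ℝ) (d : ℕ),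
      FiberPolynomialOn (U ∩ e.baseSet) d (fun l => ℓ (extChartAt (cotangentModel n) lam l)) →
      ContMDiffAt (cotangentModel n) 𝓘(ℝ, ℝ) 1 (fun l => ℓ
        (trivializationAt (Model n × (Model n →L[ℝ] ℝ)) (TangentSpace (cotangentModel n)) lam
          ⟨l, G.flowField l⟩).2) lam := by
    intro ℓ d hF
    refine (((hF.derivAlong_flowField (G := G) hX').contMDiffAt hX'.isOpen hl').of_le
      (by simp)).congr_of_eventuallyEq ?_
    filter_upwards [(chartAt (ModelProd (Model n) (Model n →L[ℝ] ℝ)) lam).open_source.mem_nhds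
      (mem_chart_source _ lam)] with l hls
    have hls' : l ∈ (trivializationAt (Model n × (Model n →L[ℝ] ℝ))
        (TangentSpace (cotangentModel n)) lam).baseSet := hls
    have h1 : (trivializationAt (Model n × (Model n →L[ℝ] ℝ)) (TangentSpace (cotangentModel n)) lam
        ⟨l, G.flowField l⟩).2 =
        mfderiv (cotangentModel n) 𝓘(ℝ, Model n × (Model n →L[ℝ] ℝ))
          (extChartAt (cotangentModel n) lam) l (G.flowField l) := by
      have h2 : (trivializationAt (Model n × (Model n →L[ℝ] ℝ))
          (TangentSpace (cotangentModel n)) lam ⟨l, G.flowField l⟩).2 =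
          (trivializationAt (Model n × (Model n →L[ℝ] ℝ))
            (TangentSpace (cotangentModel n)) lam).continuousLinearMapAt ℝ l (G.flowField l) := by
        rw [Trivialization.continuousLinearMapAt_apply, Trivialization.coe_linearMapAt_of_mem _ hls']
      exact h2.trans (DFunLike.congr_fun
        (TangentBundle.continuousLinearMapAt_trivializationAt (I := cotangentModel n) hls) _)
    rw [h1]
    have h2 := (mdifferentiableAt_extChartAt (I := cotangentModel n) hls).hasMFDerivAt
    exact (((ℓ.hasMFDerivAt).comp l h2).derivAlong_eq _).symm
  have hfst : ∀ i, FiberPolynomialOn (U ∩ e.baseSet) 0 fun l : CotangentBundle n M =>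
      ((EuclideanSpace.proj i : Model n →L[ℝ] ℝ).comp (.fst ℝ (Model n) (Model n →L[ℝ] ℝ)))
        (extChartAt (cotangentModel n) lam l) := by
    intro i
    have h1 : ContMDiffOn (𝓡 n) 𝓘(ℝ, Model n) ∞ (extChartAt (𝓡 n) lam.proj) e.baseSet :=
      contMDiffOn_extChartAt
    refine (FiberPolynomialOn.base (f := fun q => (extChartAt (𝓡 n) lam.proj q : Model n) i)
      ((EuclideanSpace.proj i : Model n →L[ℝ] ℝ).contMDiff.comp_contMDiffOn
        (h1.mono Set.inter_subset_right))).congr fun l _ => ?_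
    rw [cotangent_extChartAt_apply]
    rfl
  have hsnd : ∀ v : Model n, FiberPolynomialOn (U ∩ e.baseSet) 1 fun l : CotangentBundle n M =>
      ((ContinuousLinearMap.apply ℝ ℝ v).comp (.snd ℝ (Model n) (Model n →L[ℝ] ℝ)))
        (extChartAt (cotangentModel n) lam l) := by
    intro v
    refine (FiberPolynomialOn.momentum
      ((smoothFieldOn_coordinateField lam.proj v).mono Set.inter_subset_right)).congr
      fun l _ => ?_
    rw [cotangent_extChartAt_apply]
    rfl
  let T : CotangentBundle n M → Model n × (Model n →L[ℝ] ℝ) := fun l =>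
    (trivializationAt (Model n × (Model n →L[ℝ] ℝ)) (TangentSpace (cotangentModel n)) lam
      ⟨l, G.flowField l⟩).2
  have h1 : ∀ i, ContMDiffAt (cotangentModel n) 𝓘(ℝ, ℝ) 1 (fun l => (T l).1 i) lam :=
    fun i => key _ 0 (hfst i)
  have h2 : ∀ v, ContMDiffAt (cotangentModel n) 𝓘(ℝ, ℝ) 1 (fun l => (T l).2 v) lam :=
    fun v => key _ 1 (hsnd v)
  have h3 : ContMDiffAt (cotangentModel n) 𝓘(ℝ, Model n × (Model n →L[ℝ] ℝ)) 1 (fun l =>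
      ∑ i, (T l).1 i • ((EuclideanSpace.single i 1 : Model n), (0 : Model n →L[ℝ] ℝ)) +
      ∑ i, (T l).2 (EuclideanSpace.single i 1) • ((0 : Model n),
        (EuclideanSpace.proj i : Model n →L[ℝ] ℝ))) lam :=
    (contMDiffAt_finsetSum fun i _ => (h1 i).smul contMDiffAt_const).add
      (contMDiffAt_finsetSum fun i _ => (h2 _).smul contMDiffAt_const)
  exact h3.congr_of_eventuallyEq (Eventually.of_forall fun l => cotangent_eq_sum (T l))

end

/-! ### Existence of linked trajectories -/

section

variable {m n : ℕ} {M : Type*} [TopologicalSpace M] [ChartedSpace (Model n) M]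
  [IsManifold (𝓡 n) ∞ M] {U : Set M} {D : VectorDistribution m n M} {G G₁ G₂ : Metric D}
  {X : Fin m → (q : M) → TangentSpace (𝓡 n) q}

namespace Metric

/-- Through each covector of the level set passes a trajectory of the Hamiltonian flow, which stays
in the level set. -/
theorem exists_trajectory (hX : IsFrameOn D X U) {lam₀ : CotangentBundle n M}
    (h0 : lam₀ ∈ G.levelSet) {O : Set (CotangentBundle n M)} (hO : IsOpen O) (hO0 : lam₀ ∈ O)
    (hOU : ∀ l ∈ O, l.proj ∈ U) :
    ∃ (lam : ℝ → CotangentBundle n M) (ε : ℝ), 0 < ε ∧ lam 0 = lam₀ ∧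
      ∀ t ∈ _root_.Metric.ball (0 : ℝ) ε, lam t ∈ O ∧ lam t ∈ G.levelSet ∧
        HasMFDerivAt 𝓘(ℝ, ℝ) (cotangentModel n) lam t
          ((1 : ℝ →L[ℝ] ℝ).smulRight (G.flowField (lam t))) := by
  obtain ⟨lam, hl0, hlam⟩ := exists_isMIntegralCurveAt_of_contMDiffAt_boundaryless (t₀ := 0)
    (contMDiffAt_flowField (G := G) hX (hOU _ hO0))
  have hcont : ContinuousAt lam 0 := hlam.self_of_nhds.continuousAt
  have hmem : ∀ᶠ t in 𝓝 (0 : ℝ), lam t ∈ O := hcont (hO.mem_nhds (hl0 ▸ hO0))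
  obtain ⟨ε, hε, hb⟩ := _root_.Metric.eventually_nhds_iff_ball.1 (hmem.and hlam)
  refine ⟨lam, ε, hε, hl0, fun t ht => ⟨(hb t ht).1, ?_, (hb t ht).2⟩⟩
  have hd : ∀ s ∈ _root_.Metric.ball (0 : ℝ) ε,
      HasDerivAt (fun s => G.hamiltonian (lam s)) 0 s := by
    intro s hs
    rw [← derivAlong_hamiltonian_flowField (G := G) (lam s)]
    exact hasDerivAt_comp_curve ((fiberPolynomialOn_hamiltonian hX).mdifferentiableAt hX.isOpen
      (hOU _ (hb s hs).1)) (hb s hs).2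
  have hconst := _root_.Metric.isOpen_ball.is_const_of_deriv_eq_zero
    (convex_ball (0 : ℝ) ε).isPreconnected
    (fun s hs => (hd s hs).differentiableAt.differentiableWithinAt) (fun s hs => (hd s hs).deriv)
    ht (_root_.Metric.mem_ball_self hε)
  change G.hamiltonian (lam t) = 1 / 2
  refine hconst.trans ?_
  rw [hl0]
  exact h0

/-- Geodesic equivalence links the trajectories of the two flows. -/
theorem GeodesicsSubsume.exists_linkedTrajectories {V : Set M} (h : GeodesicsSubsume G₁ G₂ V)
    (hX : IsFrameOn D X U) (hUV : U ⊆ V) {lam₀ : CotangentBundle n M} (h0 : lam₀ ∈ G₁.levelSet)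
    (hq : lam₀.proj ∈ U) :
    ∃ lam mu a J, LinkedTrajectories G₁ G₂ U lam mu a J ∧ (0 : ℝ) ∈ J ∧ lam 0 = lam₀ := by
  obtain ⟨lam, ε, hε, hl0, hlam⟩ := exists_trajectory (G := G₁) hX h0
    (hX.isOpen.preimage (FiberBundle.continuous_proj (Model n →L[ℝ] ℝ) (CotangentSpace n M)))
    hq fun _ hl => hl
  set J := _root_.Metric.ball (0 : ℝ) ε
  have hJ : IsOpen J := _root_.Metric.isOpen_ball
  obtain ⟨γ', J', τ, ⟨hJ', -, mu, hmu, hmu'⟩, hτ, -, rfl, hγ⟩ := h (fun t => (lam t).proj) J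
    ⟨hJ, (convex_ball _ _).ordConnected, lam, fun t ht => (hlam t ht).2.2.hasMFDerivWithinAt,
      fun t ht => ⟨(hlam t ht).2.1, rfl⟩⟩ fun t ht => hUV (hlam t ht).1
  refine ⟨lam, fun t => mu (τ t), deriv τ, J, ⟨hJ, fun t ht => (hlam t ht).1, fun t ht => ?_,
    fun t ht => (hlam t ht).2.1, fun t ht => (hmu' _ ⟨t, ht, rfl⟩).1,
    fun t ht => (hlam t ht).2.2, fun t ht => ?_⟩, _root_.Metric.mem_ball_self hε, hl0⟩
  · exact (hmu' _ ⟨t, ht, rfl⟩).2.trans (hγ t ht).symm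
  · have h1 : HasDerivAt τ (deriv τ t) t :=
      ((hτ.contDiffAt (hJ.mem_nhds ht)).differentiableAt (by simp)).hasDerivAt
    have h2 := (hmu (τ t) ⟨t, ht, rfl⟩).hasMFDerivAt (hJ'.mem_nhds ⟨t, ht, rfl⟩)
    have h3 := h2.comp t h1.hasFDerivAt.hasMFDerivAt
    refine h3.congr_mfderiv ?_
    exact ContinuousLinearMap.ext
      (fun c => mul_smul c (deriv τ t) (G₂.flowField (mu (τ t))) : ∀ c : ℝ, _)

/-- An orbital diffeomorphism links the trajectories of the two flows. -/
theorem IsOrbitalDiffeo.exists_linkedTrajectories {B : Set (CotangentBundle n M)}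
    {Φ : CotangentBundle n M → CotangentBundle n M} (h : G₁.IsOrbitalDiffeo G₂ B Φ)
    (hX : IsFrameOn D X U) {lam₀ : CotangentBundle n M} (h0 : lam₀ ∈ B) (hq : lam₀.proj ∈ U) :
    ∃ lam mu a J, LinkedTrajectories G₁ G₂ U lam mu a J ∧ (0 : ℝ) ∈ J ∧ lam 0 = lam₀ := by
  obtain ⟨O, hO, rfl⟩ := h.isOpen
  obtain ⟨a, ha⟩ := h.conj
  obtain ⟨lam, ε, hε, hl0, hlam⟩ := exists_trajectory (G := G₁) hX h0.2
    (hO.inter (hX.isOpen.preimage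
      (FiberBundle.continuous_proj (Model n →L[ℝ] ℝ) (CotangentSpace n M))))
    ⟨h0.1, hq⟩ fun _ hl => hl.2
  set J := _root_.Metric.ball (0 : ℝ) ε
  have hJ : IsOpen J := _root_.Metric.isOpen_ball
  have hB : ∀ t ∈ J, lam t ∈ O ∩ G₁.levelSet := fun t ht => ⟨(hlam t ht).1.1, (hlam t ht).2.1⟩
  refine ⟨lam, fun t => Φ (lam t), fun t => a (lam t), J, ⟨hJ, fun t ht => (hlam t ht).1.2,
    fun t ht => h.fiberwise _ (hB t ht), fun t ht => (hlam t ht).2.1,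
    fun t ht => h.mapsTo (hB t ht), fun t ht => (hlam t ht).2.2, fun t ht => ?_⟩,
    _root_.Metric.mem_ball_self hε, hl0⟩
  obtain ⟨L, hL, hLa⟩ := ha _ (hB t ht)
  have h1 := (hL.comp t ((hlam t ht).2.2.hasMFDerivWithinAt (s := J)) hB).hasMFDerivAt
    (hJ.mem_nhds ht)
  refine h1.congr_mfderiv ?_
  exact ContinuousLinearMap.ext
    (fun c => (L.map_smul c (G₁.flowField (lam t))).trans (congrArg (c • ·) hLa) : ∀ c : ℝ, _)

end Metric

end

/-! ### Smooth coefficients and brackets of combinations -/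

section

variable {m n : ℕ} {M : Type*} [TopologicalSpace M] [ChartedSpace (Model n) M]
  [IsManifold (𝓡 n) ∞ M] {U : Set M}

section Components

variable {q₀ : M} {Y W : (q : M) → TangentSpace (𝓡 n) q}

/-- The components of the field `Y` in the preferred chart at `q₀`, as a function on `M` (zero outside
the domain of the chart). -/
def components (q₀ : M) (Y : (q : M) → TangentSpace (𝓡 n) q) (q : M) : Model n :=
  (trivializationAt (Model n) (TangentSpace (𝓡 n)) q₀).linearMapAt ℝ q (Y q)

theorem contMDiffOn_components (hU : IsOpen U) (hY : SmoothFieldOn Y U)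
    (hUb : U ⊆ (trivializationAt (Model n) (TangentSpace (𝓡 n)) q₀).baseSet) :
    ContMDiffOn (𝓡 n) 𝓘(ℝ, Model n) ∞ (components q₀ Y) U := by
  intro q hq
  have h1 := ((trivializationAt (Model n) (TangentSpace (𝓡 n)) q₀).contMDiffAt_section_iff
    (n := ∞) (IB := 𝓡 n) (hUb hq)).1 (hY.contMDiffAt hU hq)
  refine h1.contMDiffWithinAt.congr (fun x hx => ?_) ?_ <;>
  rw [components, Trivialization.coe_linearMapAt_of_mem _ (hUb ‹_›)]

theorem contMDiffOn_inner_components (hU : IsOpen U) (hY : SmoothFieldOn Y U)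
    (hW : SmoothFieldOn W U)
    (hUb : U ⊆ (trivializationAt (Model n) (TangentSpace (𝓡 n)) q₀).baseSet) :
    ContMDiffOn (𝓡 n) 𝓘(ℝ, ℝ) ∞ (fun q => inner ℝ (components q₀ Y q) (components q₀ W q)) U :=
  (contDiff_inner (𝕜 := ℝ) (E := Model n) (n := ∞)).contMDiff.comp_contMDiffOn
    ((contMDiffOn_components hU hY hUb).prodMk_space (contMDiffOn_components hU hW hUb))

variable {ι : Type*} [Fintype ι] [DecidableEq ι] {Z : ι → (q : M) → TangentSpace (𝓡 n) q}

theorem det_gram_components_ne_zero_iff {q : M}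
    (hq : q ∈ (trivializationAt (Model n) (TangentSpace (𝓡 n)) q₀).baseSet) :
    (Matrix.gram ℝ fun i => components q₀ (Z i) q).det ≠ 0 ↔
      LinearIndependent ℝ fun i => Z i q := by
  rw [Matrix.det_gram_ne_zero_iff_linearIndependent]
  let L := (trivializationAt (Model n) (TangentSpace (𝓡 n)) q₀).linearEquivAt ℝ q hq
  have h : (fun i => components q₀ (Z i) q) = L ∘ fun i => Z i q := by
    funext i
    rw [components, Trivialization.coe_linearMapAt_of_mem _ hq]
    rfl
  rw [h]
  exact L.toLinearMap.linearIndependent_iff L.ker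

/-- Linear independence of smooth vector fields is an open condition. -/
theorem exists_isOpen_linearIndependent {q : M} (hU : IsOpen U) (hq : q ∈ U)
    (hZ : ∀ i, SmoothFieldOn (Z i) U) (h : LinearIndependent ℝ fun i => Z i q) :
    ∃ V, IsOpen V ∧ q ∈ V ∧ V ⊆ U ∧
      V ⊆ (trivializationAt (Model n) (TangentSpace (𝓡 n)) q).baseSet ∧
      ∀ x ∈ V, LinearIndependent ℝ fun i => Z i x := by
  let e := trivializationAt (Model n) (TangentSpace (𝓡 n)) q
  have hqe : q ∈ e.baseSet := FiberBundle.mem_baseSet_trivializationAt' q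
  have hUe : IsOpen (U ∩ e.baseSet) := hU.inter e.open_baseSet
  have hdet : ContinuousOn
      (fun x => (Matrix.gram ℝ fun i => components q (Z i) x).det) (U ∩ e.baseSet) :=
    (contMDiffOn_det fun i j => contMDiffOn_inner_components hUe
      ((hZ i).mono Set.inter_subset_left) ((hZ j).mono Set.inter_subset_left)
      Set.inter_subset_right).continuousOn
  refine ⟨_, hdet.isOpen_inter_preimage hUe (isOpen_compl_singleton (x := 0)),
    ⟨⟨hq, hqe⟩, (det_gram_components_ne_zero_iff hqe).2 h⟩, fun x hx => hx.1.1,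
    fun x hx => hx.1.2, fun x hx => (det_gram_components_ne_zero_iff hx.1.2).1 hx.2⟩

/-- A smooth vector field in the span of linearly independent smooth vector fields is a combination
of them with smooth coefficients: the coefficients solve a linear system with the Gram matrix of
the fields for the Euclidean metric of a chart. -/
theorem exists_smooth_coefficients (hU : IsOpen U)
    (hUb : U ⊆ (trivializationAt (Model n) (TangentSpace (𝓡 n)) q₀).baseSet)
    (hZ : ∀ i, SmoothFieldOn (Z i) U) (hli : ∀ x ∈ U, LinearIndependent ℝ fun i => Z i x)
    (hW : SmoothFieldOn W U) (hspan : ∀ x ∈ U, W x ∈ Submodule.span ℝ (Set.range fun i => Z i x)) :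
    ∃ c : ι → M → ℝ, (∀ i, ContMDiffOn (𝓡 n) 𝓘(ℝ, ℝ) ∞ (c i) U) ∧
      ∀ x ∈ U, W x = ∑ i, c i x • Z i x := by
  let g : M → Matrix ι ι ℝ := fun x => Matrix.gram ℝ fun i => components q₀ (Z i) x
  have hdet : ∀ x ∈ U, (g x).det ≠ 0 := fun x hx =>
    (det_gram_components_ne_zero_iff (hUb hx)).2 (hli x hx)
  let c : ι → M → ℝ := fun i x =>
    ∑ j, (g x)⁻¹ i j * inner ℝ (components q₀ (Z j) x) (components q₀ W x)
  refine ⟨c, fun i => contMDiffOn_finsetSum fun j _ => ?_, fun x hx => ?_⟩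
  · exact (contMDiffOn_matrix_inv (fun i j => contMDiffOn_inner_components hU (hZ i) (hZ j) hUb)
      hdet i j).mul (contMDiffOn_inner_components hU (hZ j) hW hUb)
  · obtain ⟨a, ha⟩ := (Submodule.mem_span_range_iff_exists_fun ℝ).1 (hspan x hx)
    have h1 : ∀ j, inner ℝ (components q₀ (Z j) x) (components q₀ W x) = (g x).mulVec a j := by
      intro j
      have h2 : components q₀ W x = ∑ i, a i • components q₀ (Z i) x := by
        rw [components, ← ha, map_sum]
        exact Finset.sum_congr rfl fun i _ => map_smul _ _ _
      rw [h2, inner_sum, Matrix.mulVec, dotProduct]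
      exact Finset.sum_congr rfl fun i _ => by rw [inner_smul_right, mul_comm]; rfl
    have h3 : ∀ i, c i x = a i := by
      intro i
      have h4 : c i x = ((g x)⁻¹.mulVec ((g x).mulVec a)) i :=
        Finset.sum_congr rfl fun j _ => by rw [h1]
      rw [h4, Matrix.mulVec_mulVec, Matrix.nonsing_inv_mul _ (hdet x hx).isUnit, Matrix.one_mulVec]
    simp only [h3, ha]

end Components

section Bracket

variable {q : M} {ι κ : Type*} {S : Submodule ℝ (TangentSpace (𝓡 n) q)}

theorem mlieBracket_sum_smul_mem_right (hU : IsOpen U) (hq : q ∈ U) (s : Finset ι)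
    {Y : (q : M) → TangentSpace (𝓡 n) q} {Z : ι → (q : M) → TangentSpace (𝓡 n) q} {c : ι → M → ℝ}
    (hZ : ∀ i, SmoothFieldOn (Z i) U) (hc : ∀ i, ContMDiffOn (𝓡 n) 𝓘(ℝ, ℝ) ∞ (c i) U)
    (hZS : ∀ i, Z i q ∈ S) (hS : ∀ i, mlieBracket (𝓡 n) Y (Z i) q ∈ S) :
    mlieBracket (𝓡 n) Y (fun x => ∑ i ∈ s, c i x • Z i x) q ∈ S := by
  classical
  induction s using Finset.induction_on with
  | empty =>
    simp only [Finset.sum_empty]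
    rw [show mlieBracket (𝓡 n) Y (fun x => (0 : TangentSpace (𝓡 n) x)) q = 0 from
      congrFun (mlieBracket_zero_right (W := Y)) q]
    exact S.zero_mem
  | insert i s hi ih =>
    simp only [Finset.sum_insert hi]
    have h1 : MDifferentiableAt (𝓡 n) (𝓡 n).tangent
        (fun x => (⟨x, c i x • Z i x⟩ : TangentBundle (𝓡 n) M)) q :=
      (((hZ i).smul (hc i)).contMDiffAt hU hq).mdifferentiableAt (by simp)
    have h2 : MDifferentiableAt (𝓡 n) (𝓡 n).tangent
        (fun x => (⟨x, ∑ j ∈ s, c j x • Z j x⟩ : TangentBundle (𝓡 n) M)) q :=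
      ((SmoothFieldOn.sum fun j => (hZ j).smul (hc j)).contMDiffAt hU hq).mdifferentiableAt
        (by simp)
    have h3 := mlieBracket_add_right (V := Y) h1 h2
    have h4 := mlieBracket_smul_right (V := Y)
      (((hc i).contMDiffAt (hU.mem_nhds hq)).mdifferentiableAt (by simp))
      (((hZ i).contMDiffAt hU hq).mdifferentiableAt (by simp))
    have h5 : mlieBracket (𝓡 n) Y (fun x => c i x • Z i x) q ∈ S := by
      refine h4 ▸ ?_
      exact S.add_mem (S.smul_mem _ (hZS i)) (S.smul_mem _ (hS i))
    refine h3 ▸ ?_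
    exact S.add_mem h5 ih

/-- By the Leibniz rule, brackets of combinations with variable coefficients stay in a subspace that
contains the fields and their brackets at `q`. -/
theorem mlieBracket_sum_smul_mem (hU : IsOpen U) (hq : q ∈ U) (s : Finset ι) (t : Finset κ)
    {X : ι → (q : M) → TangentSpace (𝓡 n) q} {Z : κ → (q : M) → TangentSpace (𝓡 n) q}
    {a : ι → M → ℝ} {c : κ → M → ℝ}
    (hX : ∀ i, SmoothFieldOn (X i) U) (ha : ∀ i, ContMDiffOn (𝓡 n) 𝓘(ℝ, ℝ) ∞ (a i) U)
    (hZ : ∀ i, SmoothFieldOn (Z i) U) (hc : ∀ i, ContMDiffOn (𝓡 n) 𝓘(ℝ, ℝ) ∞ (c i) U)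
    (hXS : ∀ i, X i q ∈ S) (hZS : ∀ i, Z i q ∈ S)
    (hS : ∀ i k, mlieBracket (𝓡 n) (X i) (Z k) q ∈ S) :
    mlieBracket (𝓡 n) (fun x => ∑ i ∈ s, a i x • X i x) (fun x => ∑ k ∈ t, c k x • Z k x) q ∈ S := by
  refine mlieBracket_sum_smul_mem_right hU hq t hZ hc hZS fun k => ?_
  rw [mlieBracket_swap_apply]
  refine S.neg_mem (mlieBracket_sum_smul_mem_right hU hq s hX ha hXS fun i => ?_)
  rw [mlieBracket_swap_apply]
  exact S.neg_mem (hS i k)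

end Bracket

end

/-! ### The flag of a distribution -/

section

variable {m n : ℕ} {M : Type*} [TopologicalSpace M] [ChartedSpace (Model n) M]
  [IsManifold (𝓡 n) ∞ M] {U : Set M} {D : VectorDistribution m n M}
  {X : Fin m → (q : M) → TangentSpace (𝓡 n) q}

namespace VectorDistribution

variable {q : M} {s : ℕ}

theorem power_le_succ (s : ℕ) (q : M) : D.power s q ≤ D.power (s + 1) q := by
  cases s with
  | zero => exact bot_le
  | succ s => exact le_sup_left

theorem power_mono {s t : ℕ} (h : s ≤ t) (q : M) : D.power s q ≤ D.power t q :=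
  monotone_nat_of_le_succ (f := fun s => D.power s q) (fun s => power_le_succ s q) h

theorem mlieBracket_mem_power (hX : IsFrameOn D X U) (hq : q ∈ U) (j : Fin m)
    {Y : (q : M) → TangentSpace (𝓡 n) q} (hY : SmoothFieldOn Y U)
    (hYs : ∀ x ∈ U, Y x ∈ D.power (s + 1) x) :
    mlieBracket (𝓡 n) (X j) Y q ∈ D.power (s + 2) q :=
  Submodule.mem_sup_right (Submodule.subset_span
    ⟨U, X j, Y, hX.isOpen, hq, hX.smooth j, hY, fun _ hx => hX.mem hx j, hYs, rfl⟩)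

theorem exists_frame (D : VectorDistribution m n M) (q : M) :
    ∃ U X, q ∈ U ∧ IsFrameOn D X U := by
  obtain ⟨U, hU, hq, X, hX, h⟩ := D.exists_local_basis q
  exact ⟨U, X, hq, hU, hX, fun x hx => (h x hx).1, fun x hx => (h x hx).2⟩

theorem finrank_fiber (hX : IsFrameOn D X U) (hq : q ∈ U) :
    Module.finrank ℝ (D.fiber q) = m := by
  rw [← hX.span_eq q hq, finrank_span_eq_card (hX.linearIndependent q hq), Fintype.card_fin]

/-- If `D ^ (s + 1)` grows at `q`, the bracket of some field of a frame of `D` with some field of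
a frame of `D ^ (s + 1)` is outside `D ^ (s + 1)`. -/
theorem exists_mlieBracket_notMem (hX : IsFrameOn D X U) (hq : q ∈ U) {ι : Type*} [Fintype ι]
    {Z : ι → (q : M) → TangentSpace (𝓡 n) q} (hZ : ∀ k, SmoothFieldOn (Z k) U)
    (hli : LinearIndependent ℝ fun k => Z k q)
    (hspan : ∀ x ∈ U, (LinearIndependent ℝ fun k => Z k x) →
      Submodule.span ℝ (Set.range fun k => Z k x) = D.power (s + 1) x)
    (hne : D.power (s + 2) q ≠ D.power (s + 1) q) :
    ∃ j k, mlieBracket (𝓡 n) (X j) (Z k) q ∉ D.power (s + 1) q := by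
  classical
  -- otherwise the Leibniz rule shows that all brackets of sections stay in `D ^ (s + 1)`
  by_contra! hcon
  refine hne (le_antisymm (sup_le le_rfl (Submodule.span_le.2 ?_)) (power_le_succ _ q))
  rintro v ⟨V, V₁, V₂, hV, hqV, h1, h2, h1D, h2D, rfl⟩
  obtain ⟨W, hW, hqW, hWUV, hWb, hWli⟩ := exists_isOpen_linearIndependent
    (hX.isOpen.inter hV) ⟨hq, hqV⟩ (fun k => (hZ k).mono Set.inter_subset_left) hli
  have hWU : W ⊆ U := fun x hx => (hWUV hx).1
  have hWV : W ⊆ V := fun x hx => (hWUV hx).2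
  obtain ⟨a, ha, hVa⟩ := exists_smooth_coefficients hW hWb (fun i => (hX.smooth i).mono hWU)
    (fun x hx => hX.linearIndependent x (hWU hx)) (h1.mono hWV)
    fun x hx => (hX.span_eq x (hWU hx)).symm ▸ h1D x (hWV hx)
  obtain ⟨c, hc, hVc⟩ := exists_smooth_coefficients hW hWb (fun i => (hZ i).mono hWU)
    hWli (h2.mono hWV) fun x hx => (hspan x (hWU hx) (hWli x hx)).symm ▸ h2D x (hWV hx)
  have h3 : mlieBracket (𝓡 n) V₁ V₂ q = mlieBracket (𝓡 n) (fun x => ∑ i, a i x • X i x)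
      (fun x => ∑ k, c k x • Z k x) q := by
    refine Filter.EventuallyEq.mlieBracket_vectorField_eq ?_ ?_
    · filter_upwards [hW.mem_nhds hqW] with x hx using hVa x hx
    · filter_upwards [hW.mem_nhds hqW] with x hx using hVc x hx
  rw [h3]
  refine mlieBracket_sum_smul_mem hW hqW _ _ (fun i => (hX.smooth i).mono hWU) ha
    (fun i => (hZ i).mono hWU) hc (fun i => ?_) (fun k => ?_) hcon
  · exact power_mono (s := 1) (by omega) q (hX.mem hq i)
  · rw [← hspan q hq hli]
    exact Submodule.subset_span ⟨k, rfl⟩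

end VectorDistribution

open Classical in
/-- The fields `Y 0 = X i₀` and `Y (s + 1) = [X j, Y s]`, with the index `j` chosen so that
`Y (s + 1)` is not in `D ^ (s + 1)` at `q` if there is such an index, and `Y (s + 1) = 0`
otherwise. -/
def flagField (D : VectorDistribution m n M) (X : Fin m → (q : M) → TangentSpace (𝓡 n) q)
    (i₀ : Fin m) (q : M) : ℕ → (x : M) → TangentSpace (𝓡 n) x
  | 0 => X i₀
  | s + 1 =>
    if h : ∃ j, mlieBracket (𝓡 n) (X j) (flagField D X i₀ q s) q ∉ D.power (s + 1) q then
      mlieBracket (𝓡 n) (X h.choose) (flagField D X i₀ q s) else fun _ => 0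

/-- The frame `X` of `D` followed by the fields `Y 1, …, Y s`. -/
def extendedFrame (X : Fin m → (q : M) → TangentSpace (𝓡 n) q)
    (Y : ℕ → (x : M) → TangentSpace (𝓡 n) x) (s : ℕ) :
    Fin m ⊕ Fin s → (x : M) → TangentSpace (𝓡 n) x :=
  Sum.elim X fun t => Y (t + 1)

section Flag

variable {i₀ : Fin m} {q : M} {s : ℕ} {Y : ℕ → (x : M) → TangentSpace (𝓡 n) x}

theorem smoothFieldOn_flagField (hX : IsFrameOn D X U) (i₀ : Fin m) (q : M) (s : ℕ) :
    SmoothFieldOn (flagField D X i₀ q s) U ∧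
      ∀ x ∈ U, flagField D X i₀ q s x ∈ D.power (s + 1) x := by
  induction s with
  | zero => exact ⟨hX.smooth i₀, fun x hx => hX.mem hx i₀⟩
  | succ s ih =>
    rw [flagField]
    split_ifs with h
    · exact ⟨(hX.smooth _).mlieBracket ih.1 hX.isOpen, fun x hx =>
        VectorDistribution.mlieBracket_mem_power hX hx _ ih.1 ih.2⟩
    · refine ⟨?_, fun x _ => Submodule.zero_mem _⟩
      have h1 : SmoothFieldOn (fun x => ∑ i ∈ (∅ : Finset (Fin m)), X i x) U := .sum hX.smooth
      simpa only [Finset.sum_empty] using h1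

omit [IsManifold (𝓡 n) ∞ M] in
theorem linearIndependent_extendedFrame_succ {x : M}
    (h : LinearIndependent ℝ fun k => extendedFrame X Y s k x)
    (hY : Y (s + 1) x ∉ Submodule.span ℝ (Set.range fun k => extendedFrame X Y s k x)) :
    LinearIndependent ℝ fun k => extendedFrame X Y (s + 1) k x := by
  have h1 : LinearIndependent ℝ fun o : Option (Fin m ⊕ Fin s) =>
      o.casesOn' (Y (s + 1) x) fun k => extendedFrame X Y s k x := h.option hY
  let f : Fin m ⊕ Fin (s + 1) → Option (Fin m ⊕ Fin s) :=
    Sum.elim (fun i => some (.inl i)) fun t =>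
      Fin.lastCases (motive := fun _ => Option (Fin m ⊕ Fin s)) none (fun t => some (.inr t)) t
  have hf : Function.Injective f := by
    rintro (i | t) (j | t') hk
    · simpa [f] using hk
    · induction t' using Fin.lastCases <;> simp [f] at hk
    · induction t using Fin.lastCases <;> simp [f] at hk
    · induction t using Fin.lastCases <;> induction t' using Fin.lastCases <;> simp_all [f]
  convert h1.comp f hf using 1
  funext k
  rcases k with i | t
  · rfl
  · induction t using Fin.lastCases <;> simp [f, extendedFrame]

omit [IsManifold (𝓡 n) ∞ M] in
theorem linearIndependent_extendedFrame_of_le {r : ℕ} {x : M} (hs : s ≤ r)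
    (h : LinearIndependent ℝ fun k => extendedFrame X Y r k x) :
    LinearIndependent ℝ fun k => extendedFrame X Y s k x := by
  have hf : Function.Injective (Sum.map id (Fin.castLE hs) : Fin m ⊕ Fin s → Fin m ⊕ Fin r) :=
    Function.Injective.sumMap Function.injective_id (Fin.castLE_injective hs)
  convert h.comp _ hf using 1
  funext k
  rcases k with i | t <;> rfl

theorem span_extendedFrame (hX : IsFrameOn D X U) {x : M} (hx : x ∈ U)
    (hY : ∀ s, Y s x ∈ D.power (s + 1) x)
    (hdim : Module.finrank ℝ (D.power (s + 1) x) = m + s)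
    (h : LinearIndependent ℝ fun k => extendedFrame X Y s k x) :
    Submodule.span ℝ (Set.range fun k => extendedFrame X Y s k x) = D.power (s + 1) x := by
  refine Submodule.eq_of_le_of_finrank_eq (Submodule.span_le.2 ?_) ?_
  · rintro v ⟨i | t, rfl⟩
    · exact VectorDistribution.power_mono (s := 1) (by omega) x (hX.mem hx i)
    · exact VectorDistribution.power_mono (by omega) x (hY (t + 1))
  · rw [finrank_span_eq_card h, hdim, Fintype.card_sum, Fintype.card_fin, Fintype.card_fin]

end Flag

end

/-! ### Chains of brackets along the flag -/

section

variable {m n : ℕ} {M : Type*} [TopologicalSpace M] [ChartedSpace (Model n) M]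
  [IsManifold (𝓡 n) ∞ M] {U V : Set M} {D : VectorDistribution m n M}
  {X : Fin m → (q : M) → TangentSpace (𝓡 n) q} {q : M} {i₀ : Fin m} {r s : ℕ}

/-- If the powers of `D` grow by one dimension at each step, and `[X j, X i₀]` is not in `D` at
`q`, the fields of the flag are linearly independent and grow the flag at `q`. -/
theorem linearIndependent_extendedFrame_flagField (hX : IsFrameOn D X U) (hq : q ∈ U)
    (hdim : ∀ s ≤ r, ∀ x, Module.finrank ℝ (D.power (s + 1) x) = m + s)
    (hi₀ : 0 < r → ∃ j, mlieBracket (𝓡 n) (X j) (X i₀) q ∉ D.power 1 q) (hs : s ≤ r) :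
    LinearIndependent ℝ (fun k => extendedFrame X (flagField D X i₀ q) s k q) ∧
      (s < r → ∃ j, mlieBracket (𝓡 n) (X j) (flagField D X i₀ q s) q ∉ D.power (s + 1) q) := by
  have hY := smoothFieldOn_flagField hX i₀ q
  induction s with
  | zero =>
    refine ⟨?_, hi₀⟩
    convert (hX.linearIndependent q hq).comp
      (Sum.elim id fun t : Fin 0 => t.elim0 : Fin m ⊕ Fin 0 → Fin m) ?_ using 1
    · funext k
      rcases k with i | t
      · rfl
      · exact t.elim0
    · rintro (i | t) (j | t') h
      · exact congrArg _ h
      · exact t'.elim0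
      · exact t.elim0
      · exact t.elim0
  | succ s ih =>
    obtain ⟨hli, hout⟩ := ih (by omega)
    have hli' : LinearIndependent ℝ
        fun k => extendedFrame X (flagField D X i₀ q) (s + 1) k q := by
      refine linearIndependent_extendedFrame_succ hli ?_
      have h := hout (by omega)
      rw [span_extendedFrame hX hq (fun s => (hY s).2 q hq) (hdim s (by omega) q) hli, flagField,
        dif_pos h]
      exact h.choose_spec
    refine ⟨hli', fun hsr => ?_⟩
    have hne : D.power (s + 3) q ≠ D.power (s + 2) q := fun h => by
      have h1 := hdim (s + 2) (by omega) q
      rw [show s + 2 + 1 = s + 3 from rfl, h, hdim (s + 1) (by omega) q] at h1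
      omega
    have hZ : ∀ k, SmoothFieldOn (extendedFrame X (flagField D X i₀ q) (s + 1) k) U := by
      rintro (i | t)
      · exact hX.smooth i
      · exact (hY _).1
    obtain ⟨j, k, hjk⟩ := VectorDistribution.exists_mlieBracket_notMem (s := s + 1) hX hq hZ hli'
      (fun x hx h => span_extendedFrame hX hx (fun s => (hY s).2 x hx)
        (hdim (s + 1) (by omega) x) h) hne
    refine ⟨j, ?_⟩
    rcases k with i | t
    · exact absurd (VectorDistribution.power_mono (show 2 ≤ s + 1 + 1 by omega) q
        (VectorDistribution.mlieBracket_mem_power (s := 0) hX hq j (hX.smooth i)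
          fun x hx => hX.mem hx i)) hjk
    -- the brackets with the earlier fields are in `D ^ (s + 2)`
    · have ht : (t : ℕ) = s := by
        by_contra hts
        exact hjk (VectorDistribution.power_mono (show (t : ℕ) + 1 + 2 ≤ s + 1 + 1 by omega) q
          (VectorDistribution.mlieBracket_mem_power hX hq j (hY (t + 1)).1 (hY (t + 1)).2))
      change mlieBracket (𝓡 n) (X j) (flagField D X i₀ q (t + 1)) q ∉ D.power (s + 2) q at hjk
      rwa [ht] at hjk

/-- The expansion of a smooth field in the extended frame, written as a sum over `ℕ`. -/
theorem exists_coefficients_extendedFrame {k l : ℕ} (hk : k ≤ l) (hV : IsOpen V)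
    {Y : ℕ → (x : M) → TangentSpace (𝓡 n) x} {W : (x : M) → TangentSpace (𝓡 n) x}
    (hVb : V ⊆ (trivializationAt (Model n) (TangentSpace (𝓡 n)) q).baseSet)
    (hX : ∀ i, SmoothFieldOn (X i) V) (hY : ∀ s, SmoothFieldOn (Y s) V)
    (hli : ∀ x ∈ V, LinearIndependent ℝ fun i => extendedFrame X Y k i x)
    (hW : SmoothFieldOn W V)
    (hspan : ∀ x ∈ V, W x ∈ Submodule.span ℝ (Set.range fun i => extendedFrame X Y k i x)) :
    ∃ (A : Fin m → M → ℝ) (B : ℕ → M → ℝ), (∀ i, ContMDiffOn (𝓡 n) 𝓘(ℝ, ℝ) ∞ (A i) V) ∧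
      (∀ t, ContMDiffOn (𝓡 n) 𝓘(ℝ, ℝ) ∞ (B t) V) ∧
      (∀ x ∈ V, W x = ∑ i, A i x • X i x + ∑ t ∈ Finset.range l, B t x • Y (t + 1) x) ∧
      ∀ t, k ≤ t → B t = fun _ => 0 := by
  obtain ⟨c, hc, hWc⟩ := exists_smooth_coefficients hV hVb (Z := extendedFrame X Y k)
    (by rintro (i | t); exacts [hX i, hY _]) hli hW hspan
  refine ⟨fun i => c (.inl i), fun t => if h : t < k then c (.inr ⟨t, h⟩) else fun _ => 0,
    fun i => hc _, fun t => ?_, fun x hx => ?_, fun t ht => dif_neg (by omega)⟩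
  · dsimp only
    split_ifs with h
    · exact hc _
    · exact contMDiffOn_const
  · rw [hWc x hx, Fintype.sum_sum_type]
    congr 1
    rw [← Finset.sum_subset (Finset.range_subset_range.2 hk) fun t _ ht => by
      dsimp only
      rw [dif_neg (by simpa using ht), zero_smul], Finset.sum_range]
    refine Finset.sum_congr rfl fun t _ => ?_
    dsimp only
    rw [dif_pos t.2]
    rfl

/-- A distribution whose powers grow by one dimension at each step up to the tangent bundle has a
chain of brackets near each point. -/
theorem exists_isBracketChain (hX : IsFrameOn D X U) (hq : q ∈ U) (hm : 0 < m) (hr : m + r = n)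
    (hdim : ∀ s ≤ r, ∀ x, Module.finrank ℝ (D.power (s + 1) x) = m + s) :
    ∃ V i₀ Y A B, IsOpen V ∧ q ∈ V ∧ V ⊆ U ∧ IsBracketChain X i₀ Y r A B V q := by
  obtain ⟨i₀, hi₀⟩ :
      ∃ i₀, 0 < r → ∃ j, mlieBracket (𝓡 n) (X j) (X i₀) q ∉ D.power 1 q := by
    by_cases hr0 : 0 < r
    · have hne : D.power 2 q ≠ D.power 1 q := fun h => by
        have h1 := hdim 1 (by omega) q
        rw [show 1 + 1 = 2 from rfl, h, hdim 0 (by omega) q] at h1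
        omega
      obtain ⟨j, i₀, h⟩ := VectorDistribution.exists_mlieBracket_notMem (s := 0) hX hq hX.smooth
        (hX.linearIndependent q hq) (fun x hx _ => hX.span_eq x hx) hne
      exact ⟨i₀, fun _ => ⟨j, h⟩⟩
    · exact ⟨⟨0, hm⟩, fun h => absurd h hr0⟩
  have hflag := fun s (hs : s ≤ r) =>
    linearIndependent_extendedFrame_flagField hX hq hdim hi₀ hs
  have hY := smoothFieldOn_flagField hX i₀ q
  set Y := flagField D X i₀ q
  obtain ⟨V, hV, hqV, hVU, hVb, hli⟩ := exists_isOpen_linearIndependent hX.isOpen hq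
    (Z := extendedFrame X Y r) (by rintro (i | t); exacts [hX.smooth i, (hY _).1])
    (hflag r le_rfl).1
  have hspan : ∀ s ≤ r, ∀ x ∈ V,
      Submodule.span ℝ (Set.range fun k => extendedFrame X Y s k x) = D.power (s + 1) x :=
    fun s hs x hx => span_extendedFrame hX (hVU hx) (fun s => (hY s).2 x (hVU hx)) (hdim s hs x)
      (linearIndependent_extendedFrame_of_le hs (hli x hx))
  have hcoef : ∀ s j, ∃ (A : Fin m → M → ℝ) (B : ℕ → M → ℝ), s ≤ r →
      (∀ i, ContMDiffOn (𝓡 n) 𝓘(ℝ, ℝ) ∞ (A i) V) ∧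
      (∀ t, ContMDiffOn (𝓡 n) 𝓘(ℝ, ℝ) ∞ (B t) V) ∧
      (∀ x ∈ V, mlieBracket (𝓡 n) (X j) (Y s) x =
        ∑ i, A i x • X i x + ∑ t ∈ Finset.range (s + 1), B t x • Y (t + 1) x) ∧
      ∀ t, min (s + 1) r ≤ t → B t = fun _ => 0 := by
    intro s j
    by_cases hs : s ≤ r
    · obtain ⟨A, B, h⟩ := exists_coefficients_extendedFrame (X := X) (k := min (s + 1) r)
        (min_le_left _ _) hV hVb (fun i => (hX.smooth i).mono hVU) (fun s => (hY s).1.mono hVU)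
        (fun x hx => linearIndependent_extendedFrame_of_le (min_le_right _ _) (hli x hx))
        (((hX.smooth j).mlieBracket (hY s).1 hX.isOpen).mono hVU) fun x hx => by
          rw [hspan _ (min_le_right _ _) x hx]
          by_cases hsr : s < r
          · rw [min_eq_left hsr]
            exact VectorDistribution.mlieBracket_mem_power hX (hVU hx) j (hY s).1 (hY s).2
          · have htop : D.power (r + 1) x = ⊤ := by
              refine Submodule.eq_top_of_finrank_eq ?_
              rw [hdim r le_rfl x, hr]
              exact finrank_euclideanSpace_fin.symm
            rw [min_eq_right (by omega), htop]
            exact Submodule.mem_top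
      exact ⟨A, B, fun _ => h⟩
    · exact ⟨0, 0, fun h => absurd h hs⟩
  choose A B hAB using hcoef
  refine ⟨V, i₀, Y, fun j s => A s j, fun j s => B s j, hV, hqV, hVU, rfl,
    fun s _ => (hY s).1.mono hVU, fun s hs j i => (hAB s j hs).1 i,
    fun s hs j t _ => (hAB s j hs).2.1 t, fun s hs j => (hAB s j hs).2.2.1,
    fun j x _ => congrFun ((hAB r j le_rfl).2.2.2 r (min_le_right _ _)) x, fun s hs => ?_⟩
  obtain ⟨j, hj⟩ := (hflag s hs.le).2 hs
  refine ⟨j, fun h0 => hj ?_⟩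
  rw [(hAB s j hs.le).2.2.1 q hqV, Finset.sum_range_succ, h0, zero_smul, add_zero]
  refine Submodule.add_mem _ (Submodule.sum_mem _ fun i _ => Submodule.smul_mem _ _ ?_)
    (Submodule.sum_mem _ fun t ht => Submodule.smul_mem _ _ ?_)
  · exact VectorDistribution.power_mono (s := 1) (by omega) q (hX.mem hq i)
  · exact VectorDistribution.power_mono (by have := Finset.mem_range.1 ht; omega) q
      ((hY (t + 1)).2 q hq)

end

/-! ### Corank one distributions -/

section

variable {m n : ℕ} {M : Type*} [TopologicalSpace M] [ChartedSpace (Model n) M]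
  [IsManifold (𝓡 n) ∞ M] {U : Set M} {D : VectorDistribution m n M} {G G₁ G₂ : Metric D}
  {X : Fin m → (q : M) → TangentSpace (𝓡 n) q} {q : M}

section DefiningForm

variable {η : (q : M) → CotangentSpace n M q}

theorem formInChart_fieldInChart (Y : (q : M) → TangentSpace (𝓡 n) q) {x : Model n}
    (hx : x ∈ (extChartAt (𝓡 n) q).target) :
    formInChart η q x (fieldInChart Y q x) =
      η ((extChartAt (𝓡 n) q).symm x) (Y ((extChartAt (𝓡 n) q).symm x)) := by
  have hs := (extChartAt (𝓡 n) q).map_target hx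
  have h2 := mfderivWithin_extChartAt_symm_comp_mfderiv_extChartAt (I := 𝓡 n) hx
  have h3 := TangentBundle.continuousLinearMapAt_trivializationAt (I := 𝓡 n) (x₀ := q)
    (x := (extChartAt (𝓡 n) q).symm x) (by rwa [extChartAt_source] at hs)
  rw [ModelWithCorners.Boundaryless.range_eq_univ, mfderivWithin_univ] at h2
  rw [formInChart, fieldInChart, h3]
  exact congrArg (η ((extChartAt (𝓡 n) q).symm x)) (DFunLike.congr_fun h2 _)

theorem formInChart_self (v : Model n) :
    formInChart η q (extChartAt (𝓡 n) q q) v = (η q : Model n →L[ℝ] ℝ) v := by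
  have hq := mem_extChartAt_target (I := 𝓡 n) q
  have h := formInChart_fieldInChart (η := η) (q := q) (coordinateField q v) hq
  rw [fieldInChart_self, extChartAt_to_inv] at h
  have h1 : (coordinateField q v q : Model n) = v := by
    rw [coordinateField, symmL_trivializationAt_self]
    rfl
  rw [h1] at h
  exact h

/-- Cartan's formula `dη (V, W) = -η [V, W]` for fields annihilated by `η`. -/
theorem extDerivForm_eq {V W : (q : M) → TangentSpace (𝓡 n) q}
    (hU : IsOpen U) (hq : q ∈ U) (hV : SmoothFieldOn V U) (hW : SmoothFieldOn W U)
    (hηV : ∀ x ∈ U, η x (V x) = 0) (hηW : ∀ x ∈ U, η x (W x) = 0)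
    (hη : DifferentiableAt ℝ (formInChart η q) (extChartAt (𝓡 n) q q)) :
    extDerivForm η q (V q) (W q) = -(η q (mlieBracket (𝓡 n) V W q)) := by
  set x₀ := extChartAt (𝓡 n) q q
  -- differentiating `η (Y) = 0` in the chart
  have key : ∀ Y : (q : M) → TangentSpace (𝓡 n) q, SmoothFieldOn Y U → (∀ x ∈ U, η x (Y x) = 0) →
      ∀ u : Model n, fderiv ℝ (formInChart η q) x₀ u (fieldInChart Y q x₀) =
        -(formInChart η q x₀ (fderiv ℝ (fieldInChart Y q) x₀ u)) := by
    intro Y hY hηY u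
    have hd := differentiableAt_fieldInChart ((hY.contMDiffAt hU hq).mdifferentiableAt (by simp))
    have h1 := hη.hasFDerivAt.clm_apply hd.hasFDerivAt
    have h2 : (fun x => formInChart η q x (fieldInChart Y q x)) =ᶠ[𝓝 x₀] fun _ => (0 : ℝ) := by
      have hc : Tendsto (extChartAt (𝓡 n) q).symm (𝓝 x₀) (𝓝 q) := by
        have := continuousAt_extChartAt_symm (I := 𝓡 n) q
        rwa [ContinuousAt, extChartAt_to_inv] at this
      filter_upwards [extChartAt_target_mem_nhds (I := 𝓡 n) q, hc (hU.mem_nhds hq)] with x hx hxU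
      rw [formInChart_fieldInChart Y hx]
      exact hηY _ hxU
    have h3 := h1.unique ((hasFDerivAt_const (0 : ℝ) x₀).congr_of_eventuallyEq h2)
    have h4 := DFunLike.congr_fun h3 u
    rw [eq_neg_iff_add_eq_zero, add_comm]
    exact h4
  have h1 : extDerivForm η q (V q) (W q) =
      fderiv ℝ (formInChart η q) x₀ (V q : Model n) (W q : Model n) -
        fderiv ℝ (formInChart η q) x₀ (W q : Model n) (V q : Model n) := rfl
  have h2 : (V q : Model n) = fieldInChart V q x₀ := (fieldInChart_self V q).symm
  have h3 : (W q : Model n) = fieldInChart W q x₀ := (fieldInChart_self W q).symm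
  have h4 := key V hV hηV (fieldInChart W q x₀)
  have h5 := key W hW hηW (fieldInChart V q x₀)
  rw [h1, h2, h3, h4, h5, mlieBracket_eq_fieldInChart]
  refine Eq.trans ?_ (congrArg Neg.neg (formInChart_self (η := η) (q := q) _))
  rw [lieBracket, map_sub]
  ring

/-- If `dη|_D` does not vanish at `q`, the bracket of `D` with itself is the tangent space. -/
theorem VectorDistribution.power_two_eq_top (hmn : m + 1 = n) (hU : IsOpen U) (hq : q ∈ U)
    (hη : D.IsDefiningForm η U) (hne : D.restrictedExtDeriv η q ≠ 0) :
    D.power 2 q = ⊤ := by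
  obtain ⟨V, X, hqV, hX⟩ := D.exists_frame q
  have hX' := hX.mono (hX.isOpen.inter hU) Set.inter_subset_left
  have hq' : q ∈ V ∩ U := ⟨hqV, hq⟩
  have hηX : ∀ i, ∀ x ∈ V ∩ U, η x (X i x) = 0 := fun i x hx =>
    (hη.2 x hx.2 _).1 (hX'.mem hx i)
  -- if the form were not differentiable, its derivative would have the junk value zero
  have hdiff : DifferentiableAt ℝ (formInChart η q) (extChartAt (𝓡 n) q q) := by
    by_contra h
    refine hne (LinearMap.ext fun v => LinearMap.ext fun w => ?_)
    change extDerivForm η q v w = 0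
    have h0 := fderiv_zero_of_not_differentiableAt h
    change fderiv ℝ (formInChart η q) (extChartAt (𝓡 n) q q) (v : TangentSpace (𝓡 n) q)
      (w : TangentSpace (𝓡 n) q) - fderiv ℝ (formInChart η q) (extChartAt (𝓡 n) q q)
      (w : TangentSpace (𝓡 n) q) (v : TangentSpace (𝓡 n) q) = 0
    rw [h0]
    exact sub_self 0
  -- some bracket of fields of the frame is transverse to `D`
  obtain ⟨i, j, hij⟩ : ∃ i j, η q (mlieBracket (𝓡 n) (X i) (X j) q) ≠ 0 := by
    by_contra! hcon
    refine hne (LinearMap.ext_on_range (Metric.span_toFiber hX hqV) fun i =>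
      LinearMap.ext_on_range (Metric.span_toFiber hX hqV) fun j => ?_)
    change extDerivForm η q (toFiber D (X i) q) (toFiber D (X j) q) = 0
    rw [coe_toFiber (hX.mem hqV i), coe_toFiber (hX.mem hqV j),
      extDerivForm_eq hX'.isOpen hq' (hX'.smooth i) (hX'.smooth j) (hηX i) (hηX j) hdiff, hcon,
      neg_zero]
  have hmem := mlieBracket_mem_power (s := 0) hX hqV i (hX.smooth j) fun x hx => hX.mem hx j
  have hlt : D.fiber q < D.power 2 q := by
    refine lt_of_le_of_ne (power_le_succ 1 q) fun h => hij ?_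
    rw [← hη.2 q hq, h]
    exact hmem
  refine Submodule.eq_top_of_finrank_eq (le_antisymm (Submodule.finrank_le _) ?_)
  have h1 := Submodule.finrank_lt_finrank_of_lt hlt
  rw [finrank_fiber hX hqV] at h1
  have h2 : Module.finrank ℝ (TangentSpace (𝓡 n) q) = n := finrank_euclideanSpace_fin
  omega

end DefiningForm

end

/-! ### The growth condition and the divisibility on a fiber -/

section

variable {m n : ℕ} {M : Type*} [TopologicalSpace M] [ChartedSpace (Model n) M]
  [IsManifold (𝓡 n) ∞ M] {U : Set M} {D : VectorDistribution m n M} {G G₁ G₂ : Metric D}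
  {X : Fin m → (q : M) → TangentSpace (𝓡 n) q} {q : M}

/-- The condition that the powers `D ^ s` grow by one dimension at each step until they fill the
tangent bundle. -/
def HasUnitGrowth (D : VectorDistribution m n M) : Prop :=
  ∀ s : ℕ, 1 ≤ s → s ≤ n - m + 1 → ∀ q : M, Module.finrank ℝ (D.power s q) = m + s - 1

namespace VectorDistribution

theorem restrictedExtDeriv_ne_zero_of_finrank_ker_lt {η : (q : M) → CotangentSpace n M q}
    (h : Module.finrank ℝ (LinearMap.ker (D.restrictedExtDeriv η q)) <
      Module.finrank ℝ (D.fiber q)) : D.restrictedExtDeriv η q ≠ 0 := by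
  intro h0
  rw [h0, LinearMap.ker_zero, finrank_top] at h
  exact lt_irrefl _ h

theorem hasUnitGrowth_of_corank_one (hmn : m + 1 = n) (h : ∀ q, D.power 2 q = ⊤) :
    HasUnitGrowth D := by
  intro s hs hs' q
  obtain ⟨U, X, hq, hX⟩ := D.exists_frame q
  obtain rfl | rfl : s = 1 ∨ s = 2 := by omega
  · exact finrank_fiber hX hq
  · rw [h q, finrank_top]
    have h2 : Module.finrank ℝ (TangentSpace (𝓡 n) q) = n := finrank_euclideanSpace_fin
    omega

theorem hasUnitGrowth (hm : 2 ≤ m) (h : D.IsTangentBundle ∨ D.IsContact ∨ D.IsQuasiContact) :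
    HasUnitGrowth D := by
  rcases h with h | h | h
  · intro s hs hs' q
    obtain ⟨U, X, hq, hX⟩ := D.exists_frame q
    have h1 := finrank_fiber hX hq
    have h2 : Module.finrank ℝ (TangentSpace (𝓡 n) q) = n := finrank_euclideanSpace_fin
    rw [h q, finrank_top] at h1
    obtain rfl : s = 1 := by omega
    exact finrank_fiber hX hq
  · refine hasUnitGrowth_of_corank_one h.corank_one fun q => ?_
    obtain ⟨U, hU, hq, η, hη, hker⟩ := h.exists_form q
    obtain ⟨V, X, hqV, hX⟩ := D.exists_frame q
    refine power_two_eq_top h.corank_one hU hq hη (restrictedExtDeriv_ne_zero_of_finrank_ker_lt ?_)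
    rw [hker q hq, finrank_bot, finrank_fiber hX hqV]
    omega
  · refine hasUnitGrowth_of_corank_one h.corank_one fun q => ?_
    obtain ⟨U, hU, hq, η, hη, hker⟩ := h.exists_form q
    obtain ⟨V, X, hqV, hX⟩ := D.exists_frame q
    refine power_two_eq_top h.corank_one hU hq hη (restrictedExtDeriv_ne_zero_of_finrank_ker_lt ?_)
    rw [hker q hq, finrank_fiber hX hqV]
    omega

theorem rank_le (hX : IsFrameOn D X U) (hq : q ∈ U) : m ≤ n := by
  have h1 := Submodule.finrank_le (D.fiber q)
  rw [finrank_fiber hX hq] at h1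
  exact h1.trans_eq finrank_euclideanSpace_fin

end VectorDistribution

namespace Metric

theorem exists_mem_levelSet (hX : IsFrameOn D X U) (hq : q ∈ U) (hm : 0 < m) :
    ∃ p : CotangentSpace n M q, (⟨q, p⟩ : CotangentBundle n M) ∈ G.levelSet := by
  let i : Fin m := ⟨0, hm⟩
  have hpos : 0 < G.gram X q i i := G.pos q _ ((linearIndependent_toFiber hX hq).ne_zero i)
  obtain ⟨p, hp⟩ := exists_covector_coeff G hX hq
    (Pi.single i (Real.sqrt (G.gram X q i i))⁻¹)
  refine ⟨p, ?_⟩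
  have h1 := hamiltonian_eq_sum_gram (G := G) hX (lam := (⟨q, p⟩ : CotangentBundle n M)) hq
  change G.hamiltonian ⟨q, p⟩ = 1 / 2
  rw [h1]
  simp only [hp, Pi.single_apply, ite_mul, mul_ite, zero_mul, mul_zero, Finset.sum_ite_eq',
    Finset.mem_univ, if_true]
  rw [← mul_inv, Real.mul_self_sqrt hpos.le, inv_mul_cancel₀ hpos.ne', mul_one]

/-- The divisibility on the fiber over `q`, from trajectories of the two flows linked over all small
neighborhoods of `q`. -/
theorem exists_dvd_of_linkedTrajectories (hU : IsOpen U) (hq : q ∈ U)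
    (hD : 2 ≤ m → HasUnitGrowth D) {O : Set (CotangentBundle n M)} (hO : IsOpen O)
    (h0 : 2 ≤ m → ∃ p₀ : CotangentSpace n M q, (⟨q, p₀⟩ : CotangentBundle n M) ∈ O ∩ G₁.levelSet)
    (hL : ∀ (V : Set M) (X : Fin m → (q : M) → TangentSpace (𝓡 n) q), IsFrameOn D X V → q ∈ V →
      V ⊆ U → ∀ p : CotangentSpace n M q, (⟨q, p⟩ : CotangentBundle n M) ∈ O ∩ G₁.levelSet →
      ∃ lam mu a J, LinkedTrajectories G₁ G₂ V lam mu a J ∧ (0 : ℝ) ∈ J ∧ lam 0 = ⟨q, p⟩)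
    (b : Module.Basis (Fin n) ℝ (TangentSpace (𝓡 n) q)) :
    ∃ P R : MvPolynomial (Fin n) ℝ, P.IsHomogeneous 2 ∧ R.IsHomogeneous 3 ∧
      IsFiberPolynomial (transitionQuadric G₁ G₂) q b P ∧
      IsFiberPolynomial (transitionCubic G₁ G₂) q b R ∧ P ∣ R := by
  obtain ⟨W, X, hqW, hX⟩ := D.exists_frame q
  refine exists_dvd_of_fiberDvd hX hqW fun P hP hFP => ?_
  by_cases hm : m ≤ 1
  · exact fiberDvd_of_rank_le_one hX hqW hm hFP
  have hm2 : 2 ≤ m := by omega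
  have hmn := VectorDistribution.rank_le hX hqW
  have hXU := hX.mono (hX.isOpen.inter hU) Set.inter_subset_left
  obtain ⟨V, i₀, Y, A, B, hV, hqV, hVW, hY⟩ := exists_isBracketChain (r := n - m) hXU
    ⟨hqW, hq⟩ (by omega) (by omega) fun s hs x => by
      rw [hD hm2 (s + 1) (by omega) (by omega) x]
      omega
  have hXV := hXU.mono hV hVW
  obtain ⟨p₀, hp₀⟩ := h0 hm2
  exact hY.fiberDvd_transitionCubic hXV hqV hm2 hP hFP hO hp₀
    (hL V X hXV hqV fun x hx => (hVW hx).2)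

end Metric

end

end SubRiem

end

theorem corollary1 {m n : ℕ} {M : Type*} [TopologicalSpace M] [T2Space M]
    [ChartedSpace (SubRiem.Model n) M] [IsManifold (𝓡 n) ∞ M]
    (D : SubRiem.VectorDistribution m n M) (G₁ G₂ : SubRiem.Metric D) :
    ((D.IsTangentBundle ∨ D.IsContact ∨ D.IsQuasiContact) →
      ∀ q₀ : M, G₁.GeodesicallyEquivalentAt G₂ q₀ →
        ∃ U : Set M, IsOpen U ∧ q₀ ∈ U ∧ G₁.FirstDivisibility G₂ U) ∧
    ((∀ s : ℕ, 1 ≤ s → s ≤ n - m + 1 →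
        ∀ q : M, Module.finrank ℝ (D.power s q) = m + s - 1) →
      ∀ U : Set M, IsOpen U →
        ∀ (B : Set (SubRiem.CotangentBundle n M))
          (Φ : SubRiem.CotangentBundle n M → SubRiem.CotangentBundle n M),
          G₁.IsOrbitalDiffeo G₂ B Φ →
          Bundle.TotalSpace.proj '' B = U → G₁.FirstDivisibility G₂ U) := by
  refine ⟨fun hD q₀ ⟨U, hU, hq₀, hsub, _⟩ => ⟨U, hU, hq₀, fun q hq b => ?_⟩,
    fun hD U hU B Φ hΦ hBU q hq b => ?_⟩
  · refine SubRiem.Metric.exists_dvd_of_linkedTrajectories hU hq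
      (fun hm => SubRiem.VectorDistribution.hasUnitGrowth hm hD) isOpen_univ (fun hm => ?_)
      (fun V X hX hqV hVU p hp => hsub.exists_linkedTrajectories hX hVU hp.2 hqV) b
    obtain ⟨V, X, hqV, hX⟩ := D.exists_frame q
    obtain ⟨p, hp⟩ := SubRiem.Metric.exists_mem_levelSet (G := G₁) hX hqV (by omega)
    exact ⟨p, Set.mem_univ _, hp⟩
  · obtain ⟨O, hO, hBO⟩ := hΦ.isOpen
    refine SubRiem.Metric.exists_dvd_of_linkedTrajectories hU hq (fun _ => hD) hO (fun _ => ?_)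
      (fun V X hX hqV _ p hp => hΦ.exists_linkedTrajectories hX (hBO ▸ hp) hqV) b
    rw [← hBU] at hq
    obtain ⟨⟨x, p⟩, hp, rfl⟩ := hq
    exact ⟨p, hBO ▸ hp⟩
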